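/- **Theorem 4.** For $n\ge 2$ let $\mathcal E=\{(i,j):1\le i<j\le n\}$, and encode a graph on the vertices $\{1,\dots,n\}$ by $Y\in\{-1,1\}^{\mathcal E}$, where $Y_{ij}=1$ if $(i,j)$ is an edge and $Y_{ij}=-1$ otherwise; put $Y_{ji}=Y_{ij}$, $Y_{ii}=0$ and $k_i=\sum_{j=1}^n Y_{ij}$. For $\theta>0$ and $\bm\beta\in\mathbb R^n$, the degree corrected two-star ERGM is the probability mass function $$\mathbb P_{n,\theta,\bm\beta}(Y)=\frac1{Z_n(\bm\beta,\theta)}\exp\Big\{\frac{\theta}{n-1}\sum_{i=1}^n\sum_{j<k}Y_{ij}Y_{ik}+\frac12\sum_{i=1}^n\beta_ik_i\Big\},\qquad Y\in\{-1,1\}^{\mathcal E}.$$ For $\beta_0\in\mathbb R$ and $s,A>0$ consider testing $\mathcal H_0:\bm\beta=\beta_0\mathbf 1$ against $\mathcal H_1:\bm\beta\in\Xi(s,A)$, where $$\Xi(s,A)=\{\beta_0\mathbf 1+\bm\mu:\ |\mathrm{supp}\,\bm\mu|\ge s,\ \mu_i\ge A\text{ for all }i\in\mathrm{supp}\,\bm\mu\}.$$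 A test is a function $T_n:\{-1,1\}^{\mathcal E}\to\{0,1\}$, and its risk is $$R(T_n)=\mathbb P_{n,\theta,\beta_0\mathbf 1}(T_n(Y)=1)+\sup_{\bm\beta\in\Xi(s,A)}\mathbb P_{n,\theta,\bm\beta}(T_n(Y)=0).$$ A sequence of tests $(T_n)$ is asymptotically powerful if $\lim_{n}R(T_n)=0$, and asymptotically not powerful if $\liminf_{n}R(T_n)>0$. For $e\in\mathcal E$ write $D_e(Y)=Y_e-\mathbb E_{n,\theta,\beta_0\mathbf 1}(Y_e\mid Y_f:f\ne e)$. The conditionally centered sum test with cut-off $L_n$ equals $1$ if $\sum_{e\in\mathcal E}D_e(Y)>L_n$ and $0$ otherwise; the conditionally centered max test with cut-off $L_n$ equals $1$ if $\max_{1\le i\le n}\sum_{e\ni i}D_e(Y)>L_n$ and $0$ otherwise. Let $\theta>1/2$ and $\beta_0=0$. Then there is a constant $C>0$, depending only on $\theta$, such that for all $b\in(0,1)$ and $t<0$ the following holds for the testing problem with $s=n^b$ and $A=n^t$. (a) If $b\ge\frac12$ and $b+t<0$, all sequences of tests are asymptotically not powerful. (b) If $b\ge\frac12$ and $b+t>0$,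 then the conditionally centered sum test with cut-off $L_n$ is asymptotically powerful for every sequence $(L_n)$ with $L_n/n\to\infty$ and $L_n/(nsA)\to0$. (c) If $b<\frac12$ and $t\le-\frac12$, all sequences of tests are asymptotically not powerful. (d) If $b<\frac12$ and $t>-\frac12$, then the conditionally centered max test with cut-off $L_n=C\sqrt{n\log n}$ is asymptotically powerful. -/

import Mathlib

open Filter Topology

noncomputable section

namespace TwoStar

/-- The edges `(i, j)`, `i < j`, of the complete graph on `n` vertices. -/
abbrev Edge (n : ℕ) : Type := {e : Fin n × Fin n // e.1 < e.2}

/-- Graphs on `n` labelled vertices, encoded as points of `{-1, 1} ^ (n choose 2)`: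
the value is `+1` at the edges that are present and `-1` at those that are absent. -/
abbrev Config (n : ℕ) : Type := Edge n → ℤˣ

/-- The value `Y_e ∈ {-1, 1}` as a real number. -/
def edgeVal {n : ℕ} (Y : Config n) (e : Edge n) : ℝ := ((Y e : ℤ) : ℝ)

/-- The symmetric `n × n` matrix `Y_{ij}` with entries `±1` off the diagonal and `0` on it. -/
def adj {n : ℕ} (Y : Config n) (i j : Fin n) : ℝ :=
  if h : i < j then edgeVal Y ⟨(i, j), h⟩
  else if h : j < i then edgeVal Y ⟨(j, i), h⟩
  else 0

/-- The "degree" `k_i = ∑_j Y_{ij}`. -/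
def deg {n : ℕ} (Y : Config n) (i : Fin n) : ℝ := ∑ j, adj Y i j

/-- The two-star statistic `∑_i ∑_{j < k} Y_{ij} Y_{ik}`. -/
def twoStarCount {n : ℕ} (Y : Config n) : ℝ :=
  ∑ i, ∑ j, ∑ k ∈ Finset.Ioi j, adj Y i j * adj Y i k

/-- The unnormalized weight of a configuration. -/
def weight {n : ℕ} (θ : ℝ) (β : Fin n → ℝ) (Y : Config n) : ℝ :=
  Real.exp (θ / ((n : ℝ) - 1) * twoStarCount Y + 1 / 2 * ∑ i, β i * deg Y i)

/-- The normalizing constant. -/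
def partitionFn {n : ℕ} (θ : ℝ) (β : Fin n → ℝ) : ℝ := ∑ Y : Config n, weight θ β Y

/-- The probability mass function of the degree corrected two-star model. -/
def mass {n : ℕ} (θ : ℝ) (β : Fin n → ℝ) (Y : Config n) : ℝ :=
  weight θ β Y / partitionFn θ β

open Classical in
/-- The probability of an event in the degree corrected two-star model. -/
def prob {n : ℕ} (θ : ℝ) (β : Fin n → ℝ) (S : Set (Config n)) : ℝ :=
  ∑ Y : Config n with Y ∈ S, mass θ β Y

open Classical in
/-- The conditional expectation `E(Y_e | Y_f : f ≠ e)`, at the configuration `Y`: the average of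
`Y'_e` over the configurations `Y'` that agree with `Y` at every edge other than `e`. -/
def condMean {n : ℕ} (θ : ℝ) (β : Fin n → ℝ) (e : Edge n) (Y : Config n) : ℝ :=
  (∑ Y' : Config n with ∀ f, f ≠ e → Y' f = Y f, mass θ β Y' * edgeVal Y' e) /
    ∑ Y' : Config n with ∀ f, f ≠ e → Y' f = Y f, mass θ β Y'

/-- The null parameter vector `β₀ 1`. -/
def nullParam (n : ℕ) (β₀ : ℝ) : Fin n → ℝ := fun _ => β₀

/-- The alternative `Ξ(s, A)`: vectors `β₀ 1 + μ` such that `μ` has at least `s` nonzero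
coordinates, each of them at least `A`. -/
def alternative (n : ℕ) (β₀ s A : ℝ) : Set (Fin n → ℝ) :=
  {β | ∃ μ : Fin n → ℝ, β = nullParam n β₀ + μ ∧
    s ≤ ((Function.support μ).ncard : ℝ) ∧ ∀ i ∈ Function.support μ, A ≤ μ i}

/-- A (non-randomized) test; the value `1` means that the null hypothesis is rejected. -/
abbrev Test (n : ℕ) : Type := Config n → Fin 2

/-- Type I error plus worst-case type II error. -/
def risk {n : ℕ} (θ β₀ s A : ℝ) (T : Test n) : ℝ :=
  prob θ (nullParam n β₀) {Y | T Y = 1} +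
    ⨆ β : alternative n β₀ s A, prob θ (β : Fin n → ℝ) {Y | T Y = 0}

/-- The risk tends to `0`. -/
def AsympPowerful (θ β₀ : ℝ) (s A : ℕ → ℝ) (T : ∀ n, Test n) : Prop :=
  Tendsto (fun n => risk θ β₀ (s n) (A n) (T n)) atTop (𝓝 0)

/-- The lower limit of the risk is positive. -/
def AsympNotPowerful (θ β₀ : ℝ) (s A : ℕ → ℝ) (T : ∀ n, Test n) : Prop :=
  0 < liminf (fun n => risk θ β₀ (s n) (A n) (T n)) atTop

/-- The conditionally centered sum test with cut-off `L`. -/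
def sumTest (n : ℕ) (θ β₀ L : ℝ) : Test n := fun Y =>
  if L < ∑ e : Edge n, (edgeVal Y e - condMean θ (nullParam n β₀) e Y) then 1 else 0

/-- The conditionally centered degree of the vertex `i`, a sum over the edges that contain `i`. -/
def centeredDeg {n : ℕ} (θ β₀ : ℝ) (Y : Config n) (i : Fin n) : ℝ :=
  ∑ e : Edge n with e.1.1 = i ∨ e.1.2 = i,
    (edgeVal Y e - condMean θ (nullParam n β₀) e Y)

/-- The conditionally centered maximum degree test with cut-off `L`. -/
def maxTest (n : ℕ) (θ β₀ L : ℝ) : Test n := fun Y =>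
  if L < ⨆ i : Fin n, centeredDeg θ β₀ Y i then 1 else 0

/-- The low temperature regime `(1/2, ∞) × {0}` for `(θ, β₀)`. -/
def lowTemp : Set (ℝ × ℝ) := Set.Ioi (1 / 2) ×ˢ {0}

end TwoStar

end

/-! Upper bounds. The conditionally centered spin D_e equals Y_e − tanh(field at e), and the field
at e does not see Y_e, so D_e is orthogonal to every function of the other edges. Pairing each
configuration with its flip at e turns this into Stein's bound |E D_e F| ≤ E|F − F ∘ flip_e|
(`abs_avg_centered_mul_le`), for every parameter vector. Flipping one edge moves any sum of D_f by
at most 2 + 4θ, uniformly in n. Hence a sum over a set I of edges has second moment O(|I|), fourth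
moment O(|I|²) and a Gaussian exponential moment, and the phase transition is invisible to it. Under
an alternative, centering with the null field leaves a drift of order at least A on each edge at a
spiked vertex, since the null field is bounded by 4θ. Chebyshev then gives the power of both tests;
the type I error of the max test is a union bound with the exponential moment.

Lower bound. The method is the second moment of the likelihood ratio of a mixture of spikes. For θ >
1/2 the null law mixes two phases, with all degrees near +mn or −mn where m = tanh(2θm), and the
degree covariances under this mixture are far too large. The cure is a uniform field h = (8/m) log n
/ n² (`selectField`). It is strong enough to select the positive phase up to probability O(n⁻²),
while hn → 0; since the total degree fluctuates only by O(n) inside that phase, going back to h = 0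
costs a bounded factor (`prob_le_of_partitionFn_le`). Positive correlations (`partitionFn_mul_ge`)
carry the comparison from the null to the alternatives.

In this field the second moment for two spikes g, g' is the exponential of a quarter of the
covariance of ∑ g_i k_i and ∑ g'_i k_i at a larger parameter. The model is a ferromagnetic Ising
model on the edges, so the GHS inequality (`cov_isingWeight_antitone`, by the Ellis–Monroe rotation
of four replicas) bounds this covariance by its value at the base point. There Var k_i = O(n), and
Cov(k_i, k_j) = O(1) by exchangeability and the variance of the total degree. The prior picks one
vertex in each of about n^b blocks, which makes overlaps independent over blocks; the second moment
stays bounded when A²n ≤ 1 and sA ≤ 2.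

The variance bounds come in three stages. A given degree sequence has probability at most
exp(−excess free energy) and there are at most (2n+1)^n of them, so most normalized degrees are near
a common ±m (`IsMagnetization.exists_bulk`). Each single degree then nearly solves y = tanh(θ(y ±
m)), whose root is unique, so all degrees are close to ±m (`IsMagnetization.exists_phase`). Finally
the linearized equations at m are invertible because 2θ(1 − m²) < 1, so the deviations are
controlled by centered sums (`exists_stability_bounds`), whose moments are known from Stein's bound.
-/

noncomputable section

namespace TwoStar

/-! ### Averages, covariances and exponential tilts of finite weights; the second moment bound for
testing. -/

section Average

variable {Ω : Type*}

/-- The exponential tilt of a weight. -/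
def tilt (w X : Ω → ℝ) (u : ℝ) : Ω → ℝ := fun ω => w ω * Real.exp (u * X ω)

lemma tilt_pos {w : Ω → ℝ} (hw : ∀ ω, 0 < w ω) (X : Ω → ℝ) (u : ℝ) (ω : Ω) :
    0 < tilt w X u ω := mul_pos (hw ω) (Real.exp_pos _)

lemma tilt_zero (w X : Ω → ℝ) : tilt w X 0 = w := by
  funext ω; simp [tilt]

lemma tilt_comm (w X X' : Ω → ℝ) (u v : ℝ) : tilt (tilt w X u) X' v = tilt (tilt w X' v) X u := by
  funext ω; simp only [tilt]; ring

variable [Fintype Ω]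

/-- The average of `f` with respect to the unnormalized weight `w`. -/
def avg (w f : Ω → ℝ) : ℝ := (∑ ω, w ω * f ω) / ∑ ω, w ω

/-- The covariance of `f` and `g` with respect to the unnormalized weight `w`. -/
def cov (w f g : Ω → ℝ) : ℝ := avg w (fun ω => f ω * g ω) - avg w f * avg w g

lemma avg_add (w f g : Ω → ℝ) : avg w (fun ω => f ω + g ω) = avg w f + avg w g := by
  simp only [avg, mul_add, Finset.sum_add_distrib, add_div]

lemma avg_sub (w f g : Ω → ℝ) : avg w (fun ω => f ω - g ω) = avg w f - avg w g := by
  simp only [avg, mul_sub, Finset.sum_sub_distrib, sub_div]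

lemma avg_const_mul (w f : Ω → ℝ) (c : ℝ) : avg w (fun ω => c * f ω) = c * avg w f := by
  simp only [avg, mul_left_comm _ c, ← Finset.mul_sum, mul_div_assoc]

lemma avg_mul_const (w f : Ω → ℝ) (c : ℝ) : avg w (fun ω => f ω * c) = avg w f * c := by
  simp only [mul_comm _ c, avg_const_mul]

lemma avg_neg (w f : Ω → ℝ) : avg w (fun ω => -f ω) = -avg w f := by
  simpa using avg_const_mul w f (-1)

lemma avg_sum {ι : Type*} (s : Finset ι) (w : Ω → ℝ) (f : ι → Ω → ℝ) :
    avg w (fun ω => ∑ i ∈ s, f i ω) = ∑ i ∈ s, avg w (f i) := by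
  simp only [avg, Finset.mul_sum, Finset.sum_div]
  rw [Finset.sum_comm]

lemma cov_comm (w f g : Ω → ℝ) : cov w f g = cov w g f := by
  simp only [cov, mul_comm]

lemma cov_sum_left {ι : Type*} (s : Finset ι) (w : Ω → ℝ) (f : ι → Ω → ℝ) (g : Ω → ℝ) :
    cov w (fun ω => ∑ i ∈ s, f i ω) g = ∑ i ∈ s, cov w (f i) g := by
  simp only [cov, Finset.sum_mul, avg_sum, Finset.sum_sub_distrib]

lemma cov_sum_right {ι : Type*} (s : Finset ι) (w : Ω → ℝ) (f : Ω → ℝ) (g : ι → Ω → ℝ) :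
    cov w f (fun ω => ∑ i ∈ s, g i ω) = ∑ i ∈ s, cov w f (g i) := by
  simp only [cov_comm w f, cov_sum_left]

lemma cov_const_mul_left (w f g : Ω → ℝ) (c : ℝ) :
    cov w (fun ω => c * f ω) g = c * cov w f g := by
  simp only [cov, mul_assoc, avg_const_mul]; ring

lemma cov_const_mul_right (w f g : Ω → ℝ) (c : ℝ) :
    cov w f (fun ω => c * g ω) = c * cov w f g := by
  rw [cov_comm, cov_const_mul_left, cov_comm]

lemma hasDerivAt_sum_tilt (w X f : Ω → ℝ) (u : ℝ) :
    HasDerivAt (fun u => ∑ ω, tilt w X u ω * f ω) (∑ ω, tilt w X u ω * (f ω * X ω)) u := by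
  refine HasDerivAt.fun_sum fun ω _ => ?_
  have h : HasDerivAt (fun u : ℝ => Real.exp (u * X ω)) (Real.exp (u * X ω) * (1 * X ω)) u :=
    ((hasDerivAt_id u).mul_const (X ω)).exp
  refine ((h.const_mul (w ω)).mul_const (f ω)).congr_deriv ?_
  rw [tilt]; ring

lemma hasDerivAt_sum_tilt_one (w X : Ω → ℝ) (u : ℝ) :
    HasDerivAt (fun u => ∑ ω, tilt w X u ω) (∑ ω, tilt w X u ω * X ω) u := by
  simpa using hasDerivAt_sum_tilt w X (fun _ => 1) u

variable [Nonempty Ω] {w : Ω → ℝ}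

lemma sum_weight_pos (hw : ∀ ω, 0 < w ω) : 0 < ∑ ω, w ω :=
  Finset.sum_pos (fun ω _ => hw ω) Finset.univ_nonempty

lemma avg_const (hw : ∀ ω, 0 < w ω) (c : ℝ) : avg w (fun _ => c) = c := by
  rw [avg, ← Finset.sum_mul, mul_div_assoc, mul_comm, div_mul_cancel₀ _ (sum_weight_pos hw).ne']

lemma avg_nonneg (hw : ∀ ω, 0 < w ω) {f : Ω → ℝ} (hf : ∀ ω, 0 ≤ f ω) : 0 ≤ avg w f :=
  div_nonneg (Finset.sum_nonneg fun ω _ => mul_nonneg (hw ω).le (hf ω)) (sum_weight_pos hw).le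

lemma avg_mono (hw : ∀ ω, 0 < w ω) {f g : Ω → ℝ} (h : ∀ ω, f ω ≤ g ω) : avg w f ≤ avg w g :=
  div_le_div_of_nonneg_right
    (Finset.sum_le_sum fun ω _ => mul_le_mul_of_nonneg_left (h ω) (hw ω).le) (sum_weight_pos hw).le

lemma abs_avg_le (hw : ∀ ω, 0 < w ω) (f : Ω → ℝ) : |avg w f| ≤ avg w (fun ω => |f ω|) := by
  rw [abs_le, ← avg_neg]
  exact ⟨avg_mono hw fun ω => neg_abs_le _, avg_mono hw fun ω => le_abs_self _⟩

lemma avg_sub_sq (hw : ∀ ω, 0 < w ω) (f : Ω → ℝ) (c : ℝ) :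
    avg w (fun ω => (f ω - c) ^ 2) = cov w f f + (avg w f - c) ^ 2 := by
  have : (fun ω => (f ω - c) ^ 2) = fun ω => (f ω * f ω - 2 * c * f ω) + c ^ 2 := by
    funext ω; ring
  rw [this, avg_add, avg_sub, avg_const_mul, avg_const hw, cov]; ring

lemma cov_self_nonneg (hw : ∀ ω, 0 < w ω) (f : Ω → ℝ) : 0 ≤ cov w f f := by
  have := avg_sub_sq hw f (avg w f)
  rw [sub_self, zero_pow two_ne_zero, add_zero] at this
  rw [← this]
  exact avg_nonneg hw fun ω => sq_nonneg _

lemma cov_self_le (hw : ∀ ω, 0 < w ω) (f : Ω → ℝ) (c : ℝ) :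
    cov w f f ≤ avg w (fun ω => (f ω - c) ^ 2) := by
  rw [avg_sub_sq hw f c]; nlinarith [sq_nonneg (avg w f - c)]

lemma sq_avg_sub_le (hw : ∀ ω, 0 < w ω) (f : Ω → ℝ) (c : ℝ) :
    (avg w f - c) ^ 2 ≤ avg w (fun ω => (f ω - c) ^ 2) := by
  rw [avg_sub_sq hw f c]; linarith [cov_self_nonneg hw f]

lemma hasDerivAt_avg_tilt (hw : ∀ ω, 0 < w ω) (X f : Ω → ℝ) (u : ℝ) :
    HasDerivAt (fun u => avg (tilt w X u) f) (cov (tilt w X u) f X) u := by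
  have hZ := (sum_weight_pos (tilt_pos hw X u)).ne'
  have h1 := hasDerivAt_sum_tilt w X f u
  have h2 := hasDerivAt_sum_tilt_one w X u
  refine (h1.fun_div h2 hZ).congr_deriv ?_
  rw [cov, avg, avg, avg]
  field_simp

lemma hasDerivAt_log_sum_tilt (hw : ∀ ω, 0 < w ω) (X : Ω → ℝ) (u : ℝ) :
    HasDerivAt (fun u => Real.log (∑ ω, tilt w X u ω)) (avg (tilt w X u) X) u := by
  have hZ := (sum_weight_pos (tilt_pos hw X u)).ne'
  have h2 := hasDerivAt_sum_tilt_one w X u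
  exact h2.log hZ

/-- The derivative of a tilted mean in the tilt parameter is a covariance, so this is the mean value
theorem on [0, 1]. -/
lemma exists_avg_tilt_sub_eq_cov (hw : ∀ ω, 0 < w ω) (X f : Ω → ℝ) :
    ∃ u ∈ Set.Ioo (0 : ℝ) 1, avg (tilt w X 1) f - avg w f = cov (tilt w X u) f X := by
  obtain ⟨u, hu, h⟩ := exists_hasDerivAt_eq_slope (fun u => avg (tilt w X u) f)
    (fun u => cov (tilt w X u) f X) (zero_lt_one' ℝ)
    (fun u _ => (hasDerivAt_avg_tilt hw X f u).continuousAt.continuousWithinAt)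
    (fun u _ => hasDerivAt_avg_tilt hw X f u)
  refine ⟨u, hu, ?_⟩
  rw [h, tilt_zero]; simp

/-- The mixed second difference of the log-partition function is a covariance of a tilted weight. -/
lemma exists_log_ratio_eq_cov (hw : ∀ ω, 0 < w ω) (X X' : Ω → ℝ) :
    ∃ u ∈ Set.Ioo (0 : ℝ) 1, ∃ v ∈ Set.Ioo (0 : ℝ) 1,
      (∑ ω, tilt (tilt w X' 1) X 1 ω) * (∑ ω, w ω) =
        (∑ ω, tilt w X 1 ω) * (∑ ω, tilt w X' 1 ω) *
          Real.exp (cov (tilt (tilt w X u) X' v) X X') := by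
  have hw' := tilt_pos hw X' 1
  -- Mean value theorem in the strength u of X, for the difference of the two log-partition
  -- functions; a second one, in the strength v of X', turns the difference of means into a
  -- covariance.
  obtain ⟨u, hu, h⟩ := exists_hasDerivAt_eq_slope
    (fun u => Real.log (∑ ω, tilt (tilt w X' 1) X u ω) - Real.log (∑ ω, tilt w X u ω))
    (fun u => avg (tilt (tilt w X' 1) X u) X - avg (tilt w X u) X) (zero_lt_one' ℝ)
    (fun u _ => ((hasDerivAt_log_sum_tilt hw' X u).sub
      (hasDerivAt_log_sum_tilt hw X u)).continuousAt.continuousWithinAt)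
    (fun u _ => (hasDerivAt_log_sum_tilt hw' X u).sub (hasDerivAt_log_sum_tilt hw X u))
  obtain ⟨v, hv, h'⟩ := exists_avg_tilt_sub_eq_cov (tilt_pos hw X u) X' X
  refine ⟨u, hu, v, hv, ?_⟩
  rw [← h', tilt_comm w X X', h]
  simp only [tilt_zero, sub_zero, div_one]
  have p1 := sum_weight_pos (tilt_pos hw' X 1)
  have p2 := sum_weight_pos (tilt_pos hw X 1)
  have p3 := sum_weight_pos hw'
  have p4 := sum_weight_pos hw
  rw [Real.exp_sub, Real.exp_sub, Real.exp_sub, Real.exp_log p1, Real.exp_log p2,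
    Real.exp_log p3, Real.exp_log p4]
  field_simp

lemma avg_indicator_le (hw : ∀ ω, 0 < w ω) (f : Ω → ℝ) {a : ℝ} (ha : 0 < a) (S : Set Ω)
    (hf : ∀ ω, 0 ≤ f ω) (hS : ∀ ω ∈ S, a ≤ f ω) :
    avg w (S.indicator 1) ≤ avg w f / a := by
  rw [le_div_iff₀ ha, ← avg_mul_const]
  refine avg_mono hw fun ω => ?_
  by_cases h : ω ∈ S
  · simpa [h] using hS ω h
  · simpa [h] using hf ω

end Average

/-- If the likelihood ratio of a mixture has second moment at most `M`, no test separates it well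
from the reference measure. -/
lemma testing_lower_bound {Ω ι : Type*} [Fintype Ω] [Fintype ι] [Nonempty ι] {p : Ω → ℝ}
    {q : ι → Ω → ℝ} {M : ℝ} (hM : 1 ≤ M) (hp : ∀ ω, 0 < p ω)
    (hq0 : ∀ i ω, 0 ≤ q i ω) (hq1 : ∀ i, ∑ ω, q i ω = 1)
    (h2 : ∑ i, ∑ j, ∑ ω, q i ω * q j ω / p ω ≤ M * (Fintype.card ι : ℝ) ^ 2) (R : Set Ω) :
    1 / (4 * M) ≤ ∑ ω, p ω * R.indicator 1 ω +
      (∑ i, ∑ ω, q i ω * Rᶜ.indicator 1 ω) / Fintype.card ι := by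
  classical
  have hM0 : 0 < M := by linarith
  have hc : (0 : ℝ) < Fintype.card ι := by exact_mod_cast Fintype.card_pos
  set a := ∑ ω, p ω * R.indicator 1 ω with ha
  set N : ℝ := (Fintype.card ι : ℝ)
  have hR0 : ∀ ω, (0 : ℝ) ≤ R.indicator 1 ω := fun ω => Set.indicator_nonneg (by simp) ω
  have hR1 : ∀ ω, (R.indicator 1 ω : ℝ) + Rᶜ.indicator 1 ω = 1 := fun ω => by
    by_cases h : ω ∈ R <;> simp [h]
  have ha0 : 0 ≤ a := Finset.sum_nonneg fun ω _ => mul_nonneg (hp ω).le (hR0 ω)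
  have hsplit : (∑ i, ∑ ω, q i ω * Rᶜ.indicator 1 ω) =
      N - ∑ i, ∑ ω, q i ω * R.indicator 1 ω := by
    have : ∀ i, ∑ ω, q i ω * Rᶜ.indicator 1 ω = 1 - ∑ ω, q i ω * R.indicator 1 ω := fun i => by
      rw [← hq1 i, ← Finset.sum_sub_distrib]
      refine Finset.sum_congr rfl fun ω _ => ?_
      rw [← mul_one_sub, ← hR1 ω]; ring
    simp only [this, Finset.sum_sub_distrib]
    simp [N]
  set B := ∑ i, ∑ ω, q i ω * R.indicator 1 ω with hB
  -- Cauchy–Schwarz with the weight p split as √p · √p: one factor is the p-mass of R, the other the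
  -- second moment of the likelihood ratio.
  have hcs : B ^ 2 ≤ a * (M * N ^ 2) := by
    have e1 : B = ∑ ω, (√(p ω) * R.indicator 1 ω) * ((∑ i, q i ω) / √(p ω)) := by
      rw [hB, Finset.sum_comm]
      refine Finset.sum_congr rfl fun ω _ => ?_
      have : √(p ω) ≠ 0 := (Real.sqrt_pos.2 (hp ω)).ne'
      rw [← Finset.sum_mul]; field_simp
    have e2 : a = ∑ ω, (√(p ω) * R.indicator 1 ω) ^ 2 := by
      refine Finset.sum_congr rfl fun ω _ => ?_
      rw [mul_pow, Real.sq_sqrt (hp ω).le]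
      by_cases h : ω ∈ R <;> simp [h]
    have e3 : ∑ i, ∑ j, ∑ ω, q i ω * q j ω / p ω = ∑ ω, ((∑ i, q i ω) / √(p ω)) ^ 2 := by
      rw [Finset.sum_congr rfl fun i _ => Finset.sum_comm, Finset.sum_comm]
      refine Finset.sum_congr rfl fun ω _ => ?_
      rw [div_pow, Real.sq_sqrt (hp ω).le, sq, Finset.sum_mul_sum]
      simp only [Finset.sum_div]
    rw [e1, e2]
    refine (Finset.sum_mul_sq_le_sq_mul_sq _ _ _).trans ?_
    rw [← e3]
    exact mul_le_mul_of_nonneg_left h2 (Finset.sum_nonneg fun _ _ => sq_nonneg _)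
  rw [hsplit]
  -- Either the type I error is already large, or Cauchy–Schwarz forces the average power below 1/2.
  by_cases hcase : 1 / (4 * M) ≤ a
  · have hBN : B ≤ N := by
      have : 0 ≤ N - B := hsplit ▸ Finset.sum_nonneg fun i _ => Finset.sum_nonneg fun ω _ =>
        mul_nonneg (hq0 i ω) (Set.indicator_nonneg (by simp) ω)
      linarith
    have : 0 ≤ (N - B) / N := div_nonneg (by linarith) hc.le
    linarith
  · push Not at hcase
    have h4 : a * (4 * M) < 1 := by rwa [lt_div_iff₀ (by positivity)] at hcase
    have hB2 : B ^ 2 ≤ (N / 2) ^ 2 := by nlinarith [sq_nonneg N]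
    have hB3 : B ≤ N / 2 := le_of_sq_le_sq hB2 (by positivity)
    have : 1 / 2 ≤ (N - B) / N := by rw [le_div_iff₀ hc]; linarith
    have : 1 / (4 * M) ≤ 1 / 2 := by
      apply one_div_le_one_div_of_le <;> linarith
    linarith

/-! ### Ferromagnetic Ising models: positive correlations and GHS by rotating four replicas. -/

section Ising

/-- The real value of a spin. -/
def spinVal (x : ℤˣ) : ℝ := ((x : ℤ) : ℝ)

/-- Four replicas of a single spin. -/
abbrev Quad : Type := ℤˣ × ℤˣ × ℤˣ × ℤˣ

/-- The orthogonal change of variables of Ellis and Monroe. -/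
def rot (r : Fin 4) (x : Quad) : ℝ :=
  ![(spinVal x.1 + spinVal x.2.1 + spinVal x.2.2.1 + spinVal x.2.2.2) / 2,
    (spinVal x.1 + spinVal x.2.1 - spinVal x.2.2.1 - spinVal x.2.2.2) / 2,
    (spinVal x.1 - spinVal x.2.1 + spinVal x.2.2.1 - spinVal x.2.2.2) / 2,
    (-spinVal x.1 + spinVal x.2.1 + spinVal x.2.2.1 - spinVal x.2.2.2) / 2] r

lemma sum_units_int {M : Type*} [AddCommMonoid M] (f : ℤˣ → M) : ∑ x, f x = f 1 + f (-1) := by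
  have : (Finset.univ : Finset ℤˣ) = {1, -1} := rfl
  rw [this, Finset.sum_pair (by decide)]

lemma pow_add_neg_pow_nonneg {c : ℝ} (hc : 0 ≤ c) (i : ℕ) : 0 ≤ c ^ i + (-c) ^ i := by
  rcases Nat.even_or_odd i with hi | hi
  · rw [hi.neg_pow]; positivity
  · rw [hi.neg_pow]; simp

/-- The 16 spin quadruples are rotated to the 8 points with one coordinate ±2 and the others 0
(product of spins +1), and the 8 points (u, v, w, uvw) with u, v, w = ±1 (product −1). On each
family the sum of a monomial factors into terms c^i + (−c)^i ≥ 0 and powers of 0. -/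
lemma sum_prod_rot_nonneg (a : Fin 4 → ℕ) : 0 ≤ ∑ x : Quad, ∏ r, rot r x ^ a r := by
  have h : ∑ x : Quad, ∏ r, rot r x ^ a r =
      (2 ^ a 0 + (-2) ^ a 0) * 0 ^ a 1 * 0 ^ a 2 * 0 ^ a 3 +
      0 ^ a 0 * (2 ^ a 1 + (-2) ^ a 1) * 0 ^ a 2 * 0 ^ a 3 +
      0 ^ a 0 * 0 ^ a 1 * (2 ^ a 2 + (-2) ^ a 2) * 0 ^ a 3 +
      0 ^ a 0 * 0 ^ a 1 * 0 ^ a 2 * (2 ^ a 3 + (-2) ^ a 3) +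
      (1 ^ (a 0 + a 3) + (-1) ^ (a 0 + a 3)) * (1 ^ (a 1 + a 3) + (-1) ^ (a 1 + a 3)) *
        (1 ^ (a 2 + a 3) + (-1) ^ (a 2 + a 3)) := by
    simp only [Fintype.sum_prod_type, sum_units_int, Fin.prod_univ_four, rot, spinVal,
      Matrix.cons_val]
    generalize a 0 = i
    generalize a 1 = j
    generalize a 2 = k
    generalize a 3 = l
    norm_num [pow_add]
    rcases neg_one_pow_eq_or ℝ i with hi | hi <;> rcases neg_one_pow_eq_or ℝ j with hj | hj <;>
      rcases neg_one_pow_eq_or ℝ k with hk | hk <;> rcases neg_one_pow_eq_or ℝ l with hl | hl <;>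
      rw [hi, hj, hk, hl] <;> ring
  rw [h]
  have h2 := pow_add_neg_pow_nonneg (zero_le_two (α := ℝ))
  have h1 := pow_add_neg_pow_nonneg (zero_le_one (α := ℝ))
  have h0 : ∀ i : ℕ, (0 : ℝ) ≤ 0 ^ i := fun i => by positivity
  refine add_nonneg (add_nonneg (add_nonneg (add_nonneg ?_ ?_) ?_) ?_) ?_
  all_goals
    repeat' first | exact h2 _ | exact h1 _ | exact h0 _ | apply mul_nonneg

variable {E : Type*} [Fintype E]

/-- A monomial in the rotated spins. -/
def rotMonomial (a : E → Fin 4 → ℕ) (ω : E → Quad) : ℝ := ∏ e, ∏ r, rot r (ω e) ^ a e r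

/-- The weight of an Ising model with couplings `J` and external field `b`. -/
def isingWeight (J : E → E → ℝ) (b : E → ℝ) (σ : E → ℤˣ) : ℝ :=
  Real.exp (∑ e, ∑ f, J e f * (spinVal (σ e) * spinVal (σ f)) + ∑ e, b e * spinVal (σ e))

lemma isingWeight_pos (J : E → E → ℝ) (b : E → ℝ) (σ : E → ℤˣ) : 0 < isingWeight J b σ :=
  Real.exp_pos _

/-- The rotation is orthogonal, so the coupling keeps its form; replicas 1, 2 carry the field b + c
and replicas 3, 4 the field b, which makes every linear coefficient in the rotated spins
nonnegative. -/
lemma prod_isingWeight_eq_exp (J : E → E → ℝ) (b c : E → ℝ) (ω : E → Quad) :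
    isingWeight J (b + c) (fun e => (ω e).1) * isingWeight J (b + c) (fun e => (ω e).2.1) *
      isingWeight J b (fun e => (ω e).2.2.1) * isingWeight J b (fun e => (ω e).2.2.2) =
    Real.exp (∑ e, ∑ f, J e f * (∑ r, rot r (ω e) * rot r (ω f)) +
      ∑ e, (2 * b e * rot 0 (ω e) + c e * (rot 0 (ω e) + rot 1 (ω e)))) := by
  simp only [isingWeight, ← Real.exp_add]
  congr 1
  have h1 : ∀ e f, ∑ r, rot r (ω e) * rot r (ω f) =
      spinVal (ω e).1 * spinVal (ω f).1 + spinVal (ω e).2.1 * spinVal (ω f).2.1 +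
      spinVal (ω e).2.2.1 * spinVal (ω f).2.2.1 + spinVal (ω e).2.2.2 * spinVal (ω f).2.2.2 := by
    intro e f
    simp only [Fin.sum_univ_four, rot, Matrix.cons_val]
    ring
  have h2 : ∀ e, 2 * b e * rot 0 (ω e) + c e * (rot 0 (ω e) + rot 1 (ω e)) =
      (b e + c e) * spinVal (ω e).1 + (b e + c e) * spinVal (ω e).2.1 +
      b e * spinVal (ω e).2.2.1 + b e * spinVal (ω e).2.2.2 := by
    intro e
    simp only [rot, Matrix.cons_val]
    ring
  rw [Finset.sum_congr rfl fun e _ => h2 e]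
  simp only [h1, mul_add, Finset.sum_add_distrib, Pi.add_apply]
  ring

variable [DecidableEq E]

lemma sum_rotMonomial_nonneg (a : E → Fin 4 → ℕ) : 0 ≤ ∑ ω, rotMonomial a ω := by
  have h := Finset.prod_univ_sum (fun _ : E => (Finset.univ : Finset Quad))
    (fun e x => ∏ r, rot r x ^ a e r)
  rw [Fintype.piFinset_univ] at h
  simp only [rotMonomial]
  rw [← h]
  exact Finset.prod_nonneg fun e _ => sum_prod_rot_nonneg (a e)

/-- The functions whose product with every monomial in the rotated spins has nonnegative sum. -/
def posCone (E : Type*) [Fintype E] [DecidableEq E] : Set ((E → Quad) → ℝ) :=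
  {F | ∀ a, 0 ≤ ∑ ω, F ω * rotMonomial a ω}

/-- The functions that multiply the positive cone into itself. -/
def IsPosMult (P : (E → Quad) → ℝ) : Prop :=
  ∀ F ∈ posCone E, (fun ω => P ω * F ω) ∈ posCone E

lemma one_mem_posCone : (fun _ => 1) ∈ posCone E := fun a => by
  simpa using sum_rotMonomial_nonneg a

lemma isPosMult_rot (e : E) (r : Fin 4) : IsPosMult (fun ω : E → Quad => rot r (ω e)) := by
  intro F hF a
  have h : ∀ ω : E → Quad, rot r (ω e) * F ω * rotMonomial a ω =
      F ω * rotMonomial (fun e' r' => a e' r' + if e' = e ∧ r' = r then 1 else 0) ω := fun ω => by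
    have : rotMonomial (fun e' r' => a e' r' + if e' = e ∧ r' = r then 1 else 0) ω =
        rotMonomial a ω * rot r (ω e) := by
      simp only [rotMonomial, pow_add, Finset.prod_mul_distrib]
      congr 1
      rw [Finset.prod_eq_single e, Finset.prod_eq_single r]
      · simp
      · intro b _ hb; simp [hb]
      · simp
      · intro b _ hb; simp [hb]
      · simp
    rw [this]; ring
  simp only [h]
  exact hF _

lemma IsPosMult.add {P Q : (E → Quad) → ℝ} (hP : IsPosMult P) (hQ : IsPosMult Q) :
    IsPosMult (fun ω => P ω + Q ω) := fun F hF a => by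
  have := add_nonneg (hP F hF a) (hQ F hF a)
  rw [← Finset.sum_add_distrib] at this
  simpa only [add_mul] using this

lemma IsPosMult.mul {P Q : (E → Quad) → ℝ} (hP : IsPosMult P) (hQ : IsPosMult Q) :
    IsPosMult (fun ω => P ω * Q ω) := fun F hF => by
  simpa only [mul_assoc] using hP _ (hQ F hF)

lemma IsPosMult.const_mul {P : (E → Quad) → ℝ} (hP : IsPosMult P) {c : ℝ} (hc : 0 ≤ c) :
    IsPosMult (fun ω => c * P ω) := fun F hF a => by
  have := mul_nonneg hc (hP F hF a)
  rw [Finset.mul_sum] at this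
  simpa only [mul_assoc] using this

lemma isPosMult_const {c : ℝ} (hc : 0 ≤ c) : IsPosMult (fun _ : E → Quad => c) := fun F hF a => by
  have := mul_nonneg hc (hF a)
  rw [Finset.mul_sum] at this
  simpa only [mul_assoc] using this

lemma IsPosMult.sum {ι : Type*} (s : Finset ι) {P : ι → (E → Quad) → ℝ}
    (hP : ∀ i, IsPosMult (P i)) : IsPosMult (fun ω => ∑ i ∈ s, P i ω) := by
  classical
  induction s using Finset.induction_on with
  | empty => simpa using isPosMult_const (E := E) le_rfl
  | insert i s hi ih => simpa only [Finset.sum_insert hi] using (hP i).add ih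

lemma IsPosMult.pow {P : (E → Quad) → ℝ} (hP : IsPosMult P) (k : ℕ) :
    IsPosMult (fun ω => P ω ^ k) := by
  induction k with
  | zero => simpa using isPosMult_const (E := E) zero_le_one
  | succ k ih => simpa only [pow_succ] using ih.mul hP

/-- The partial sums of the exponential series have nonnegative coefficients, and the defining
inequalities pass to the limit. -/
lemma IsPosMult.exp {P : (E → Quad) → ℝ} (hP : IsPosMult P) :
    IsPosMult (fun ω => Real.exp (P ω)) := fun F hF a => by
  have ht : Tendsto (fun N => ∑ ω, (∑ k ∈ Finset.range N, P ω ^ k / k.factorial) * F ω *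
      rotMonomial a ω) atTop (𝓝 (∑ ω, Real.exp (P ω) * F ω * rotMonomial a ω)) := by
    refine tendsto_finsetSum _ fun ω _ => ?_
    have : HasSum (fun k : ℕ => P ω ^ k / k.factorial) (Real.exp (P ω)) := by
      rw [Real.exp_eq_exp_ℝ]
      exact NormedSpace.expSeries_div_hasSum_exp (P ω)
    exact (this.tendsto_sum_nat.mul_const _).mul_const _
  refine ge_of_tendsto' ht fun N => ?_
  refine IsPosMult.sum (Finset.range N) (P := fun k ω => P ω ^ k / k.factorial) (fun k => ?_) F hF a
  simpa only [div_eq_inv_mul] using (hP.pow k).const_mul (by positivity)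

lemma IsPosMult.sum_nonneg {P : (E → Quad) → ℝ} (hP : IsPosMult P) : 0 ≤ ∑ ω, P ω := by
  simpa [rotMonomial] using hP _ one_mem_posCone (fun _ _ => 0)

lemma sum_replicas (G : (E → ℤˣ) → (E → ℤˣ) → (E → ℤˣ) → (E → ℤˣ) → ℝ) :
    ∑ ω : E → Quad, G (fun e => (ω e).1) (fun e => (ω e).2.1) (fun e => (ω e).2.2.1)
      (fun e => (ω e).2.2.2) = ∑ σ₁, ∑ σ₂, ∑ σ₃, ∑ σ₄, G σ₁ σ₂ σ₃ σ₄ := by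
  rw [← (Equiv.arrowProdEquivProdArrow E (fun _ => ℤˣ) (fun _ => ℤˣ × ℤˣ × ℤˣ)).symm.sum_comp,
    Fintype.sum_prod_type]
  refine Finset.sum_congr rfl fun σ₁ _ => ?_
  rw [← (Equiv.arrowProdEquivProdArrow E (fun _ => ℤˣ) (fun _ => ℤˣ × ℤˣ)).symm.sum_comp,
    Fintype.sum_prod_type]
  refine Finset.sum_congr rfl fun σ₂ _ => ?_
  rw [← (Equiv.arrowProdEquivProdArrow E (fun _ => ℤˣ) (fun _ => ℤˣ)).symm.sum_comp,
    Fintype.sum_prod_type]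
  rfl

lemma sum_mul_replicas (f₁ f₂ f₃ f₄ : (E → ℤˣ) → ℝ) :
    ∑ ω : E → Quad, f₁ (fun e => (ω e).1) * f₂ (fun e => (ω e).2.1) * f₃ (fun e => (ω e).2.2.1) *
      f₄ (fun e => (ω e).2.2.2) = (∑ σ, f₁ σ) * (∑ σ, f₂ σ) * (∑ σ, f₃ σ) * (∑ σ, f₄ σ) := by
  rw [sum_replicas fun σ₁ σ₂ σ₃ σ₄ => f₁ σ₁ * f₂ σ₂ * f₃ σ₃ * f₄ σ₄]
  simp only [← Finset.mul_sum, ← Finset.sum_mul]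

lemma isPosMult_prod_isingWeight {J : E → E → ℝ} {b c : E → ℝ} (hJ : ∀ e f, 0 ≤ J e f)
    (hb : ∀ e, 0 ≤ b e) (hc : ∀ e, 0 ≤ c e) :
    IsPosMult (fun ω : E → Quad => isingWeight J (b + c) (fun e => (ω e).1) *
      isingWeight J (b + c) (fun e => (ω e).2.1) * isingWeight J b (fun e => (ω e).2.2.1) *
      isingWeight J b (fun e => (ω e).2.2.2)) := by
  simp only [prod_isingWeight_eq_exp]
  refine IsPosMult.exp (IsPosMult.add (IsPosMult.sum _ fun e => IsPosMult.sum _ fun f =>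
    (IsPosMult.sum _ fun r => (isPosMult_rot e r).mul (isPosMult_rot f r)).const_mul (hJ e f))
    (IsPosMult.sum _ fun e => ?_))
  exact ((isPosMult_rot e 0).const_mul (mul_nonneg zero_le_two (hb e))).add
    (((isPosMult_rot e 0).add (isPosMult_rot e 1)).const_mul (hc e))

/-- Two independent copies give E (f − f')(g − g') = 2 Cov(f, g); the other two replicas only
contribute their normalization. -/
lemma sum_replicas_first_pair (w' w f g : (E → ℤˣ) → ℝ) :
    ∑ ω : E → Quad, w' (fun e => (ω e).1) * w' (fun e => (ω e).2.1) * w (fun e => (ω e).2.2.1) *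
      w (fun e => (ω e).2.2.2) * ((f (fun e => (ω e).1) - f (fun e => (ω e).2.1)) *
        (g (fun e => (ω e).1) - g (fun e => (ω e).2.1))) =
    2 * (∑ σ, w σ) ^ 2 * ((∑ σ, w' σ) * (∑ σ, w' σ * (f σ * g σ)) -
      (∑ σ, w' σ * f σ) * (∑ σ, w' σ * g σ)) := by
  have expand : ∀ ω : E → Quad, w' (fun e => (ω e).1) * w' (fun e => (ω e).2.1) *
      w (fun e => (ω e).2.2.1) * w (fun e => (ω e).2.2.2) *
      ((f (fun e => (ω e).1) - f (fun e => (ω e).2.1)) *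
        (g (fun e => (ω e).1) - g (fun e => (ω e).2.1))) =
      ((w' (fun e => (ω e).1) * (f (fun e => (ω e).1) * g (fun e => (ω e).1))) *
        w' (fun e => (ω e).2.1) * w (fun e => (ω e).2.2.1) * w (fun e => (ω e).2.2.2)) +
      (w' (fun e => (ω e).1) * (w' (fun e => (ω e).2.1) *
        (f (fun e => (ω e).2.1) * g (fun e => (ω e).2.1))) *
        w (fun e => (ω e).2.2.1) * w (fun e => (ω e).2.2.2)) -
      ((w' (fun e => (ω e).1) * f (fun e => (ω e).1)) *
        (w' (fun e => (ω e).2.1) * g (fun e => (ω e).2.1)) *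
        w (fun e => (ω e).2.2.1) * w (fun e => (ω e).2.2.2)) -
      ((w' (fun e => (ω e).1) * g (fun e => (ω e).1)) *
        (w' (fun e => (ω e).2.1) * f (fun e => (ω e).2.1)) *
        w (fun e => (ω e).2.2.1) * w (fun e => (ω e).2.2.2)) := by
    intro ω; ring
  simp only [expand, Finset.sum_sub_distrib, Finset.sum_add_distrib]
  rw [sum_mul_replicas (fun σ => w' σ * (f σ * g σ)) w' w w,
    sum_mul_replicas w' (fun σ => w' σ * (f σ * g σ)) w w,
    sum_mul_replicas (fun σ => w' σ * f σ) (fun σ => w' σ * g σ) w w,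
    sum_mul_replicas (fun σ => w' σ * g σ) (fun σ => w' σ * f σ) w w]
  ring

lemma sum_replicas_second_pair (w' w f g : (E → ℤˣ) → ℝ) :
    ∑ ω : E → Quad, w' (fun e => (ω e).1) * w' (fun e => (ω e).2.1) * w (fun e => (ω e).2.2.1) *
      w (fun e => (ω e).2.2.2) * ((f (fun e => (ω e).2.2.1) - f (fun e => (ω e).2.2.2)) *
        (g (fun e => (ω e).2.2.1) - g (fun e => (ω e).2.2.2))) =
    2 * (∑ σ, w' σ) ^ 2 * ((∑ σ, w σ) * (∑ σ, w σ * (f σ * g σ)) -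
      (∑ σ, w σ * f σ) * (∑ σ, w σ * g σ)) := by
  rw [← sum_replicas_first_pair w w' f g, sum_replicas (fun a b c d => w' a * w' b * w c * w d *
      ((f c - f d) * (g c - g d))), sum_replicas (fun a b c d => w a * w b * w' c * w' d *
      ((f a - f b) * (g a - g b)))]
  simp only [← Fintype.sum_prod_type']
  refine Fintype.sum_equiv ((Equiv.prodAssoc _ _ _).symm.trans ((Equiv.prodComm _ _).trans
    (Equiv.prodAssoc _ _ _))) _ _ fun x => ?_
  simp only [Equiv.trans_apply, Equiv.prodAssoc_symm_apply, Equiv.prodComm_apply, Prod.swap_prod_mk,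
    Equiv.prodAssoc_apply]
  ring

lemma cov_eq_div {w : (E → ℤˣ) → ℝ} (hZ : ∑ σ, w σ ≠ 0) (f g : (E → ℤˣ) → ℝ) :
    cov w f g = ((∑ σ, w σ) * (∑ σ, w σ * (f σ * g σ)) -
      (∑ σ, w σ * f σ) * (∑ σ, w σ * g σ)) / (∑ σ, w σ) ^ 2 := by
  simp only [cov, avg]
  field_simp

variable {J : E → E → ℝ} {b c : E → ℝ}

/-- The GHS inequality in finite form: truncated pair correlations of a ferromagnetic Ising model
decrease when a nonnegative external field grows. -/
lemma cov_isingWeight_antitone (hJ : ∀ e f, 0 ≤ J e f)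
    (hb : ∀ e, 0 ≤ b e) (hc : ∀ e, 0 ≤ c e) (e f : E) :
    cov (isingWeight J (b + c)) (fun σ => spinVal (σ e)) (fun σ => spinVal (σ f)) ≤
      cov (isingWeight J b) (fun σ => spinVal (σ e)) (fun σ => spinVal (σ f)) := by
  -- This observable is half the product of the differences of replicas 3, 4 minus half that of
  -- replicas 1, 2, so its expectation is the covariance in the field b minus the one in the field b
  -- + c.
  have key := ((isPosMult_prod_isingWeight hJ hb hc).mul
    (((isPosMult_rot e 2).mul (isPosMult_rot f 3)).add
      ((isPosMult_rot e 3).mul (isPosMult_rot f 2)))).sum_nonneg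
  have hZ : 0 < ∑ σ, isingWeight J b σ := sum_weight_pos (isingWeight_pos J b)
  have hZ' : 0 < ∑ σ, isingWeight J (b + c) σ := sum_weight_pos (isingWeight_pos J (b + c))
  have expand : ∀ ω : E → Quad, rot 2 (ω e) * rot 3 (ω f) + rot 3 (ω e) * rot 2 (ω f) =
      1 / 2 * ((spinVal (ω e).2.2.1 - spinVal (ω e).2.2.2) *
        (spinVal (ω f).2.2.1 - spinVal (ω f).2.2.2)) - 1 / 2 * ((spinVal (ω e).1 -
        spinVal (ω e).2.1) * (spinVal (ω f).1 - spinVal (ω f).2.1)) := by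
    intro ω
    simp only [rot, Matrix.cons_val]
    ring
  have h₁ := sum_replicas_first_pair (isingWeight J (b + c)) (isingWeight J b)
    (fun σ => spinVal (σ e)) (fun σ => spinVal (σ f))
  have h₂ := sum_replicas_second_pair (isingWeight J (b + c)) (isingWeight J b)
    (fun σ => spinVal (σ e)) (fun σ => spinVal (σ f))
  have split := congrArg₂ (fun x y => 1 / 2 * x - 1 / 2 * y) h₂ h₁
  dsimp only at split
  rw [Finset.mul_sum _ _ (1 / 2 : ℝ), Finset.mul_sum _ _ (1 / 2 : ℝ), ← Finset.sum_sub_distrib] at split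
  rw [Finset.sum_congr rfl fun ω _ => by 
      rw [expand, mul_sub, mul_left_comm, mul_left_comm _ (1 / 2 : ℝ)], split] at key
  rw [cov_eq_div hZ.ne', cov_eq_div hZ'.ne', div_le_div_iff₀ (by positivity) (by positivity)]
  linarith

/-- Spins of a ferromagnetic Ising model in a nonnegative field are positively correlated. -/
lemma cov_isingWeight_nonneg (hJ : ∀ e f, 0 ≤ J e f) (hb : ∀ e, 0 ≤ b e) (e f : E) :
    0 ≤ cov (isingWeight J b) (fun σ => spinVal (σ e)) (fun σ => spinVal (σ f)) := by
  -- With c = 0 the four replicas have the same law; pairing equal indices changes the difference of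
  -- the two covariances into their sum.
  have key := ((isPosMult_prod_isingWeight hJ hb (c := 0) fun _ => le_rfl).mul
    (((isPosMult_rot e 2).mul (isPosMult_rot f 2)).add
      ((isPosMult_rot e 3).mul (isPosMult_rot f 3)))).sum_nonneg
  have hZ : 0 < ∑ σ, isingWeight J b σ := sum_weight_pos (isingWeight_pos J b)
  have expand : ∀ ω : E → Quad, rot 2 (ω e) * rot 2 (ω f) + rot 3 (ω e) * rot 3 (ω f) =
      1 / 2 * ((spinVal (ω e).2.2.1 - spinVal (ω e).2.2.2) *
        (spinVal (ω f).2.2.1 - spinVal (ω f).2.2.2)) + 1 / 2 * ((spinVal (ω e).1 -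
        spinVal (ω e).2.1) * (spinVal (ω f).1 - spinVal (ω f).2.1)) := by
    intro ω
    simp only [rot, Matrix.cons_val]
    ring
  rw [add_zero] at key
  have h₁ := sum_replicas_first_pair (isingWeight J b) (isingWeight J b)
    (fun σ => spinVal (σ e)) (fun σ => spinVal (σ f))
  have h₂ := sum_replicas_second_pair (isingWeight J b) (isingWeight J b)
    (fun σ => spinVal (σ e)) (fun σ => spinVal (σ f))
  have split := congrArg₂ (fun x y => 1 / 2 * x + 1 / 2 * y) h₂ h₁
  dsimp only at split
  rw [Finset.mul_sum _ _ (1 / 2 : ℝ), Finset.mul_sum _ _ (1 / 2 : ℝ), ← Finset.sum_add_distrib] at split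
  rw [Finset.sum_congr rfl fun ω _ => by 
      rw [expand, mul_add, mul_left_comm, mul_left_comm _ (1 / 2 : ℝ)], split] at key
  rw [cov_eq_div hZ.ne']
  refine div_nonneg (nonneg_of_mul_nonneg_right (a := (∑ σ, isingWeight J b σ) ^ 2) ?_
    (by positivity)) (by positivity)
  linarith

end Ising

/-! ### The two-star model: incidence sums, edge flips, conditional means and Stein's bound. -/

section Model

variable {n : ℕ}

/-- The incidence indicator of a vertex and an edge. -/
def inc (i : Fin n) (e : Edge n) : ℝ := if e.1.1 = i ∨ e.1.2 = i then 1 else 0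

lemma inc_eq (i : Fin n) (e : Edge n) :
    inc i e = (if e.1.1 = i then 1 else 0) + (if e.1.2 = i then 1 else 0) := by
  have h := e.2
  by_cases h1 : e.1.1 = i
  · have h2 : e.1.2 ≠ i := by rintro rfl; exact absurd h1 h.ne
    simp [inc, h1, h2]
  · simp [inc, h1]

lemma inc_nonneg (i : Fin n) (e : Edge n) : 0 ≤ inc i e := by
  unfold inc; split <;> norm_num

lemma inc_mul_self (i : Fin n) (e : Edge n) : inc i e * inc i e = inc i e := by
  unfold inc; split <;> norm_num

lemma sum_inc_mul (g : Fin n → ℝ) (e : Edge n) :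
    ∑ i, inc i e * g i = g e.1.1 + g e.1.2 := by
  simp [inc_eq, add_mul, Finset.sum_add_distrib]

lemma sum_filter_incident (F : Edge n → ℝ) (i : Fin n) :
    ∑ e : Edge n with e.1.1 = i ∨ e.1.2 = i, F e = ∑ e, inc i e * F e := by
  simp [Finset.sum_filter, inc]

lemma sum_edge (F : Edge n → ℝ) :
    ∑ e, F e = ∑ i, ∑ j, if h : i < j then F ⟨(i, j), h⟩ else 0 := by
  rw [← Fintype.sum_prod_type' fun i j => if h : i < j then F ⟨(i, j), h⟩ else 0]
  refine Fintype.sum_of_injective Subtype.val Subtype.val_injective _ _ ?_ ?_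
  · intro p hp
    exact dif_neg fun h => hp ⟨⟨p, h⟩, rfl⟩
  · intro e
    rw [dif_pos e.2]

lemma sum_incident (F : Edge n → ℝ) (i : Fin n) :
    ∑ e, inc i e * F e = ∑ j, if h : i < j then F ⟨(i, j), h⟩
      else if h : j < i then F ⟨(j, i), h⟩ else 0 := by
  simp only [inc_eq, add_mul, Finset.sum_add_distrib]
  rw [sum_edge, sum_edge]
  have h1 : ∀ a : Fin n, (∑ b, if h : a < b then
      (if a = i then (1 : ℝ) else 0) * F ⟨(a, b), h⟩ else 0) =
      if a = i then ∑ b, (if h : a < b then F ⟨(a, b), h⟩ else 0) else 0 := by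
    intro a; split_ifs with h
    · simp
    · simp
  have h2 : ∀ a : Fin n, (∑ b, if h : a < b then
      (if b = i then (1 : ℝ) else 0) * F ⟨(a, b), h⟩ else 0) =
      if h : a < i then F ⟨(a, i), h⟩ else 0 := by
    intro a
    rw [Finset.sum_eq_single i]
    · simp
    · intro b _ hb; simp [hb]
    · simp
  simp only [h1, h2]
  rw [Finset.sum_ite_eq' Finset.univ i, if_pos (Finset.mem_univ i), ← Finset.sum_add_distrib]
  refine Finset.sum_congr rfl fun j _ => ?_
  rcases lt_trichotomy i j with h | h | h
  · simp [h, h.not_gt]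
  · simp [h]
  · simp [h, h.not_gt]

lemma deg_eq (Y : Config n) (i : Fin n) : deg Y i = ∑ e, inc i e * edgeVal Y e := by
  rw [sum_incident]; rfl

/-- The vertex i occurs in its n − 1 edges and every other vertex once; completing the second sum by
the term j = i leaves n − 2. -/
lemma sum_inc_mul_endpoints (g : Fin n → ℝ) (i : Fin n) :
    ∑ e, inc i e * (g e.1.1 + g e.1.2) = ((n : ℝ) - 2) * g i + ∑ j, g j := by
  rw [sum_incident]
  have h : ∀ j, (if h : i < j then g i + g j else if h : j < i then g j + g i else 0) =
      (g i + g j) - if i = j then 2 * g i else 0 := by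
    intro j
    rcases lt_trichotomy i j with h | h | h
    · simp [h, h.ne]
    · subst h; simp; ring
    · simp [h, h.not_gt, h.ne', add_comm]
  simp only [h]
  simp [Finset.sum_sub_distrib, Finset.sum_add_distrib]
  ring

lemma sum_inc (i : Fin n) : ∑ e, inc i e = (n : ℝ) - 1 := by
  have := sum_inc_mul_endpoints (fun _ => (1 / 2 : ℝ)) i
  norm_num at this
  rw [this]; ring

lemma sum_mul_deg (g : Fin n → ℝ) (Y : Config n) :
    ∑ i, g i * deg Y i = ∑ e, (g e.1.1 + g e.1.2) * edgeVal Y e := by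
  simp only [deg_eq, Finset.mul_sum, ← sum_inc_mul, Finset.sum_mul]
  rw [Finset.sum_comm]
  refine Finset.sum_congr rfl fun e _ => Finset.sum_congr rfl fun i _ => by ring

lemma sum_edge_endpoints (g : Fin n → ℝ) :
    ∑ e : Edge n, (g e.1.1 + g e.1.2) = ((n : ℝ) - 1) * ∑ i, g i := by
  simp only [← sum_inc_mul]
  rw [Finset.sum_comm, Finset.mul_sum]
  refine Finset.sum_congr rfl fun i _ => ?_
  rw [← Finset.sum_mul, sum_inc]

lemma card_edge : (Fintype.card (Edge n) : ℝ) = (n : ℝ) * ((n : ℝ) - 1) / 2 := by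
  have := sum_edge_endpoints (n := n) (fun _ => (1 / 2 : ℝ))
  norm_num at this
  rw [Fintype.card_eq_nat_card, Nat.card_eq_fintype_card]
  simp only [← Finset.card_univ] at this ⊢
  linarith

lemma edgeVal_eq_or (Y : Config n) (e : Edge n) : edgeVal Y e = 1 ∨ edgeVal Y e = -1 := by
  rcases Int.units_eq_one_or (Y e) with h | h <;> simp [edgeVal, h]

lemma edgeVal_sq (Y : Config n) (e : Edge n) : edgeVal Y e ^ 2 = 1 := by
  rcases edgeVal_eq_or Y e with h | h <;> simp [h]

lemma abs_edgeVal (Y : Config n) (e : Edge n) : |edgeVal Y e| = 1 := by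
  rcases edgeVal_eq_or Y e with h | h <;> simp [h]

lemma abs_deg_le (Y : Config n) (i : Fin n) : |deg Y i| ≤ (n : ℝ) - 1 := by
  rw [deg_eq, ← sum_inc i]
  refine (Finset.abs_sum_le_sum_abs _ _).trans (Finset.sum_le_sum fun e _ => ?_)
  rw [abs_mul, abs_edgeVal, mul_one, abs_of_nonneg (inc_nonneg i e)]

lemma sum_Ioi_mul_eq (x : Fin n → ℝ) :
    ∑ j, ∑ k ∈ Finset.Ioi j, x j * x k = ((∑ j, x j) ^ 2 - ∑ j, x j ^ 2) / 2 := by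
  have h1 : ∀ j, ∑ k ∈ Finset.Ioi j, x j * x k = ∑ k, if j < k then x j * x k else 0 := by
    intro j
    rw [← Finset.sum_filter]
    congr 1
    ext k; simp
  have h2 : (∑ j, x j) ^ 2 = ∑ j, ∑ k, ((if j < k then x j * x k else 0) +
      (if k < j then x j * x k else 0) + if j = k then x j ^ 2 else 0) := by
    rw [sq, Finset.sum_mul_sum]
    refine Finset.sum_congr rfl fun j _ => Finset.sum_congr rfl fun k _ => ?_
    rcases lt_trichotomy j k with h | h | h
    · simp [h, h.not_gt, h.ne]
    · subst h; simp [sq]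
    · simp [h, h.not_gt, h.ne']
  simp only [Finset.sum_add_distrib] at h2
  have h3 : ∑ j, ∑ k, (if k < j then x j * x k else 0) =
      ∑ j, ∑ k, if j < k then x j * x k else 0 := by
    rw [Finset.sum_comm]
    refine Finset.sum_congr rfl fun j _ => Finset.sum_congr rfl fun k _ => ?_
    rw [mul_comm]
  rw [h3] at h2
  simp only [h1]
  simp at h2
  linarith

lemma sum_adj_sq (Y : Config n) (i : Fin n) : ∑ j, adj Y i j ^ 2 = (n : ℝ) - 1 := by
  rw [← sum_inc i]
  have := sum_incident (fun _ => (1 : ℝ)) i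
  simp only [mul_one] at this
  rw [this]
  refine Finset.sum_congr rfl fun j _ => ?_
  unfold adj
  split_ifs <;> simp [edgeVal_sq]

/-- Pairs j < k are half of the square minus the diagonal, and the diagonal is constant because
Y_ij² = 1. -/
lemma twoStarCount_eq (Y : Config n) :
    twoStarCount Y = (∑ i, deg Y i ^ 2 - n * ((n : ℝ) - 1)) / 2 := by
  simp only [twoStarCount, sum_Ioi_mul_eq, sum_adj_sq]
  rw [← Finset.sum_div, Finset.sum_sub_distrib]
  simp [deg]
  ring

lemma weight_eq (hn : 2 ≤ n) (θ : ℝ) (β : Fin n → ℝ) (Y : Config n) :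
    weight θ β Y = Real.exp (-(θ * n / 2)) *
      Real.exp (θ / (2 * ((n : ℝ) - 1)) * ∑ i, deg Y i ^ 2 + 1 / 2 * ∑ i, β i * deg Y i) := by
  have : (n : ℝ) - 1 ≠ 0 := by
    have : (2 : ℝ) ≤ n := by exact_mod_cast hn
    linarith
  rw [weight, ← Real.exp_add, twoStarCount_eq]
  congr 1
  field_simp
  ring

lemma weight_pos (θ : ℝ) (β : Fin n → ℝ) (Y : Config n) : 0 < weight θ β Y := Real.exp_pos _

lemma partitionFn_pos (θ : ℝ) (β : Fin n → ℝ) : 0 < partitionFn θ β :=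
  sum_weight_pos (weight_pos θ β)

lemma mass_pos (θ : ℝ) (β : Fin n → ℝ) (Y : Config n) : 0 < mass θ β Y :=
  div_pos (weight_pos θ β Y) (partitionFn_pos θ β)

lemma sum_mass (θ : ℝ) (β : Fin n → ℝ) : ∑ Y : Config n, mass θ β Y = 1 := by
  simp only [mass, ← Finset.sum_div]
  exact div_self (partitionFn_pos θ β).ne'

lemma prob_eq_avg (θ : ℝ) (β : Fin n → ℝ) (S : Set (Config n)) :
    prob θ β S = avg (weight θ β) (S.indicator 1) := by
  classical
  simp only [prob, avg, mass, Finset.sum_filter, Finset.sum_div, partitionFn]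
  refine Finset.sum_congr rfl fun Y _ => ?_
  by_cases h : Y ∈ S <;> simp [h]

lemma prob_eq_sum (θ : ℝ) (β : Fin n → ℝ) (S : Set (Config n)) :
    prob θ β S = ∑ Y, mass θ β Y * S.indicator 1 Y := by
  classical
  simp only [prob, Finset.sum_filter]
  refine Finset.sum_congr rfl fun Y _ => ?_
  by_cases h : Y ∈ S <;> simp [h]

lemma prob_nonneg (θ : ℝ) (β : Fin n → ℝ) (S : Set (Config n)) : 0 ≤ prob θ β S :=
  Finset.sum_nonneg fun Y _ => (mass_pos θ β Y).le

lemma prob_mono (θ : ℝ) (β : Fin n → ℝ) {S T : Set (Config n)} (h : S ⊆ T) :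
    prob θ β S ≤ prob θ β T := by
  rw [prob_eq_avg, prob_eq_avg]
  refine avg_mono (weight_pos θ β) fun Y => ?_
  exact Set.indicator_le_indicator_of_subset h (fun _ => zero_le_one) Y

lemma prob_univ (θ : ℝ) (β : Fin n → ℝ) : prob θ β (Set.univ) = 1 := by
  rw [prob_eq_avg, Set.indicator_univ]
  exact avg_const (weight_pos θ β) 1

lemma prob_le_one (θ : ℝ) (β : Fin n → ℝ) (S : Set (Config n)) : prob θ β S ≤ 1 :=
  prob_univ θ β ▸ prob_mono θ β (Set.subset_univ S)

lemma prob_union_le (θ : ℝ) (β : Fin n → ℝ) (S T : Set (Config n)) :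
    prob θ β (S ∪ T) ≤ prob θ β S + prob θ β T := by
  rw [prob_eq_avg, prob_eq_avg, prob_eq_avg, ← avg_add]
  refine avg_mono (weight_pos θ β) fun Y => ?_
  by_cases h : Y ∈ S <;> by_cases h' : Y ∈ T <;> simp [h, h']

lemma prob_compl (θ : ℝ) (β : Fin n → ℝ) (S : Set (Config n)) :
    prob θ β Sᶜ = 1 - prob θ β S := by
  have h : ∀ Y, Sᶜ.indicator (1 : Config n → ℝ) Y = 1 - S.indicator 1 Y := fun Y => by
    by_cases h : Y ∈ S <;> simp [h]
  rw [prob_eq_avg, prob_eq_avg, funext h, avg_sub, avg_const (weight_pos θ β)]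

lemma prob_iUnion_le {ι : Type*} [Fintype ι] (θ : ℝ) (β : Fin n → ℝ) (S : ι → Set (Config n)) :
    prob θ β (⋃ i, S i) ≤ ∑ i, prob θ β (S i) := by
  simp only [prob_eq_avg]
  rw [← avg_sum]
  refine avg_mono (weight_pos θ β) fun Y => ?_
  have h0 : ∀ i, (0 : ℝ) ≤ (S i).indicator 1 Y := fun i => Set.indicator_nonneg (by simp) Y
  by_cases h : Y ∈ ⋃ i, S i
  · obtain ⟨i, hi⟩ := Set.mem_iUnion.1 h
    refine le_trans ?_ (Finset.single_le_sum (fun i _ => h0 i) (Finset.mem_univ i))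
    simp [h, hi]
  · rw [Set.indicator_of_notMem h]
    exact Finset.sum_nonneg fun i _ => h0 i

/-- Markov's inequality. -/
lemma prob_le_avg_div (θ : ℝ) (β : Fin n → ℝ) (f : Config n → ℝ) {a : ℝ} (ha : 0 < a)
    (S : Set (Config n)) (hf : ∀ Y, 0 ≤ f Y) (hS : ∀ Y ∈ S, a ≤ f Y) :
    prob θ β S ≤ avg (weight θ β) f / a := by
  rw [prob_eq_avg]
  exact avg_indicator_le (weight_pos θ β) f ha S hf hS

/-- Reversing the spin of one edge. -/
def flipEdge (e : Edge n) (Y : Config n) : Config n := Function.update Y e (-Y e)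

lemma flipEdge_flipEdge (e : Edge n) (Y : Config n) : flipEdge e (flipEdge e Y) = Y := by
  funext f
  by_cases h : f = e
  · subst h; simp [flipEdge]
  · simp [flipEdge, h]

lemma edgeVal_flipEdge_self (e : Edge n) (Y : Config n) :
    edgeVal (flipEdge e Y) e = -edgeVal Y e := by
  simp [edgeVal, flipEdge]

lemma edgeVal_flipEdge_of_ne {e f : Edge n} (h : f ≠ e) (Y : Config n) :
    edgeVal (flipEdge e Y) f = edgeVal Y f := by
  simp [edgeVal, flipEdge, h]

lemma deg_flipEdge (e : Edge n) (Y : Config n) (i : Fin n) :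
    deg (flipEdge e Y) i = deg Y i - 2 * inc i e * edgeVal Y e := by
  have h : ∀ f, inc i f * edgeVal (flipEdge e Y) f =
      inc i f * edgeVal Y f - if f = e then 2 * inc i e * edgeVal Y e else 0 := by
    intro f
    by_cases h : f = e
    · subst h; rw [edgeVal_flipEdge_self, if_pos rfl]; ring
    · rw [edgeVal_flipEdge_of_ne h, if_neg h]; ring
  rw [deg_eq, deg_eq, Finset.sum_congr rfl fun f _ => h f, Finset.sum_sub_distrib]
  simp

lemma sum_flipEdge (e : Edge n) (F : Config n → ℝ) : ∑ Y, F (flipEdge e Y) = ∑ Y, F Y :=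
  Equiv.sum_comp ⟨flipEdge e, flipEdge e, flipEdge_flipEdge e, flipEdge_flipEdge e⟩ F

/-- The field acting on the edge `e`: its conditional law given the others is determined by it. -/
def field (θ : ℝ) (β : Fin n → ℝ) (e : Edge n) (Y : Config n) : ℝ :=
  θ / ((n : ℝ) - 1) * (deg Y e.1.1 + deg Y e.1.2 - 2 * edgeVal Y e) + (β e.1.1 + β e.1.2) / 2

lemma inc_fst (e : Edge n) : inc e.1.1 e = 1 := by simp [inc]

lemma inc_snd (e : Edge n) : inc e.1.2 e = 1 := by simp [inc]

/-- Both endpoint degrees contain Y_e; the summand −2Y_e in `field` removes these two copies. -/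
lemma field_flipEdge_self (θ : ℝ) (β : Fin n → ℝ) (e : Edge n) (Y : Config n) :
    field θ β e (flipEdge e Y) = field θ β e Y := by
  simp only [field, deg_flipEdge, edgeVal_flipEdge_self, inc_fst, inc_snd]
  ring

lemma weight_flipEdge (hn : 2 ≤ n) (θ : ℝ) (β : Fin n → ℝ) (e : Edge n) (Y : Config n) :
    weight θ β (flipEdge e Y) = weight θ β Y * Real.exp (-2 * edgeVal Y e * field θ β e Y) := by
  have hn' : (n : ℝ) - 1 ≠ 0 := by
    have : (2 : ℝ) ≤ n := by exact_mod_cast hn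
    linarith
  rw [weight_eq hn, weight_eq hn, mul_assoc, ← Real.exp_add (_ + _)]
  congr 2
  have h1 : ∑ i, deg (flipEdge e Y) i ^ 2 =
      ∑ i, deg Y i ^ 2 - 4 * edgeVal Y e * (deg Y e.1.1 + deg Y e.1.2) + 8 := by
    have h : ∀ i, deg (flipEdge e Y) i ^ 2 =
        deg Y i ^ 2 - 4 * edgeVal Y e * (inc i e * deg Y i) + 4 * (inc i e * 1) := by
      intro i
      rw [deg_flipEdge]
      linear_combination 4 * edgeVal Y e ^ 2 * inc_mul_self i e + 4 * inc i e * edgeVal_sq Y e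
    simp only [h, Finset.sum_add_distrib, Finset.sum_sub_distrib, ← Finset.mul_sum]
    rw [sum_inc_mul (fun i => deg Y i), sum_inc_mul (fun _ => 1)]
    ring
  have h2 : ∑ i, β i * deg (flipEdge e Y) i =
      ∑ i, β i * deg Y i - 2 * edgeVal Y e * (β e.1.1 + β e.1.2) := by
    have h : ∀ i, β i * deg (flipEdge e Y) i =
        β i * deg Y i - 2 * edgeVal Y e * (inc i e * β i) := by
      intro i; rw [deg_flipEdge]; ring
    simp only [h, Finset.sum_sub_distrib, ← Finset.mul_sum]
    rw [sum_inc_mul]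
  rw [h1, h2, field]
  field_simp
  linear_combination (-8 * θ) * edgeVal_sq Y e

lemma tanh_mul_one_add_exp (x : ℝ) :
    Real.tanh x * (1 + Real.exp (-2 * x)) = 1 - Real.exp (-2 * x) := by
  rw [Real.tanh_eq, div_mul_eq_mul_div, div_eq_iff (by positivity)]
  have h : Real.exp (-2 * x) = Real.exp (-x) * Real.exp (-x) := by
    rw [← Real.exp_add]; ring_nf
  have h' : Real.exp x * Real.exp (-x) = 1 := by rw [← Real.exp_add]; simp
  rw [h]
  linear_combination (2 * Real.exp (-x)) * h'

/-- Given the other edges only Y and its flip are possible, and their weight ratio is exp(−2 Y_e ·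
field); this is the two-point identity for the mean, cleared of denominators. -/
lemma weight_balance (hn : 2 ≤ n) (θ : ℝ) (β : Fin n → ℝ) (e : Edge n) (Y : Config n) :
    Real.tanh (field θ β e Y) * (weight θ β Y + weight θ β (flipEdge e Y)) =
      edgeVal Y e * (weight θ β Y - weight θ β (flipEdge e Y)) := by
  rw [weight_flipEdge hn]
  rcases edgeVal_eq_or Y e with h | h
  · rw [h]
    have := tanh_mul_one_add_exp (field θ β e Y)
    rw [mul_one]
    linear_combination weight θ β Y * this
  · rw [h]
    have := tanh_mul_one_add_exp (-field θ β e Y)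
    rw [Real.tanh_neg] at this
    have e1 : -2 * -1 * field θ β e Y = -2 * -field θ β e Y := by ring
    rw [e1]
    linear_combination -weight θ β Y * this

lemma condMean_eq_tanh (hn : 2 ≤ n) (θ : ℝ) (β : Fin n → ℝ) (e : Edge n) (Y : Config n) :
    condMean θ β e Y = Real.tanh (field θ β e Y) := by
  classical
  have hset : (Finset.univ.filter fun Y' : Config n => ∀ f, f ≠ e → Y' f = Y f) =
      {Y, flipEdge e Y} := by
    ext Y'
    simp only [Finset.mem_filter, Finset.mem_univ, true_and, Finset.mem_insert,
      Finset.mem_singleton]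
    constructor
    · intro h
      by_cases h' : Y' e = Y e
      · left; funext f
        by_cases hf : f = e
        · rw [hf, h']
        · exact h f hf
      · right; funext f
        by_cases hf : f = e
        · subst hf
          rcases Int.units_eq_one_or (Y f) with h1 | h1 <;>
            rcases Int.units_eq_one_or (Y' f) with h2 | h2 <;> simp_all [flipEdge]
        · simp [flipEdge, hf, h f hf]
    · rintro (rfl | rfl) f hf
      · rfl
      · simp [flipEdge, hf]
  have hne : Y ≠ flipEdge e Y := by
    intro h
    have h1 := congrArg (fun Z => edgeVal Z e) h
    simp only [edgeVal_flipEdge_self] at h1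
    rcases edgeVal_eq_or Y e with h2 | h2 <;> rw [h2] at h1 <;> norm_num at h1
  have hp : 0 < mass θ β Y + mass θ β (flipEdge e Y) := add_pos (mass_pos _ _ _) (mass_pos _ _ _)
  have hZ := (partitionFn_pos θ β).ne'
  unfold condMean
  have hs : ∀ F : Config n → ℝ, (∑ Y' with ∀ f, f ≠ e → Y' f = Y f, F Y') =
      F Y + F (flipEdge e Y) := by
    intro F
    rw [← Finset.sum_pair hne, ← hset]
  rw [hs, hs, edgeVal_flipEdge_self, div_eq_iff hp.ne']
  have := weight_balance hn θ β e Y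
  simp only [mass]
  field_simp
  linear_combination -this

/-- The conditionally centered spin of an edge. -/
def centered (θ : ℝ) (β : Fin n → ℝ) (e : Edge n) (Y : Config n) : ℝ :=
  edgeVal Y e - Real.tanh (field θ β e Y)

/-- The flip preserves G and the field, and by `weight_balance` it changes the sign of weight times
centered spin, up to resummation; the sum equals its own negative. -/
lemma avg_centered_mul_eq_zero (hn : 2 ≤ n) (θ : ℝ) (β : Fin n → ℝ) (e : Edge n)
    {G : Config n → ℝ} (hG : ∀ Y, G (flipEdge e Y) = G Y) :
    avg (weight θ β) (fun Y => centered θ β e Y * G Y) = 0 := by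
  have h : ∑ Y, weight θ β Y * (centered θ β e Y * G Y) =
      -∑ Y, weight θ β Y * (centered θ β e Y * G Y) := by
    conv_lhs => rw [← sum_flipEdge e]
    rw [← Finset.sum_neg_distrib]
    refine Finset.sum_congr rfl fun Y _ => ?_
    rw [hG]
    simp only [centered, edgeVal_flipEdge_self, field_flipEdge_self]
    linear_combination -G Y * weight_balance hn θ β e Y
  rw [avg, show ∑ Y, weight θ β Y * (centered θ β e Y * G Y) = 0 by linarith, zero_div]

lemma abs_centered_le (θ : ℝ) (β : Fin n → ℝ) (e : Edge n) (Y : Config n) :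
    |centered θ β e Y| ≤ 2 := by
  refine (abs_sub _ _).trans ?_
  rw [abs_edgeVal]
  linarith [Real.abs_tanh_lt_one (field θ β e Y)]

/-- Stein's identity for a conditionally centered spin, as a bound. -/
lemma abs_avg_centered_mul_le (hn : 2 ≤ n) (θ : ℝ) (β : Fin n → ℝ) (e : Edge n)
    (F : Config n → ℝ) :
    |avg (weight θ β) (fun Y => centered θ β e Y * F Y)| ≤
      avg (weight θ β) (fun Y => |F Y - F (flipEdge e Y)|) := by
  have h0 := avg_centered_mul_eq_zero hn θ β e (G := fun Y => F Y + F (flipEdge e Y))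
    (fun Y => by rw [flipEdge_flipEdge, add_comm])
  -- Only the part of F that is odd under the flip survives; its factor 1/2 compensates the bound 2
  -- for the centered spin.
  have h1 : avg (weight θ β) (fun Y => centered θ β e Y * F Y) =
      avg (weight θ β) (fun Y => centered θ β e Y * (1 / 2 * (F Y - F (flipEdge e Y)))) := by
    have : (fun Y => centered θ β e Y * F Y) =
        fun Y => centered θ β e Y * (1 / 2 * (F Y - F (flipEdge e Y))) +
          1 / 2 * (centered θ β e Y * (F Y + F (flipEdge e Y))) := by
      funext Y; ring
    rw [this, avg_add, avg_const_mul, h0, mul_zero, add_zero]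
  rw [h1]
  refine (abs_avg_le (weight_pos θ β) _).trans (avg_mono (weight_pos θ β) fun Y => ?_)
  rw [abs_mul, abs_mul, abs_of_pos (by norm_num : (0 : ℝ) < 1 / 2)]
  have := abs_centered_le θ β e Y
  have h3 := abs_nonneg (F Y - F (flipEdge e Y))
  nlinarith

end Model

/-! ### Monotonicity and Taylor bounds for the hyperbolic tangent. -/

section Tanh

lemma hasDerivAt_tanh (x : ℝ) : HasDerivAt Real.tanh (1 - Real.tanh x ^ 2) x := by
  have h : HasDerivAt (fun x => Real.sinh x / Real.cosh x)
      ((Real.cosh x * Real.cosh x - Real.sinh x * Real.sinh x) / Real.cosh x ^ 2) x :=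
    (Real.hasDerivAt_sinh x).fun_div (Real.hasDerivAt_cosh x) (Real.cosh_pos x).ne'
  have h' : (fun x => Real.sinh x / Real.cosh x) = Real.tanh := by
    funext y; rw [Real.tanh_eq_sinh_div_cosh]
  rw [h'] at h
  refine h.congr_deriv ?_
  have := (Real.cosh_pos x).ne'
  rw [Real.tanh_eq_sinh_div_cosh]
  field_simp

lemma continuous_tanh : Continuous Real.tanh :=
  continuous_iff_continuousAt.2 fun x => (hasDerivAt_tanh x).continuousAt

lemma exists_tanh_sub_eq {x y : ℝ} (h : x < y) :
    ∃ c ∈ Set.Ioo x y, Real.tanh y - Real.tanh x = (1 - Real.tanh c ^ 2) * (y - x) := by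
  obtain ⟨c, hc, h'⟩ := exists_hasDerivAt_eq_slope Real.tanh (fun x => 1 - Real.tanh x ^ 2) h
    continuous_tanh.continuousOn (fun x _ => hasDerivAt_tanh x)
  refine ⟨c, hc, ?_⟩
  rw [h', div_mul_cancel₀ _ (sub_pos.2 h).ne']

lemma tanh_strictMono : StrictMono Real.tanh := fun x y h => by
  obtain ⟨c, -, hc⟩ := exists_tanh_sub_eq h
  have : 0 < 1 - Real.tanh c ^ 2 := by linarith [Real.tanh_sq_lt_one c]
  have := mul_pos this (sub_pos.2 h)
  linarith

lemma abs_tanh_sub_le (x y : ℝ) : |Real.tanh x - Real.tanh y| ≤ |x - y| := by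
  wlog h : y < x generalizing x y
  · rcases eq_or_lt_of_le (not_lt.1 h) with h | h
    · simp [h]
    · rw [abs_sub_comm, abs_sub_comm x]; exact this _ _ h
  obtain ⟨c, -, hc⟩ := exists_tanh_sub_eq h
  have h1 : 0 < 1 - Real.tanh c ^ 2 := by linarith [Real.tanh_sq_lt_one c]
  rw [hc, abs_mul, abs_of_pos h1]
  have := abs_nonneg (x - y)
  nlinarith [sq_nonneg (Real.tanh c)]

lemma abs_tanh_add_sub_le (a z : ℝ) :
    |Real.tanh (a + z) - Real.tanh a - (1 - Real.tanh a ^ 2) * z| ≤ 2 * z ^ 2 := by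
  have key : ∃ c, |c - a| ≤ |z| ∧
      Real.tanh (a + z) - Real.tanh a = (1 - Real.tanh c ^ 2) * z := by
    rcases lt_trichotomy z 0 with h | h | h
    · obtain ⟨c, hc, h'⟩ := exists_tanh_sub_eq (show a + z < a by linarith)
      refine ⟨c, ?_, by linear_combination -h'⟩
      rw [abs_of_neg h, abs_of_neg (by linarith [hc.2])]; linarith [hc.1]
    · subst h; exact ⟨a, by simp, by simp⟩
    · obtain ⟨c, hc, h'⟩ := exists_tanh_sub_eq (show a < a + z by linarith)
      refine ⟨c, ?_, by linear_combination h'⟩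
      rw [abs_of_pos h, abs_of_pos (by linarith [hc.1])]; linarith [hc.2]
  obtain ⟨c, hc, h⟩ := key
  rw [h, show (1 - Real.tanh c ^ 2) * z - (1 - Real.tanh a ^ 2) * z =
    (Real.tanh a + Real.tanh c) * (Real.tanh a - Real.tanh c) * z by ring, abs_mul, abs_mul]
  have h1 : |Real.tanh a + Real.tanh c| ≤ 2 := (abs_add_le _ _).trans (by
    linarith [Real.abs_tanh_lt_one a, Real.abs_tanh_lt_one c])
  have h2 : |Real.tanh a - Real.tanh c| ≤ |z| :=
    (abs_tanh_sub_le a c).trans (by rwa [abs_sub_comm])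
  rw [← sq_abs z, sq]
  calc _ ≤ 2 * |z| * |z| := by gcongr
    _ = _ := by ring

lemma mul_le_tanh_add_sub {a x d : ℝ} (hx : |x| ≤ a) (hd0 : 0 ≤ d) (hd1 : d ≤ 1) :
    (1 - Real.tanh (a + 1) ^ 2) * d ≤ Real.tanh (x + d) - Real.tanh x := by
  rcases hd0.eq_or_lt with h | h
  · simp [← h]
  obtain ⟨c, hc, h'⟩ := exists_tanh_sub_eq (show x < x + d by linarith)
  rw [h', add_sub_cancel_left]
  refine mul_le_mul_of_nonneg_right ?_ hd0
  have h1 : |c| ≤ a + 1 := by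
    rw [abs_le] at hx ⊢
    constructor <;> linarith [hc.1, hc.2]
  have h2 : Real.tanh c ^ 2 ≤ Real.tanh (a + 1) ^ 2 := by
    rw [abs_le] at h1
    apply sq_le_sq'
    · rw [← Real.tanh_neg]; exact tanh_strictMono.monotone h1.1
    · exact tanh_strictMono.monotone h1.2
  linarith

end Tanh

/-! ### Second, fourth and exponential moments of conditionally centered sums. -/

section CenteredSums

variable {n : ℕ}

/-- The sum of the conditionally centered spins over a set of edges. -/
def centeredSum (θ : ℝ) (β : Fin n → ℝ) (I : Finset (Edge n)) (Y : Config n) : ℝ :=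
  ∑ e ∈ I, centered θ β e Y

lemma abs_centered_sub_flipEdge_le (hn : 2 ≤ n) {θ : ℝ} (hθ : 0 ≤ θ) (β : Fin n → ℝ)
    (e f : Edge n) (Y : Config n) :
    |centered θ β f Y - centered θ β f (flipEdge e Y)| ≤
      (if f = e then 2 else 0) + 2 * θ / ((n : ℝ) - 1) * (inc f.1.1 e + inc f.1.2 e) := by
  have hn' : (0 : ℝ) < (n : ℝ) - 1 := by
    have : (2 : ℝ) ≤ n := by exact_mod_cast hn
    linarith
  have h0 : 0 ≤ 2 * θ / ((n : ℝ) - 1) * (inc f.1.1 e + inc f.1.2 e) :=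
    mul_nonneg (by positivity) (add_nonneg (inc_nonneg _ _) (inc_nonneg _ _))
  by_cases h : f = e
  · subst h
    simp only [centered, field_flipEdge_self, edgeVal_flipEdge_self, if_true]
    have : edgeVal Y f - Real.tanh (field θ β f Y) - (-edgeVal Y f - Real.tanh (field θ β f Y)) =
        2 * edgeVal Y f := by ring
    rw [this, abs_mul, abs_edgeVal]
    norm_num
    exact h0
  · simp only [centered, edgeVal_flipEdge_of_ne h, if_neg h, zero_add]
    have : edgeVal Y f - Real.tanh (field θ β f Y) -
        (edgeVal Y f - Real.tanh (field θ β f (flipEdge e Y))) =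
        Real.tanh (field θ β f (flipEdge e Y)) - Real.tanh (field θ β f Y) := by ring
    rw [this]
    refine (abs_tanh_sub_le _ _).trans ?_
    have : field θ β f (flipEdge e Y) - field θ β f Y =
        -(2 * θ / ((n : ℝ) - 1) * (inc f.1.1 e + inc f.1.2 e)) * edgeVal Y e := by
      simp only [field, deg_flipEdge, edgeVal_flipEdge_of_ne h]
      ring
    rw [this, abs_mul, abs_edgeVal, mul_one, abs_neg, abs_of_nonneg h0]

/-- The flipped edge itself contributes 2. Every edge sharing a vertex with it moves by O(1/n)
through the field, and these changes add up to at most 4θ, independently of n and I. -/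
lemma abs_centeredSum_sub_flipEdge_le (hn : 2 ≤ n) {θ : ℝ} (hθ : 0 ≤ θ) (β : Fin n → ℝ)
    (I : Finset (Edge n)) (e : Edge n) (Y : Config n) :
    |centeredSum θ β I Y - centeredSum θ β I (flipEdge e Y)| ≤ 2 + 4 * θ := by
  have hn' : (0 : ℝ) < (n : ℝ) - 1 := by
    have : (2 : ℝ) ≤ n := by exact_mod_cast hn
    linarith
  have h2 : ∑ i, inc i e = 2 := by
    have := sum_inc_mul (fun _ => 1) e
    simp only [mul_one] at this
    rw [this]; norm_num
  unfold centeredSum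
  rw [← Finset.sum_sub_distrib]
  calc _ ≤ ∑ f ∈ I, |centered θ β f Y - centered θ β f (flipEdge e Y)| :=
        Finset.abs_sum_le_sum_abs _ _
    _ ≤ ∑ f, |centered θ β f Y - centered θ β f (flipEdge e Y)| :=
        Finset.sum_le_sum_of_subset_of_nonneg (Finset.subset_univ I) fun _ _ _ => abs_nonneg _
    _ ≤ ∑ f : Edge n, ((if f = e then 2 else 0) +
          2 * θ / ((n : ℝ) - 1) * (inc f.1.1 e + inc f.1.2 e)) :=
        Finset.sum_le_sum fun f _ => abs_centered_sub_flipEdge_le hn hθ β e f Y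
    _ = 2 + 4 * θ := by
        rw [Finset.sum_add_distrib, ← Finset.mul_sum, sum_edge_endpoints fun i => inc i e, h2]
        simp
        field_simp
        ring

lemma avg_centeredSum_mul_le (hn : 2 ≤ n) (θ : ℝ) (β : Fin n → ℝ) (I : Finset (Edge n))
    (F : Config n → ℝ) {B : ℝ}
    (hB : ∀ e ∈ I, avg (weight θ β) (fun Y => |F Y - F (flipEdge e Y)|) ≤ B) :
    |avg (weight θ β) (fun Y => centeredSum θ β I Y * F Y)| ≤ I.card * B := by
  have : (fun Y => centeredSum θ β I Y * F Y) = fun Y => ∑ e ∈ I, centered θ β e Y * F Y := by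
    funext Y; rw [centeredSum, Finset.sum_mul]
  rw [this, avg_sum]
  refine (Finset.abs_sum_le_sum_abs _ _).trans ?_
  refine (Finset.sum_le_card_nsmul _ _ B fun e he => ?_).trans (by simp)
  exact (abs_avg_centered_mul_le hn θ β e F).trans (hB e he)

/-- Stein's bound with F the sum itself. It holds at every β, hence in all phases and under all
alternatives. -/
lemma avg_centeredSum_sq_le (hn : 2 ≤ n) {θ : ℝ} (hθ : 0 ≤ θ) (β : Fin n → ℝ)
    (I : Finset (Edge n)) :
    avg (weight θ β) (fun Y => centeredSum θ β I Y ^ 2) ≤ I.card * (2 + 4 * θ) := by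
  simp only [sq]
  refine (le_abs_self _).trans (avg_centeredSum_mul_le hn θ β I _ fun e _ => ?_)
  rw [← avg_const (weight_pos θ β) (2 + 4 * θ)]
  exact avg_mono (weight_pos θ β) fun Y => abs_centeredSum_sub_flipEdge_le hn hθ β I e Y

lemma abs_cube_sub_le {a b c : ℝ} (h : |a - b| ≤ c) :
    |a ^ 3 - b ^ 3| ≤ c * (9 / 2 * a ^ 2 + 3 * c ^ 2) := by
  have hc : 0 ≤ c := (abs_nonneg _).trans h
  have hb : b ^ 2 ≤ 2 * a ^ 2 + 2 * c ^ 2 := by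
    have := sq_le_sq' (abs_le.1 h).1 (abs_le.1 h).2
    nlinarith [sq_nonneg (2 * a - b)]
  have h1 : |a ^ 2 + a * b + b ^ 2| ≤ 9 / 2 * a ^ 2 + 3 * c ^ 2 := by
    rw [abs_of_nonneg (by nlinarith [sq_nonneg (a + b)])]
    nlinarith [sq_nonneg (a - b)]
  rw [show a ^ 3 - b ^ 3 = (a - b) * (a ^ 2 + a * b + b ^ 2) by ring, abs_mul]
  exact mul_le_mul h h1 (abs_nonneg _) hc

/-- Stein's bound with F the cube of the sum, whose increment under a flip is controlled by the
second moment. -/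
lemma avg_centeredSum_pow_four_le (hn : 2 ≤ n) {θ : ℝ} (hθ : 0 ≤ θ) (β : Fin n → ℝ)
    (I : Finset (Edge n)) :
    avg (weight θ β) (fun Y => centeredSum θ β I Y ^ 4) ≤
      I.card * ((2 + 4 * θ) * (9 / 2 * (I.card * (2 + 4 * θ)) + 3 * (2 + 4 * θ) ^ 2)) := by
  have h4 : (fun Y => centeredSum θ β I Y ^ 4) =
      fun Y => centeredSum θ β I Y * centeredSum θ β I Y ^ 3 := by funext Y; ring
  rw [h4]
  refine (le_abs_self _).trans (avg_centeredSum_mul_le hn θ β I _ fun e _ => ?_)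
  refine (avg_mono (weight_pos θ β) fun Y =>
    abs_cube_sub_le (abs_centeredSum_sub_flipEdge_le hn hθ β I e Y)).trans ?_
  rw [avg_const_mul, avg_add, avg_const_mul, avg_const (weight_pos θ β)]
  have := avg_centeredSum_sq_le hn hθ β I
  gcongr

lemma abs_exp_sub_exp_le {l a b c : ℝ} (hc : 0 ≤ c) (h : |a - b| ≤ c) (hl : |l| * c ≤ 1) :
    |Real.exp (l * a) - Real.exp (l * b)| ≤ 3 * |l| * c * Real.exp (l * a) := by
  have hx : |l * (b - a)| ≤ |l| * c := by
    rw [abs_mul, abs_sub_comm]; gcongr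
  have h1 : |Real.exp (l * (b - a)) - 1| ≤ 2 * |l * (b - a)| :=
    Real.abs_exp_sub_one_le (hx.trans hl)
  have : Real.exp (l * a) - Real.exp (l * b) =
      -(Real.exp (l * a) * (Real.exp (l * (b - a)) - 1)) := by
    have : Real.exp (l * b) = Real.exp (l * a) * Real.exp (l * (b - a)) := by
      rw [← Real.exp_add]; ring_nf
    rw [this]; ring
  rw [this, abs_neg, abs_mul, Real.abs_exp, mul_comm]
  refine mul_le_mul_of_nonneg_right ?_ (Real.exp_pos _).le
  have : 0 ≤ |l| * c := by positivity
  linarith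

/-- Gaussian bound on the moment generating function of a conditionally centered sum. -/
lemma avg_exp_centeredSum_le (hn : 2 ≤ n) {θ : ℝ} (hθ : 0 ≤ θ) (β : Fin n → ℝ)
    (I : Finset (Edge n)) {l : ℝ} (hl : |l| * (2 + 4 * θ) ≤ 1) :
    avg (weight θ β) (fun Y => Real.exp (l * centeredSum θ β I Y)) ≤
      Real.exp (3 * (2 + 4 * θ) * I.card * l ^ 2) := by
  set c := 2 + 4 * θ with hc
  have hc0 : 0 ≤ c := by positivity
  set w := weight θ β
  have hw := weight_pos θ β
  set X : Config n → ℝ := fun Y => l * centeredSum θ β I Y with hX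
  set κ := 3 * c * I.card * l ^ 2 with hκ
  have hκ0 : 0 ≤ κ := by positivity
  let φ : ℝ → ℝ := fun t => avg w (fun Y => Real.exp (t * X Y))
  have hφ0 : ∀ t, 0 ≤ φ t := fun t => avg_nonneg hw fun Y => (Real.exp_pos _).le
  have hφ : ∀ t, HasDerivAt φ (avg w (fun Y => X Y * Real.exp (t * X Y))) t := by
    intro t
    have := (hasDerivAt_sum_tilt_one w X t).div_const (∑ Y, w Y)
    simp only [tilt, mul_assoc, mul_comm (Real.exp _)] at this
    exact this
  -- Stein's bound with F the exponential itself gives the differential inequality φ' ≤ κφ; the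
  -- condition on l keeps a flip from changing the exponent by more than 1.
  have hφ' : ∀ t ∈ Set.Ioo (0 : ℝ) 1, avg w (fun Y => X Y * Real.exp (t * X Y)) ≤ κ * φ t := by
    intro t ht
    have e1 : (fun Y => X Y * Real.exp (t * X Y)) =
        fun Y => l * (centeredSum θ β I Y * Real.exp (t * X Y)) := by
      funext Y; simp only [hX]; ring
    rw [e1, avg_const_mul]
    have hb : |avg w (fun Y => centeredSum θ β I Y * Real.exp (t * X Y))| ≤
        I.card * (3 * |l| * c * φ t) := by
      refine avg_centeredSum_mul_le hn θ β I _ fun e _ => ?_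
      rw [← avg_const_mul]
      refine avg_mono hw fun Y => ?_
      have ht' : |t * l| ≤ |l| := by
        rw [abs_mul, abs_of_pos ht.1]
        nlinarith [ht.2, abs_nonneg l]
      have := abs_exp_sub_exp_le (l := t * l) hc0
        (abs_centeredSum_sub_flipEdge_le hn hθ β I e Y)
        ((mul_le_mul_of_nonneg_right ht' hc0).trans hl)
      simp only [hX, ← mul_assoc]
      refine this.trans ?_
      gcongr
    calc l * avg w (fun Y => centeredSum θ β I Y * Real.exp (t * X Y))
        ≤ |l| * |avg w (fun Y => centeredSum θ β I Y * Real.exp (t * X Y))| := by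
          rw [← abs_mul]; exact le_abs_self _
      _ ≤ |l| * (I.card * (3 * |l| * c * φ t)) := by gcongr
      _ = κ * φ t := by rw [hκ, ← sq_abs l]; ring
  have hψ : ∀ t, HasDerivAt (fun t => φ t * Real.exp (-(κ * t)))
      (avg w (fun Y => X Y * Real.exp (t * X Y)) * Real.exp (-(κ * t)) +
        φ t * (Real.exp (-(κ * t)) * -(κ * 1))) t := fun t =>
    (hφ t).mul (((hasDerivAt_id t).const_mul κ).neg.exp)
  -- Grönwall: φ(t) exp(−κt) decreases from its value 1 at t = 0.
  have hanti : AntitoneOn (fun t => φ t * Real.exp (-(κ * t))) (Set.Icc 0 1) := by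
    refine antitoneOn_of_deriv_nonpos (convex_Icc 0 1)
      (fun t _ => (hψ t).continuousAt.continuousWithinAt)
      (fun t _ => (hψ t).differentiableAt.differentiableWithinAt) fun t ht => ?_
    rw [interior_Icc] at ht
    rw [(hψ t).deriv]
    have := hφ' t ht
    have h3 := Real.exp_pos (-(κ * t))
    nlinarith
  have h01 := hanti (Set.left_mem_Icc.2 zero_le_one) (Set.right_mem_Icc.2 zero_le_one) zero_le_one
  have hφ00 : φ 0 = 1 := by
    simp only [φ, zero_mul, Real.exp_zero]
    exact avg_const hw 1
  simp only [mul_one, mul_zero, neg_zero, Real.exp_zero, hφ00] at h01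
  have h1 : φ 1 = avg w (fun Y => Real.exp (l * centeredSum θ β I Y)) := by
    simp only [φ, one_mul, hX]
  rw [← h1]
  rw [Real.exp_neg, ← div_eq_mul_inv, div_le_iff₀ (Real.exp_pos _), one_mul] at h01
  exact h01

lemma prob_centeredSum_le (hn : 2 ≤ n) {θ : ℝ} (hθ : 0 ≤ θ) (β : Fin n → ℝ)
    (I : Finset (Edge n)) {l : ℝ} (hl : |l| * (2 + 4 * θ) ≤ 1) (a : ℝ) :
    prob θ β {Y | a ≤ l * centeredSum θ β I Y} ≤
      Real.exp (3 * (2 + 4 * θ) * I.card * l ^ 2 - a) := by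
  refine (prob_le_avg_div θ β (fun Y => Real.exp (l * centeredSum θ β I Y)) (Real.exp_pos a) _
    (fun Y => (Real.exp_pos _).le) fun Y hY => Real.exp_le_exp.2 hY).trans ?_
  rw [Real.exp_sub]
  exact div_le_div_of_nonneg_right (avg_exp_centeredSum_le hn hθ β I hl) (Real.exp_pos a).le

end CenteredSums

/-! ### Drift under the alternatives and power of the sum and max tests. -/

section Tests

variable {n : ℕ}

/-- The edges that contain a given vertex. -/
def incident (i : Fin n) : Finset (Edge n) := Finset.univ.filter fun e => e.1.1 = i ∨ e.1.2 = i

lemma card_incident (i : Fin n) : ((incident i).card : ℝ) = (n : ℝ) - 1 := by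
  rw [← sum_inc i, ← mul_one ((incident i).card : ℝ), ← nsmul_eq_mul, ← Finset.sum_const,
    incident, sum_filter_incident]
  simp

lemma centeredDeg_eq (hn : 2 ≤ n) (θ β₀ : ℝ) (Y : Config n) (i : Fin n) :
    centeredDeg θ β₀ Y i = centeredSum θ (nullParam n β₀) (incident i) Y := by
  simp only [centeredDeg, condMean_eq_tanh hn]; rfl

lemma abs_field_null_le (hn : 2 ≤ n) {θ : ℝ} (hθ : 0 ≤ θ) (e : Edge n) (Y : Config n) :
    |field θ (nullParam n 0) e Y| ≤ 4 * θ := by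
  have hn' : (1 : ℝ) ≤ (n : ℝ) - 1 := by
    have : (2 : ℝ) ≤ n := by exact_mod_cast hn
    linarith
  have h1 := abs_le.1 (abs_deg_le Y e.1.1)
  have h2 := abs_le.1 (abs_deg_le Y e.1.2)
  have h3 := abs_le.1 (abs_edgeVal Y e).le
  simp only [field, nullParam, add_zero, zero_div]
  rw [abs_mul, abs_of_nonneg (div_nonneg hθ (by linarith))]
  have h4 : |deg Y e.1.1 + deg Y e.1.2 - 2 * edgeVal Y e| ≤ 4 * ((n : ℝ) - 1) := by
    rw [abs_le]; constructor <;> linarith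
  calc _ ≤ θ / ((n : ℝ) - 1) * (4 * ((n : ℝ) - 1)) := by gcongr
    _ = 4 * θ := by field_simp

/-- The statistic centered with the null field is mean zero noise under μ plus an explicit drift,
the increment of tanh caused by μ. -/
lemma centered_null_eq (θ : ℝ) (μ : Fin n → ℝ) (e : Edge n) (Y : Config n) :
    centered θ (nullParam n 0) e Y = centered θ μ e Y +
      (Real.tanh (field θ (nullParam n 0) e Y + (μ e.1.1 + μ e.1.2) / 2) -
        Real.tanh (field θ (nullParam n 0) e Y)) := by
  have : field θ μ e Y = field θ (nullParam n 0) e Y + (μ e.1.1 + μ e.1.2) / 2 := by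
    simp [field, nullParam]
  rw [centered, centered, this]; ring

/-- A lower bound for the drift of the conditionally centered spins. -/
def driftConst (θ : ℝ) : ℝ := 1 - Real.tanh (4 * θ + 1) ^ 2

lemma driftConst_pos (θ : ℝ) : 0 < driftConst θ := by
  have := Real.tanh_sq_lt_one (4 * θ + 1)
  unfold driftConst; linarith

/-- The null field lies in [−4θ, 4θ], so tanh has slope at least `driftConst` on the unit step
beyond it. Only a part of the signal, of size at most 1, is used there; by monotonicity larger
entries of μ do no harm. -/
lemma centered_add_le_centered_null (hn : 2 ≤ n) {θ : ℝ} (hθ : 0 ≤ θ) {A : ℝ} (hA0 : 0 ≤ A)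
    (hA1 : A ≤ 1) {μ : Fin n → ℝ} (hμ : ∀ i ∈ Function.support μ, A ≤ μ i) (e : Edge n)
    (Y : Config n) :
    centered θ μ e Y + driftConst θ * (A / 4) *
      ((Function.support μ).indicator 1 e.1.1 + (Function.support μ).indicator 1 e.1.2) ≤
      centered θ (nullParam n 0) e Y := by
  rw [centered_null_eq θ μ]
  have h0 : ∀ i, A * (Function.support μ).indicator 1 i ≤ μ i := by
    intro i
    by_cases h : i ∈ Function.support μ
    · simpa [h] using hμ i h
    · rw [Set.indicator_of_notMem h, Function.notMem_support.1 h]; simp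
  have h1 : ∀ i, (0 : ℝ) ≤ (Function.support μ).indicator 1 i := fun i =>
    Set.indicator_nonneg (by simp) i
  have h2 : ∀ i, (Function.support μ).indicator (1 : Fin n → ℝ) i ≤ 1 := fun i =>
    Set.indicator_le_self' (by simp) i
  set x := (Function.support μ).indicator (1 : Fin n → ℝ) e.1.1
  set y := (Function.support μ).indicator (1 : Fin n → ℝ) e.1.2
  have hx := h0 e.1.1
  have hy := h0 e.1.2
  have hx1 : 0 ≤ x ∧ x ≤ 1 := ⟨h1 _, h2 _⟩
  have hy1 : 0 ≤ y ∧ y ≤ 1 := ⟨h1 _, h2 _⟩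
  have key := mul_le_tanh_add_sub (d := A / 4 * (x + y)) (abs_field_null_le hn hθ e Y)
    (mul_nonneg (by positivity) (by linarith [hx1.1, hy1.1]))
    (by nlinarith [hx1.1, hx1.2, hy1.1, hy1.2])
  have mono : Real.tanh (field θ (nullParam n 0) e Y + A / 4 * (x + y)) ≤
      Real.tanh (field θ (nullParam n 0) e Y + (μ e.1.1 + μ e.1.2) / 2) := by
    apply tanh_strictMono.monotone
    have : 0 ≤ A * x := mul_nonneg hA0 hx1.1
    have : 0 ≤ A * y := mul_nonneg hA0 hy1.1
    nlinarith
  have : driftConst θ * (A / 4) * (x + y) = driftConst θ * (A / 4 * (x + y)) := by ring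
  rw [this]
  unfold driftConst
  linarith

lemma sum_indicator_support (μ : Fin n → ℝ) :
    ∑ i, (Function.support μ).indicator (1 : Fin n → ℝ) i = ((Function.support μ).ncard : ℝ) := by
  classical
  rw [Set.ncard_eq_toFinset_card', Finset.card_eq_sum_ones, Nat.cast_sum,
    ← Finset.sum_subset (Finset.subset_univ (Function.support μ).toFinset)]
  · refine Finset.sum_congr rfl fun i hi => ?_
    rw [Set.indicator_of_mem (Set.mem_toFinset.1 hi)]; simp
  · intro i _ hi
    rw [Set.indicator_of_notMem fun h => hi (Set.mem_toFinset.2 h)]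

lemma centeredSum_univ_null_ge (hn : 2 ≤ n) {θ : ℝ} (hθ : 0 ≤ θ) {A s : ℝ} (hA0 : 0 ≤ A)
    (hA1 : A ≤ 1) {μ : Fin n → ℝ} (hμ : ∀ i ∈ Function.support μ, A ≤ μ i)
    (hs : s ≤ (Function.support μ).ncard) (Y : Config n) :
    centeredSum θ μ Finset.univ Y + driftConst θ * (A / 4) * (((n : ℝ) - 1) * s) ≤
      centeredSum θ (nullParam n 0) Finset.univ Y := by
  have hn' : (0 : ℝ) ≤ (n : ℝ) - 1 := by
    have : (2 : ℝ) ≤ n := by exact_mod_cast hn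
    linarith
  have h := Finset.sum_le_sum fun e (_ : e ∈ Finset.univ) =>
    centered_add_le_centered_null hn hθ hA0 hA1 hμ e Y
  rw [Finset.sum_add_distrib, ← Finset.mul_sum, sum_edge_endpoints, sum_indicator_support] at h
  refine le_trans ?_ h
  have := driftConst_pos θ
  unfold centeredSum
  gcongr

/-- One spiked vertex suffices for the max test: all its n − 1 edges drift upwards, whatever the
other vertices do. -/
lemma centeredSum_incident_null_ge (hn : 2 ≤ n) {θ : ℝ} (hθ : 0 ≤ θ) {A : ℝ} (hA0 : 0 ≤ A)
    (hA1 : A ≤ 1) {μ : Fin n → ℝ} (hμ : ∀ i ∈ Function.support μ, A ≤ μ i) {i : Fin n}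
    (hi : i ∈ Function.support μ) (Y : Config n) :
    centeredSum θ μ (incident i) Y + driftConst θ * (A / 4) * ((n : ℝ) - 1) ≤
      centeredSum θ (nullParam n 0) (incident i) Y := by
  have h : ∀ e ∈ incident i, centered θ μ e Y + driftConst θ * (A / 4) ≤
      centered θ (nullParam n 0) e Y := by
    intro e he
    refine le_trans ?_ (centered_add_le_centered_null hn hθ hA0 hA1 hμ e Y)
    have h1 : ∀ i, (0 : ℝ) ≤ (Function.support μ).indicator 1 i := fun i =>
      Set.indicator_nonneg (by simp) i
    have h2 : (1 : ℝ) ≤ (Function.support μ).indicator 1 e.1.1 +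
        (Function.support μ).indicator 1 e.1.2 := by
      rcases (Finset.mem_filter.1 he).2 with h | h
      · rw [h, Set.indicator_of_mem hi]
        have := h1 e.1.2
        simpa using this
      · rw [h, Set.indicator_of_mem hi]
        have := h1 e.1.1
        simpa using this
    have := mul_nonneg (driftConst_pos θ).le (by positivity : 0 ≤ A / 4)
    nlinarith
  have := Finset.sum_le_sum h
  rw [Finset.sum_add_distrib, Finset.sum_const, nsmul_eq_mul, card_incident] at this
  unfold centeredSum
  linarith

lemma prob_abs_centeredSum_ge (hn : 2 ≤ n) {θ : ℝ} (hθ : 0 ≤ θ) (β : Fin n → ℝ)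
    (I : Finset (Edge n)) {a : ℝ} (ha : 0 < a) (S : Set (Config n))
    (hS : ∀ Y ∈ S, a ≤ |centeredSum θ β I Y|) :
    prob θ β S ≤ I.card * (2 + 4 * θ) / a ^ 2 := by
  refine (prob_le_avg_div θ β (fun Y => centeredSum θ β I Y ^ 2) (by positivity) S
    (fun Y => sq_nonneg _) fun Y hY => ?_).trans
    (div_le_div_of_nonneg_right (avg_centeredSum_sq_le hn hθ β I) (by positivity))
  rw [← sq_abs (centeredSum θ β I Y)]
  exact pow_le_pow_left₀ ha.le (hS Y hY) 2

lemma risk_nonneg (θ β₀ s A : ℝ) (T : Test n) : 0 ≤ risk θ β₀ s A T :=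
  add_nonneg (prob_nonneg _ _ _) (Real.iSup_nonneg fun _ => prob_nonneg _ _ _)

lemma risk_le {θ β₀ s A : ℝ} {T : Test n} {a b : ℝ} (hb0 : 0 ≤ b)
    (ha : prob θ (nullParam n β₀) {Y | T Y = 1} ≤ a)
    (hb : ∀ μ : Fin n → ℝ, s ≤ (Function.support μ).ncard →
      (∀ i ∈ Function.support μ, A ≤ μ i) → prob θ (nullParam n β₀ + μ) {Y | T Y = 0} ≤ b) :
    risk θ β₀ s A T ≤ a + b := by
  refine add_le_add ha (Real.iSup_le (fun β => ?_) hb0)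
  obtain ⟨μ, h1, h2, h3⟩ := β.2
  rw [h1]
  exact hb μ h2 h3

lemma nullParam_zero_add (μ : Fin n → ℝ) : nullParam n 0 + μ = μ := by
  funext i; simp [nullParam]

lemma sumTest_eq_one_iff (hn : 2 ≤ n) (θ β₀ L : ℝ) (Y : Config n) :
    sumTest n θ β₀ L Y = 1 ↔ L < centeredSum θ (nullParam n β₀) Finset.univ Y := by
  have key : ∑ e : Edge n, (edgeVal Y e - condMean θ (nullParam n β₀) e Y) =
      centeredSum θ (nullParam n β₀) Finset.univ Y :=
    Finset.sum_congr rfl fun e _ => by rw [condMean_eq_tanh hn, centered]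
  unfold sumTest
  rw [key]
  split_ifs with h <;> simp [h]

lemma sumTest_eq_zero_iff (hn : 2 ≤ n) (θ β₀ L : ℝ) (Y : Config n) :
    sumTest n θ β₀ L Y = 0 ↔ centeredSum θ (nullParam n β₀) Finset.univ Y ≤ L := by
  rw [← not_lt, ← sumTest_eq_one_iff hn]
  generalize sumTest n θ β₀ L Y = x
  fin_cases x <;> simp

lemma maxTest_eq_one_iff (hn : 2 ≤ n) (θ β₀ L : ℝ) (Y : Config n) :
    maxTest n θ β₀ L Y = 1 ↔ ∃ i, L < centeredSum θ (nullParam n β₀) (incident i) Y := by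
  have : Nonempty (Fin n) := ⟨⟨0, by omega⟩⟩
  have key : (L < ⨆ i : Fin n, centeredDeg θ β₀ Y i) ↔
      ∃ i, L < centeredSum θ (nullParam n β₀) (incident i) Y := by
    rw [lt_ciSup_iff (Set.finite_range _).bddAbove]
    simp only [centeredDeg_eq hn]
  unfold maxTest
  rw [← key]
  split_ifs with h <;> simp [h]

lemma maxTest_eq_zero_iff (hn : 2 ≤ n) (θ β₀ L : ℝ) (Y : Config n) :
    maxTest n θ β₀ L Y = 0 ↔ ∀ i, centeredSum θ (nullParam n β₀) (incident i) Y ≤ L := by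
  have h := (maxTest_eq_one_iff hn θ β₀ L Y).not
  push Not at h
  rw [← h]
  generalize maxTest n θ β₀ L Y = x
  fin_cases x <;> simp

lemma risk_sumTest_le (hn : 2 ≤ n) {θ : ℝ} (hθ : 0 ≤ θ) {s A L : ℝ} (hs : 0 < s) (hA0 : 0 < A)
    (hA1 : A ≤ 1) (hL : 0 < L) (hL' : L ≤ driftConst θ / 16 * (n * s * A)) :
    risk θ 0 s A (sumTest n θ 0 L) ≤ (n : ℝ) ^ 2 * (2 + 4 * θ) / L ^ 2 +
      (n : ℝ) ^ 2 * (2 + 4 * θ) / (driftConst θ / 16 * (n * s * A)) ^ 2 := by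
  have hn' : (2 : ℝ) ≤ n := by exact_mod_cast hn
  have hd := driftConst_pos θ
  have hg : 0 < driftConst θ / 16 * (n * s * A) := by positivity
  have hcard : ((Finset.univ : Finset (Edge n)).card : ℝ) ≤ (n : ℝ) ^ 2 := by
    rw [Finset.card_univ, card_edge]; nlinarith
  refine risk_le (by positivity) ?_ fun μ h1 h2 => ?_
  · refine (prob_abs_centeredSum_ge hn hθ _ Finset.univ hL _ fun Y hY => ?_).trans (by gcongr)
    rw [Set.mem_ofPred_eq, sumTest_eq_one_iff hn] at hY
    exact hY.le.trans (le_abs_self _)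
  · rw [nullParam_zero_add]
    refine (prob_abs_centeredSum_ge hn hθ μ Finset.univ hg _ fun Y hY => ?_).trans (by gcongr)
    rw [Set.mem_ofPred_eq, sumTest_eq_zero_iff hn] at hY
    have h3 := centeredSum_univ_null_ge hn hθ hA0.le hA1 h2 h1 Y
    -- The drift is at least twice the bound on L, so acceptance forces the mean zero part below
    -- minus that bound.
    have h4 : 2 * (driftConst θ / 16 * (n * s * A)) ≤
        driftConst θ * (A / 4) * (((n : ℝ) - 1) * s) := by
      have : (n : ℝ) / 2 ≤ n - 1 := by linarith
      calc 2 * (driftConst θ / 16 * (n * s * A)) = driftConst θ * (A / 4) * ((n : ℝ) / 2 * s) := by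
            ring
        _ ≤ _ := by gcongr
    refine le_trans ?_ (neg_le_abs _)
    linarith

/-- The two errors need different tools: type I is a union bound over n vertices, hence an
exponential moment with parameter l, while for type II Chebyshev at a single spiked vertex is
enough. -/
lemma risk_maxTest_le (hn : 2 ≤ n) {θ : ℝ} (hθ : 0 ≤ θ) {s A L l : ℝ} (hs : 0 < s) (hA0 : 0 < A)
    (hA1 : A ≤ 1) (hl0 : 0 ≤ l) (hl : l * (2 + 4 * θ) ≤ 1)
    (hL' : L ≤ driftConst θ / 16 * (n * A)) :
    risk θ 0 s A (maxTest n θ 0 L) ≤ n * Real.exp (3 * (2 + 4 * θ) * n * l ^ 2 - l * L) +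
      n * (2 + 4 * θ) / (driftConst θ / 16 * (n * A)) ^ 2 := by
  have hn' : (2 : ℝ) ≤ n := by exact_mod_cast hn
  have hd := driftConst_pos θ
  have hg : 0 < driftConst θ / 16 * (n * A) := by positivity
  refine risk_le (by positivity) ?_ fun μ h1 h2 => ?_
  · have hsub : {Y : Config n | maxTest n θ 0 L Y = 1} ⊆
        ⋃ i, {Y | l * L ≤ l * centeredSum θ (nullParam n 0) (incident i) Y} := by
      intro Y hY
      obtain ⟨i, hi⟩ := (maxTest_eq_one_iff hn θ 0 L Y).1 hY
      exact Set.mem_iUnion.2 ⟨i, mul_le_mul_of_nonneg_left hi.le hl0⟩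
    refine (prob_mono _ _ hsub).trans ((prob_iUnion_le _ _ _).trans ?_)
    refine (Finset.sum_le_card_nsmul _ _ (Real.exp (3 * (2 + 4 * θ) * n * l ^ 2 - l * L))
      fun i _ => ?_).trans (by simp)
    refine (prob_centeredSum_le hn hθ _ (incident i) (by rwa [abs_of_nonneg hl0]) _).trans ?_
    rw [card_incident]
    gcongr
    linarith
  · rw [nullParam_zero_add]
    have hne : (Function.support μ).Nonempty := by
      rw [Set.nonempty_iff_ne_empty]
      intro h
      rw [h] at h1
      simp at h1
      linarith
    obtain ⟨i, hi⟩ := hne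
    refine (prob_abs_centeredSum_ge hn hθ μ (incident i) hg _ fun Y hY => ?_).trans ?_
    · rw [Set.mem_ofPred_eq, maxTest_eq_zero_iff hn] at hY
      have h3 := centeredSum_incident_null_ge hn hθ hA0.le hA1 h2 hi Y
      have h4 : 2 * (driftConst θ / 16 * (n * A)) ≤ driftConst θ * (A / 4) * ((n : ℝ) - 1) := by
        have : (n : ℝ) / 2 ≤ n - 1 := by linarith
        calc 2 * (driftConst θ / 16 * (n * A)) = driftConst θ * (A / 4) * ((n : ℝ) / 2) := by
              ring
          _ ≤ _ := by gcongr
      refine le_trans ?_ (neg_le_abs _)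
      linarith [hY i]
    · rw [card_incident]
      gcongr
      linarith

lemma rpow_nonpos_le_one {n : ℕ} (hn : 1 ≤ n) {t : ℝ} (ht : t ≤ 0) : (n : ℝ) ^ t ≤ 1 :=
  Real.rpow_le_one_of_one_le_of_nonpos (by exact_mod_cast hn) ht

/-- Power of the conditionally centered sum test. -/
lemma asympPowerful_sumTest {θ : ℝ} (hθ : 0 ≤ θ) {b t : ℝ} (ht : t < 0) (hbt : 0 < b + t)
    {L : ℕ → ℝ} (hL : Tendsto (fun n => L n / (n : ℝ)) atTop atTop)
    (hL' : Tendsto (fun n => L n / ((n : ℝ) * (n : ℝ) ^ b * (n : ℝ) ^ t)) atTop (𝓝 0)) :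
    AsympPowerful θ 0 (fun n => (n : ℝ) ^ b) (fun n => (n : ℝ) ^ t)
      (fun n => sumTest n θ 0 (L n)) := by
  have hd := driftConst_pos θ
  have hlim : Tendsto (fun n : ℕ => (2 + 4 * θ) / (L n / n) ^ 2 +
      (2 + 4 * θ) / (driftConst θ / 16 * (n : ℝ) ^ (b + t)) ^ 2) atTop (𝓝 0) := by
    rw [← add_zero (0 : ℝ)]
    refine Tendsto.add ?_ ?_
    · exact tendsto_const_nhds.div_atTop ((tendsto_pow_atTop two_ne_zero).comp hL)
    · refine tendsto_const_nhds.div_atTop ((tendsto_pow_atTop two_ne_zero).comp ?_)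
      exact ((tendsto_rpow_atTop hbt).comp tendsto_natCast_atTop_atTop).const_mul_atTop
        (by positivity)
  refine squeeze_zero' (Eventually.of_forall fun n => risk_nonneg _ _ _ _ _) ?_ hlim
  filter_upwards [eventually_ge_atTop 2, hL.eventually_gt_atTop 0,
    hL'.eventually_le_const (show 0 < driftConst θ / 16 by positivity)] with n hn h1 h2
  have hn0 : (0 : ℝ) < n := by positivity
  have hs : (0 : ℝ) < (n : ℝ) ^ b := Real.rpow_pos_of_pos hn0 b
  have hA : (0 : ℝ) < (n : ℝ) ^ t := Real.rpow_pos_of_pos hn0 t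
  have hLpos : 0 < L n := by
    have := mul_pos h1 hn0
    rwa [div_mul_cancel₀ _ hn0.ne'] at this
  refine (risk_sumTest_le hn hθ hs hA (rpow_nonpos_le_one (by omega) ht.le) hLpos ?_).trans
    (le_of_eq ?_)
  · rwa [div_le_iff₀ (by positivity)] at h2
  · rw [Real.rpow_add hn0]
    field_simp

/-- Power of the conditionally centered max test. -/
lemma asympPowerful_maxTest {θ : ℝ} (hθ : 0 ≤ θ) {b t : ℝ} (ht : t < 0)
    (ht' : 0 < t + 1 / 2) :
    AsympPowerful θ 0 (fun n => (n : ℝ) ^ b) (fun n => (n : ℝ) ^ t)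
      (fun n => maxTest n θ 0 ((3 * (2 + 4 * θ) + 2) * Real.sqrt ((n : ℝ) * Real.log n))) := by
  have hd := driftConst_pos θ
  have hlogdiv : ∀ r : ℝ, 0 < r → Tendsto (fun n : ℕ => Real.log n / (n : ℝ) ^ r) atTop (𝓝 0) :=
    fun r hr => ((isLittleO_log_rpow_atTop hr).tendsto_div_nhds_zero).comp
      tendsto_natCast_atTop_atTop
  have hlim : Tendsto (fun n : ℕ => 1 / (n : ℝ) +
      (2 + 4 * θ) / (driftConst θ / 16) ^ 2 / (n : ℝ) ^ (2 * (t + 1 / 2))) atTop (𝓝 0) := by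
    rw [← add_zero (0 : ℝ)]
    refine Tendsto.add tendsto_one_div_atTop_nhds_zero_nat ?_
    exact tendsto_const_nhds.div_atTop ((tendsto_rpow_atTop (by positivity)).comp
      tendsto_natCast_atTop_atTop)
  refine squeeze_zero' (Eventually.of_forall fun n => risk_nonneg _ _ _ _ _) ?_ hlim
  have e1 := (hlogdiv 1 one_pos).eventually_le_const
    (show 0 < (1 / (2 + 4 * θ)) ^ 2 by positivity)
  have e2 := (hlogdiv (2 * (t + 1 / 2)) (by positivity)).eventually_le_const
    (show 0 < (driftConst θ / 16 / (3 * (2 + 4 * θ) + 2)) ^ 2 by positivity)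
  filter_upwards [eventually_ge_atTop 2, e1, e2] with n hn h1 h2
  have hn0 : (0 : ℝ) < n := by positivity
  have hs : (0 : ℝ) < (n : ℝ) ^ b := Real.rpow_pos_of_pos hn0 b
  have hA : (0 : ℝ) < (n : ℝ) ^ t := Real.rpow_pos_of_pos hn0 t
  have hlog : 0 ≤ Real.log n := Real.log_natCast_nonneg n
  set c := 2 + 4 * θ with hc
  have hc0 : 0 < c := by positivity
  rw [Real.rpow_one] at h1
  have hpow : (n : ℝ) ^ (2 * (t + 1 / 2)) = n * ((n : ℝ) ^ t) ^ 2 := by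
    rw [show 2 * (t + 1 / 2) = 1 + t * 2 by ring, Real.rpow_add hn0, Real.rpow_one,
      Real.rpow_mul hn0.le]
    norm_cast
  refine (risk_maxTest_le (l := √(Real.log n / n)) hn hθ hs hA
    (rpow_nonpos_le_one (by omega) ht.le) (Real.sqrt_nonneg _) ?_ ?_).trans (le_of_eq ?_)
  · rw [← le_div_iff₀ hc0]
    exact Real.sqrt_le_iff.2 ⟨by positivity, h1⟩
  · rw [← le_div_iff₀' (by positivity)]
    refine Real.sqrt_le_iff.2 ⟨by positivity, ?_⟩
    rw [hpow, div_le_iff₀ (by positivity)] at h2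
    calc (n : ℝ) * Real.log n ≤ n * ((driftConst θ / 16 / (3 * c + 2)) ^ 2 *
          (n * ((n : ℝ) ^ t) ^ 2)) := by gcongr
      _ = _ := by ring
  · have e3 : √(Real.log n / n) ^ 2 = Real.log n / n := Real.sq_sqrt (by positivity)
    have e4 : √(Real.log n / n) * √(n * Real.log n) = Real.log n := by
      rw [← Real.sqrt_mul (by positivity), div_mul_eq_mul_div, ← mul_assoc, mul_comm (Real.log n),
        mul_assoc, mul_div_cancel_left₀ _ hn0.ne', Real.sqrt_mul_self hlog]
    -- With l = √(log n / n) the Gaussian term costs 3c log n; the extra 2 in the cut-off leaves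
    -- n⁻², one power of which pays for the union bound.
    have e5 : 3 * c * n * √(Real.log n / n) ^ 2 -
        √(Real.log n / n) * ((3 * c + 2) * √(n * Real.log n)) = -(2 * Real.log n) := by
      rw [mul_left_comm, e4, e3]
      field_simp
      ring
    rw [e5, Real.exp_neg, two_mul, Real.exp_add, Real.exp_log hn0, hpow]
    congr 1
    · field_simp
    · rw [← hc]; field_simp

end Tests

/-! ### The mean field equation, its free energy, and degree vectors of almost minimal energy. -/

section MeanField

/-- `m` is the positive solution of the mean field equation `m = tanh (2 θ m)`. -/
structure IsMagnetization (θ m : ℝ) : Prop where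
  half_lt : 1 / 2 < θ
  pos : 0 < m
  tanh_eq : Real.tanh (2 * θ * m) = m

lemma exists_isMagnetization {θ : ℝ} (hθ : 1 / 2 < θ) : ∃ m, IsMagnetization θ m := by
  -- Taylor at 0 gives tanh(2θx) ≥ 2θx − 8θ²x²; at x₀ the quadratic loss is half of the gain (2θ −
  -- 1)x₀.
  set x₀ := (2 * θ - 1) / (16 * θ ^ 2) with hx₀
  have hθ0 : 0 < θ := by linarith
  have hx0 : 0 < x₀ := div_pos (by linarith) (by positivity)
  have hx1 : x₀ ≤ 1 := by
    rw [hx₀, div_le_one (by positivity)]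
    nlinarith
  have h1 : x₀ ≤ Real.tanh (2 * θ * x₀) := by
    have h := abs_tanh_add_sub_le 0 (2 * θ * x₀)
    simp only [zero_add, Real.tanh_zero, sub_zero, ne_eq, OfNat.ofNat_ne_zero, not_false_eq_true,
      zero_pow, one_mul] at h
    have h2 := (abs_le.1 h).1
    have h3 : x₀ * (16 * θ ^ 2) = 2 * θ - 1 := div_mul_cancel₀ _ (by positivity)
    nlinarith
  have hcont : ContinuousOn (fun x => x - Real.tanh (2 * θ * x)) (Set.Icc x₀ 1) :=
    (continuous_id.sub (continuous_tanh.comp (continuous_const.mul continuous_id))).continuousOn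
  obtain ⟨m, hm, h⟩ := intermediate_value_Icc hx1 hcont
    (show (0 : ℝ) ∈ _ from ⟨by simpa using h1, by
      have := Real.tanh_lt_one (2 * θ * 1); linarith⟩)
  exact ⟨m, hθ, hx0.trans_le hm.1, by simp only at h; linarith⟩

/-- Concavity on the positive axis: tanh x / x is strictly decreasing there. -/
lemma tanh_mul_lt_mul_tanh {x y : ℝ} (hx : 0 < x) (hxy : x < y) :
    Real.tanh y * x < Real.tanh x * y := by
  obtain ⟨c, hc, h1⟩ := exists_tanh_sub_eq hx
  obtain ⟨d, hd, h2⟩ := exists_tanh_sub_eq hxy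
  rw [Real.tanh_zero, sub_zero, sub_zero] at h1
  have hc0 : 0 < Real.tanh c := Real.tanh_zero ▸ tanh_strictMono hc.1
  have hcd : Real.tanh c < Real.tanh d := tanh_strictMono (hc.2.trans hd.1)
  have h3 : Real.tanh y = (1 - Real.tanh c ^ 2) * x + (1 - Real.tanh d ^ 2) * (y - x) := by
    linarith
  rw [h3, h1]
  have h4 : Real.tanh c ^ 2 < Real.tanh d ^ 2 := pow_lt_pow_left₀ hcd hc0.le two_ne_zero
  have h5 : 0 < x * (y - x) := mul_pos hx (sub_pos.2 hxy)
  nlinarith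

variable {θ m : ℝ}

namespace IsMagnetization

lemma theta_pos (h : IsMagnetization θ m) : 0 < θ := by linarith [h.half_lt]

lemma lt_one (h : IsMagnetization θ m) : m < 1 := h.tanh_eq ▸ Real.tanh_lt_one _

/-- The chord from 0 to the fixed point has slope 1, and by strict concavity the tangent at the
fixed point is flatter. This makes the linearized equations invertible. -/
lemma stable (h : IsMagnetization θ m) : 2 * (θ * (1 - m ^ 2)) < 1 := by
  have hθ := h.theta_pos
  have hm := h.pos
  have hu : 0 < 2 * θ * m := by positivity
  obtain ⟨c, hc, h1⟩ := exists_tanh_sub_eq hu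
  rw [Real.tanh_zero, sub_zero, sub_zero, h.tanh_eq] at h1
  have hc0 : 0 < Real.tanh c := Real.tanh_zero ▸ tanh_strictMono hc.1
  have hcm : Real.tanh c < m := h.tanh_eq ▸ tanh_strictMono hc.2
  have h2 : 1 = (1 - Real.tanh c ^ 2) * (2 * θ) := by
    have : m * 1 = m * ((1 - Real.tanh c ^ 2) * (2 * θ)) := by linarith
    exact mul_left_cancel₀ hm.ne' this
  have h3 : Real.tanh c ^ 2 < m ^ 2 := pow_lt_pow_left₀ hcm hc0.le two_ne_zero
  nlinarith

lemma tanh_lt (h : IsMagnetization θ m) {x : ℝ} (hx : m < x) : Real.tanh (2 * θ * x) < x := by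
  have hθ := h.theta_pos
  have hm := h.pos
  have := tanh_mul_lt_mul_tanh (show 0 < 2 * θ * m by positivity)
    (show 2 * θ * m < 2 * θ * x by gcongr)
  rw [h.tanh_eq] at this
  have h2 : 0 < 2 * θ * m := by positivity
  nlinarith

lemma lt_tanh (h : IsMagnetization θ m) {x : ℝ} (hx0 : 0 < x) (hx : x < m) :
    x < Real.tanh (2 * θ * x) := by
  have hθ := h.theta_pos
  have hm := h.pos
  have := tanh_mul_lt_mul_tanh (show 0 < 2 * θ * x by positivity)
    (show 2 * θ * x < 2 * θ * m by gcongr)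
  rw [h.tanh_eq] at this
  have h2 : 0 < 2 * θ * m := by positivity
  nlinarith

/-- The equation of one vertex when the others have normalized degree m. For y < m the argument θ(y
+ m) exceeds 2θy and for y > m it is smaller, so comparison with `lt_tanh` and `tanh_lt` excludes
every root but m, in particular any near −m. -/
lemma eq_of_tanh_eq (h : IsMagnetization θ m) {y : ℝ} (hy : Real.tanh (θ * (y + m)) = y) :
    y = m := by
  have hθ := h.theta_pos
  have hm := h.pos
  rcases lt_trichotomy y m with h1 | h1 | h1
  · exfalso
    by_cases h2 : 0 < y
    · have h3 := h.lt_tanh h2 h1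
      have h4 : Real.tanh (2 * θ * y) < Real.tanh (θ * (y + m)) := tanh_strictMono (by nlinarith)
      linarith
    · push Not at h2
      by_cases h3 : -m < y
      · have : Real.tanh 0 < Real.tanh (θ * (y + m)) :=
          tanh_strictMono (mul_pos hθ (by linarith))
        rw [Real.tanh_zero] at this
        linarith
      · push Not at h3
        rcases h3.eq_or_lt with h4 | h4
        · rw [h4, neg_add_cancel, mul_zero, Real.tanh_zero] at hy
          linarith
        · have h5 := h.tanh_lt (show m < -y by linarith)
          have h6 : Real.tanh (-(2 * θ * -y)) < Real.tanh (θ * (y + m)) :=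
            tanh_strictMono (by nlinarith)
          rw [Real.tanh_neg] at h6
          linarith
  · exact h1
  · exfalso
    have h3 := h.tanh_lt h1
    have h4 : Real.tanh (θ * (y + m)) < Real.tanh (2 * θ * y) := tanh_strictMono (by nlinarith)
    linarith

end IsMagnetization

/-- The mean field free energy. -/
def freeEnergy (θ x : ℝ) : ℝ := θ * x ^ 2 - Real.log (Real.cosh (2 * θ * x))

lemma hasDerivAt_freeEnergy (θ x : ℝ) :
    HasDerivAt (freeEnergy θ) (2 * θ * (x - Real.tanh (2 * θ * x))) x := by
  have h1 : HasDerivAt (fun x => Real.log (Real.cosh (2 * θ * x)))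
      (Real.sinh (2 * θ * x) * (2 * θ * 1) / Real.cosh (2 * θ * x)) x :=
    (((hasDerivAt_id x).const_mul (2 * θ)).cosh).log (Real.cosh_pos _).ne'
  have h2 : HasDerivAt (fun x : ℝ => θ * x ^ 2) (θ * (2 * x)) x := by
    simpa using (hasDerivAt_pow 2 x).const_mul θ
  refine (h2.sub h1).congr_deriv ?_
  rw [Real.tanh_eq_sinh_div_cosh]; ring

lemma continuous_freeEnergy (θ : ℝ) : Continuous (freeEnergy θ) :=
  continuous_iff_continuousAt.2 fun x => (hasDerivAt_freeEnergy θ x).continuousAt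

lemma freeEnergy_neg (θ x : ℝ) : freeEnergy θ (-x) = freeEnergy θ x := by
  simp [freeEnergy]

lemma abs_freeEnergy_sub_le {θ : ℝ} (hθ : 0 ≤ θ) {x y : ℝ} (hx : |x| ≤ 1) (hy : |y| ≤ 1) :
    |freeEnergy θ x - freeEnergy θ y| ≤ 4 * θ * |x - y| := by
  have := Convex.norm_image_sub_le_of_norm_hasDerivWithin_le (s := Set.Icc (-1 : ℝ) 1)
    (f := freeEnergy θ) (C := 4 * θ) (fun z _ => (hasDerivAt_freeEnergy θ z).hasDerivWithinAt)
    (fun z hz => by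
      rw [Real.norm_eq_abs, abs_mul, abs_of_nonneg (by positivity)]
      have h1 : |z - Real.tanh (2 * θ * z)| ≤ 2 :=
        (abs_sub _ _).trans (by linarith [abs_le.2 hz, Real.abs_tanh_lt_one (2 * θ * z)])
      nlinarith) (convex_Icc _ _) (abs_le.1 hy) (abs_le.1 hx)
  simpa using this

/-- The derivative is a positive multiple of x − tanh(2θx), negative on (0, m) and positive beyond
m; evenness gives the other half. -/
lemma IsMagnetization.freeEnergy_lt (h : IsMagnetization θ m) {x : ℝ} (hx : |x| ≠ m) :
    freeEnergy θ m < freeEnergy θ x := by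
  wlog h0 : 0 ≤ x generalizing x
  · rw [← freeEnergy_neg θ x]
    exact this (by rwa [abs_neg]) (by linarith)
  have hθ := h.theta_pos
  rw [abs_of_nonneg h0] at hx
  rcases lt_or_gt_of_ne hx with h1 | h1
  · have : StrictAntiOn (freeEnergy θ) (Set.Icc 0 m) := by
      refine strictAntiOn_of_deriv_neg (convex_Icc 0 m) (continuous_freeEnergy θ).continuousOn ?_
      intro z hz
      rw [interior_Icc] at hz
      rw [(hasDerivAt_freeEnergy θ z).deriv]
      exact mul_neg_of_pos_of_neg (by positivity) (by linarith [h.lt_tanh hz.1 hz.2])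
    exact this ⟨h0, h1.le⟩ ⟨h.pos.le, le_rfl⟩ h1
  · have : StrictMonoOn (freeEnergy θ) (Set.Ici m) := by
      refine strictMonoOn_of_deriv_pos (convex_Ici m) (continuous_freeEnergy θ).continuousOn ?_
      intro z hz
      rw [interior_Ici] at hz
      rw [(hasDerivAt_freeEnergy θ z).deriv]
      exact mul_pos (by positivity) (by linarith [h.tanh_lt hz])
    exact this (Set.mem_Ici.2 le_rfl) (Set.mem_Ici.2 h1.le) h1

lemma IsMagnetization.freeEnergy_le (h : IsMagnetization θ m) (x : ℝ) :
    freeEnergy θ m ≤ freeEnergy θ x := by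
  by_cases hx : |x| = m
  · rcases abs_eq h.pos.le |>.1 hx with rfl | rfl
    · rfl
    · rw [freeEnergy_neg]
  · exact (h.freeEnergy_lt hx).le

/-- Approximate zeros of a continuous function on a compact interval are close to its zeros. -/
lemma exists_pos_forall_le_imp {f g : ℝ → ℝ} (hf : Continuous f) (hg : Continuous g) {δ : ℝ}
    (h : ∀ x ∈ Set.Icc (-1 : ℝ) 1, f x ≤ 0 → g x < δ) :
    ∃ η > 0, ∀ x ∈ Set.Icc (-1 : ℝ) 1, f x ≤ η → g x < δ := by
  have hK : IsCompact (Set.Icc (-1 : ℝ) 1 ∩ {x | δ ≤ g x}) :=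
    isCompact_Icc.inter_right (isClosed_le continuous_const hg)
  rcases (Set.Icc (-1 : ℝ) 1 ∩ {x | δ ≤ g x}).eq_empty_or_nonempty with h0 | h0
  · refine ⟨1, one_pos, fun x hx _ => ?_⟩
    by_contra hlt
    have : x ∈ Set.Icc (-1 : ℝ) 1 ∩ {x | δ ≤ g x} := ⟨hx, not_lt.1 hlt⟩
    rw [h0] at this
    exact this
  · obtain ⟨x₀, hx₀, hmin⟩ := hK.exists_isMinOn h0 hf.continuousOn
    have hpos : 0 < f x₀ := by
      by_contra hle
      exact absurd (h x₀ hx₀.1 (not_lt.1 hle)) (not_lt.2 hx₀.2)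
    refine ⟨f x₀ / 2, by positivity, fun x hx hfx => ?_⟩
    by_contra hlt
    have : f x₀ ≤ f x := hmin ⟨hx, not_lt.1 hlt⟩
    linarith

lemma IsMagnetization.exists_freeEnergy_gap (h : IsMagnetization θ m) {δ : ℝ} (hδ : 0 < δ) :
    ∃ η > 0, ∀ x ∈ Set.Icc (-1 : ℝ) 1, freeEnergy θ x - freeEnergy θ m ≤ η → |(|x| - m)| < δ := by
  refine exists_pos_forall_le_imp (f := fun x => freeEnergy θ x - freeEnergy θ m)
    (g := fun x => |(|x| - m)|) ((continuous_freeEnergy θ).sub continuous_const)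
    ((continuous_abs.sub continuous_const).abs) fun x _ hx => ?_
  have : |x| = m := by
    by_contra hne
    linarith [h.freeEnergy_lt hne]
  rw [this]; simpa using hδ

lemma IsMagnetization.exists_root_gap (h : IsMagnetization θ m) {δ : ℝ} (hδ : 0 < δ) :
    ∃ η > 0, ∀ y ∈ Set.Icc (-1 : ℝ) 1, |y - Real.tanh (θ * (y + m))| ≤ η → |y - m| < δ := by
  refine exists_pos_forall_le_imp (f := fun y => |y - Real.tanh (θ * (y + m))|)
    (g := fun y => |y - m|) ((continuous_id.sub (continuous_tanh.comp (continuous_const.mul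
      (continuous_id.add continuous_const)))).abs)
    ((continuous_id.sub continuous_const).abs) fun y _ hy => ?_
  have : y = m := h.eq_of_tanh_eq (by
    have := abs_nonpos_iff.1 hy
    linarith)
  simpa [this] using hδ

/-- The excess free energy of a pair of vertices with normalized degrees `a` and `b`. -/
def pairExcess (θ m a b : ℝ) : ℝ :=
  θ / 2 * (a ^ 2 + b ^ 2) - Real.log (Real.cosh (θ * (a + b))) - freeEnergy θ m

/-- The point of the definition: the excess splits into two nonnegative parts, one forcing the mean
of a and b to be near ±m and one forcing a and b together. -/
lemma pairExcess_eq (θ m a b : ℝ) : pairExcess θ m a b =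
    (freeEnergy θ ((a + b) / 2) - freeEnergy θ m) + θ / 4 * (a - b) ^ 2 := by
  rw [pairExcess, freeEnergy.eq_1 θ ((a + b) / 2), show 2 * θ * ((a + b) / 2) = θ * (a + b) by ring]
  ring

lemma pairExcess_comm (θ m a b : ℝ) : pairExcess θ m a b = pairExcess θ m b a := by
  simp only [pairExcess, add_comm]

/-- A vector with small total excess free energy is close to a constant vector `± m`. -/
lemma IsMagnetization.exists_bulk (h : IsMagnetization θ m) {δ : ℝ} (hδ : 0 < δ) :
    ∃ ε > 0, ∀ (n : ℕ), 2 ≤ n → ∀ y : Fin n → ℝ, (∀ i, |y i| ≤ 1) →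
      ∑ e : Edge n, pairExcess θ m (y e.1.1) (y e.1.2) ≤ ε * (n : ℝ) ^ 2 →
      ∑ j, |y j - m| ≤ δ * n ∨ ∑ j, |y j - -m| ≤ δ * n := by
  have hθ := h.theta_pos
  obtain ⟨η, hη, hgap⟩ := h.exists_freeEnergy_gap (half_pos hδ)
  set ρ := min (δ / 2) (η / (8 * θ)) with hρ
  have hρ0 : 0 < ρ := lt_min (by positivity) (by positivity)
  refine ⟨min (θ * ρ ^ 2 / 8) (η / 8), lt_min (by positivity) (by positivity), ?_⟩
  intro n hn y hy hsum
  set ε := min (θ * ρ ^ 2 / 8) (η / 8) with hε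
  have hε1 : ε ≤ θ * ρ ^ 2 / 8 := min_le_left _ _
  have hε2 : ε ≤ η / 8 := min_le_right _ _
  have hρ1 : ρ ≤ δ / 2 := min_le_left _ _
  have hρ2 : ρ * (8 * θ) ≤ η := by
    rw [← le_div_iff₀ (by positivity)]; exact min_le_right _ _
  have hn' : (2 : ℝ) ≤ n := by exact_mod_cast hn
  -- Each edge counts at both ends, so an average vertex carries at most 2εn of the excess; this
  -- vertex serves as reference for all others.
  obtain ⟨i, hi⟩ : ∃ i : Fin n,
      ∑ e : Edge n, inc i e * pairExcess θ m (y e.1.1) (y e.1.2) ≤ 2 * ε * n := by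
    have htot : ∑ i : Fin n, ∑ e : Edge n, inc i e * pairExcess θ m (y e.1.1) (y e.1.2) ≤
        ∑ _i : Fin n, 2 * ε * n := by
      rw [Finset.sum_comm]
      have : ∀ e : Edge n, ∑ i, inc i e * pairExcess θ m (y e.1.1) (y e.1.2) =
          2 * pairExcess θ m (y e.1.1) (y e.1.2) := fun e => by
        rw [sum_inc_mul fun _ => pairExcess θ m (y e.1.1) (y e.1.2)]; ring
      simp only [this, ← Finset.mul_sum]
      simp
      nlinarith
    obtain ⟨i, -, hi⟩ := Finset.exists_le_of_sum_le ⟨⟨0, by omega⟩, Finset.mem_univ _⟩ htot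
    exact ⟨i, hi⟩
  have hi' : ∑ j, (if j = i then 0 else pairExcess θ m (y i) (y j)) ≤ 2 * ε * n := by
    rw [sum_incident] at hi
    refine le_trans (le_of_eq (Finset.sum_congr rfl fun j _ => ?_)) hi
    rcases lt_trichotomy i j with h1 | h1 | h1
    · simp [h1, h1.ne']
    · simp [h1]
    · simp [h1, h1.ne, h1.not_gt, pairExcess_comm θ m (y i)]
  have hsq : ∑ j, (y i - y j) ^ 2 ≤ ρ ^ 2 * n := by
    have h1 : θ / 4 * ∑ j, (y i - y j) ^ 2 ≤ 2 * ε * n := by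
      refine le_trans ?_ hi'
      rw [Finset.mul_sum]
      refine Finset.sum_le_sum fun j _ => ?_
      split_ifs with hj
      · simp [hj]
      · rw [pairExcess_eq]
        linarith [h.freeEnergy_le ((y i + y j) / 2)]
    have h2 : 2 * ε * n ≤ 2 * (θ * ρ ^ 2 / 8) * n := by gcongr
    have h3 : θ / 4 * ∑ j, (y i - y j) ^ 2 ≤ θ / 4 * (ρ ^ 2 * n) := by linarith
    exact le_of_mul_le_mul_left h3 (by positivity)
  have habs : ∑ j, |y i - y j| ≤ ρ * n := by
    have h1 := sq_sum_le_card_mul_sum_sq (s := Finset.univ) (f := fun j => |y i - y j|)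
    simp only [sq_abs, Finset.card_univ, Fintype.card_fin] at h1
    refine le_of_sq_le_sq (h1.trans ?_) (by positivity)
    calc (n : ℝ) * ∑ j, (y i - y j) ^ 2 ≤ n * (ρ ^ 2 * n) := by gcongr
      _ = _ := by ring
  -- Replacing the mean of y_i and y_j by y_i costs 2θ|y_i − y_j|, by the Lipschitz constant 4θ; sum
  -- over j and use n − 1 ≥ n/2.
  have hF : freeEnergy θ (y i) - freeEnergy θ m ≤ η := by
    have h1 : ((n : ℝ) - 1) * (freeEnergy θ (y i) - freeEnergy θ m) ≤
        2 * ε * n + 2 * θ * (ρ * n) := by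
      have h2 : ∑ j, (if j = i then 0 else freeEnergy θ (y i) - freeEnergy θ m) =
          ((n : ℝ) - 1) * (freeEnergy θ (y i) - freeEnergy θ m) := by
        have : ∀ j, (if j = i then 0 else freeEnergy θ (y i) - freeEnergy θ m) =
            (freeEnergy θ (y i) - freeEnergy θ m) -
              if j = i then (freeEnergy θ (y i) - freeEnergy θ m) else 0 := fun j => by
          split_ifs <;> ring
        rw [Finset.sum_congr rfl fun j _ => this j, Finset.sum_sub_distrib]
        simp
        ring
      rw [← h2]
      calc _ ≤ ∑ j, ((if j = i then 0 else pairExcess θ m (y i) (y j)) +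
            2 * θ * |y i - y j|) := by
            refine Finset.sum_le_sum fun j _ => ?_
            split_ifs with hj
            · simp [hj]
            · rw [pairExcess_eq]
              have h3 : |(y i + y j) / 2| ≤ 1 := by
                have := abs_le.1 (hy i)
                have := abs_le.1 (hy j)
                rw [abs_le]; constructor <;> linarith
              have h4 := abs_freeEnergy_sub_le hθ.le (hy i) h3
              rw [show y i - (y i + y j) / 2 = (y i - y j) / 2 by ring, abs_div,
                abs_of_pos (two_pos (α := ℝ))] at h4
              have h5 : 0 ≤ θ / 4 * (y i - y j) ^ 2 := by positivity
              linarith [le_abs_self (freeEnergy θ (y i) - freeEnergy θ ((y i + y j) / 2))]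
        _ ≤ _ := by
            rw [Finset.sum_add_distrib, ← Finset.mul_sum]
            gcongr
    have h2 : 0 ≤ freeEnergy θ (y i) - freeEnergy θ m := sub_nonneg.2 (h.freeEnergy_le _)
    have h3 : (n : ℝ) / 2 * (freeEnergy θ (y i) - freeEnergy θ m) ≤ n / 2 * η := by
      have h4 : (n : ℝ) / 2 * (freeEnergy θ (y i) - freeEnergy θ m) ≤
          ((n : ℝ) - 1) * (freeEnergy θ (y i) - freeEnergy θ m) := by
        gcongr; linarith
      have h5 : 2 * ε * n + 2 * θ * (ρ * n) ≤ n / 2 * η := by nlinarith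
      linarith
    exact le_of_mul_le_mul_left h3 (by positivity)
  have hclose := hgap (y i) (abs_le.1 (hy i)) hF
  have fin : ∀ τ : ℝ, |y i - τ| ≤ δ / 2 → ∑ j, |y j - τ| ≤ δ * n := by
    intro τ hτ
    calc ∑ j, |y j - τ| ≤ ∑ j, (|y i - y j| + δ / 2) := by
          refine Finset.sum_le_sum fun j _ => ?_
          have := abs_add_le (y j - y i) (y i - τ)
          rw [sub_add_sub_cancel, abs_sub_comm (y j) (y i)] at this
          linarith
      _ ≤ ρ * n + n * (δ / 2) := by
          rw [Finset.sum_add_distrib]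
          simp
          linarith
      _ ≤ δ * n := by nlinarith
  rcases le_total 0 (y i) with h0 | h0
  · left
    rw [abs_of_nonneg h0] at hclose
    exact fin m hclose.le
  · right
    rw [abs_of_nonpos h0] at hclose
    refine fin (-m) ?_
    rw [show y i - -m = -(-y i - m) by ring, abs_neg]
    exact hclose.le

end MeanField

/-! ### Concentration of all degrees near +m or −m. -/

section Phases

variable {n : ℕ} {θ m : ℝ}

lemma sum_exp_edges (c : Edge n → ℝ) :
    ∑ Y : Config n, Real.exp (∑ e, c e * edgeVal Y e) =
      Real.exp (∑ e, (Real.log 2 + Real.log (Real.cosh (c e)))) := by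
  have h := Finset.prod_univ_sum (fun _ : Edge n => (Finset.univ : Finset ℤˣ))
    (fun e x => Real.exp (c e * spinVal x))
  rw [Fintype.piFinset_univ] at h
  have h1 : ∀ Y : Config n, Real.exp (∑ e, c e * edgeVal Y e) =
      ∏ e, Real.exp (c e * spinVal (Y e)) := fun Y => by
    rw [Real.exp_sum]; rfl
  rw [Finset.sum_congr rfl fun Y _ => h1 Y, ← h, Real.exp_sum]
  refine Finset.prod_congr rfl fun e _ => ?_
  rw [Real.exp_add, Real.exp_log two_pos, Real.exp_log (Real.cosh_pos _), sum_units_int,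
    Real.cosh_eq]
  simp [spinVal]
  ring

lemma weight_null_zero (hn : 2 ≤ n) (θ : ℝ) (Y : Config n) :
    weight θ (nullParam n 0) Y = Real.exp (-(θ * n / 2)) *
      Real.exp (θ / (2 * ((n : ℝ) - 1)) * ∑ i, deg Y i ^ 2) := by
  rw [weight_eq hn]; simp [nullParam]

/-- Dropping the squares (k_i − (n − 1)m)² bounds the energy below by a linear function of the
spins, whose partition function factorizes. -/
lemma le_partitionFn_null (hn : 2 ≤ n) (hm : IsMagnetization θ m) :
    Real.exp (-(θ * n / 2)) *
      Real.exp (∑ _e : Edge n, (Real.log 2 - freeEnergy θ m)) ≤ partitionFn θ (nullParam n 0) := by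
  have hn' : (0 : ℝ) < (n : ℝ) - 1 := by
    have : (2 : ℝ) ≤ n := by exact_mod_cast hn
    linarith
  have hθ := hm.theta_pos
  simp only [partitionFn, weight_null_zero hn]
  rw [← Finset.mul_sum]
  refine mul_le_mul_of_nonneg_left ?_ (Real.exp_pos _).le
  have h1 : ∀ Y : Config n, ∑ e, (2 * θ * m) * edgeVal Y e - ∑ _e : Edge n, θ * m ^ 2 ≤
      θ / (2 * ((n : ℝ) - 1)) * ∑ i, deg Y i ^ 2 := by
    intro Y
    have h2 := sum_mul_deg (fun _ => θ * m) Y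
    have h3 := sum_edge_endpoints (n := n) (fun _ => θ * m ^ 2 / 2)
    have h4 : ∑ e, (2 * θ * m) * edgeVal Y e = ∑ i, θ * m * deg Y i := by
      rw [h2]; refine Finset.sum_congr rfl fun e _ => by ring
    have h5 : ∑ _e : Edge n, θ * m ^ 2 = ∑ _i : Fin n, ((n : ℝ) - 1) * (θ * m ^ 2 / 2) := by
      rw [← Finset.mul_sum Finset.univ (fun _ : Fin n => θ * m ^ 2 / 2), ← h3]
      refine Finset.sum_congr rfl fun e _ => by ring
    rw [h4, h5, ← Finset.sum_sub_distrib, Finset.mul_sum]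
    refine Finset.sum_le_sum fun i _ => ?_
    have h6 : θ / (2 * ((n : ℝ) - 1)) * deg Y i ^ 2 -
        (θ * m * deg Y i - ((n : ℝ) - 1) * (θ * m ^ 2 / 2)) =
        θ / (2 * ((n : ℝ) - 1)) * (deg Y i - ((n : ℝ) - 1) * m) ^ 2 := by
      field_simp
      ring
    have h7 : 0 ≤ θ / (2 * ((n : ℝ) - 1)) * (deg Y i - ((n : ℝ) - 1) * m) ^ 2 := by positivity
    linarith
  calc Real.exp (∑ _e : Edge n, (Real.log 2 - freeEnergy θ m))
      = ∑ Y : Config n, Real.exp (∑ e, (2 * θ * m) * edgeVal Y e - ∑ _e : Edge n, θ * m ^ 2) := by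
        simp only [Real.exp_sub]
        rw [← Finset.sum_div, sum_exp_edges, ← Real.exp_sub, ← Finset.sum_sub_distrib]
        congr 1
        refine Finset.sum_congr rfl fun e _ => ?_
        rw [freeEnergy]; ring
    _ ≤ _ := Finset.sum_le_sum fun Y _ => Real.exp_le_exp.2 (h1 Y)

/-- On the event k = deg Y one has k_i² = 2 k_i deg_i − k_i², so the quadratic energy may be
replaced by a linear one. Its sum over all configurations factorizes over edges and is compared with
`le_partitionFn_null`. -/
lemma prob_deg_eq_le (hn : 2 ≤ n) (hm : IsMagnetization θ m) (k : Fin n → ℝ) :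
    prob θ (nullParam n 0) {Y | deg Y = k} ≤ Real.exp (-∑ e : Edge n,
      pairExcess θ m (k e.1.1 / ((n : ℝ) - 1)) (k e.1.2 / ((n : ℝ) - 1))) := by
  have hn' : (0 : ℝ) < (n : ℝ) - 1 := by
    have : (2 : ℝ) ≤ n := by exact_mod_cast hn
    linarith
  have hZ : 0 < ∑ Y : Config n, weight θ (nullParam n 0) Y := partitionFn_pos θ _
  rw [prob_eq_avg, avg, div_le_iff₀ hZ]
  set ν := (n : ℝ) - 1 with hν
  have h1 : ∀ Y : Config n, weight θ (nullParam n 0) Y *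
      ({Y | deg Y = k} : Set (Config n)).indicator 1 Y ≤
      Real.exp (-(θ * n / 2)) * (Real.exp (-(θ / (2 * ν) * ∑ i, k i ^ 2)) *
        Real.exp (∑ e, (θ * (k e.1.1 / ν + k e.1.2 / ν)) * edgeVal Y e)) := by
    intro Y
    by_cases hY : deg Y = k
    · rw [Set.indicator_of_mem (show Y ∈ {Y | deg Y = k} from hY), Pi.one_apply, mul_one,
        weight_null_zero hn, ← Real.exp_add (-(θ / (2 * ν) * ∑ i, k i ^ 2))]
      refine mul_le_mul_of_nonneg_left (Real.exp_le_exp.2 (le_of_eq ?_)) (Real.exp_pos _).le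
      have h2 := sum_mul_deg (fun i => θ * (k i / ν)) Y
      have h3 : ∑ e, (θ * (k e.1.1 / ν + k e.1.2 / ν)) * edgeVal Y e =
          ∑ i, θ * (k i / ν) * deg Y i := by
        rw [h2]; refine Finset.sum_congr rfl fun e _ => by ring
      rw [h3, hY, ← hν, Finset.mul_sum, ← Finset.sum_neg_distrib, ← Finset.sum_add_distrib]
      refine Finset.sum_congr rfl fun i _ => ?_
      field_simp
      ring
    · rw [Set.indicator_of_notMem (show Y ∉ {Y | deg Y = k} from hY), mul_zero]
      positivity
  refine (Finset.sum_le_sum fun Y _ => h1 Y).trans ?_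
  rw [← Finset.mul_sum, ← Finset.mul_sum, sum_exp_edges, ← Real.exp_add]
  have h4 : -(θ / (2 * ν) * ∑ i, k i ^ 2) +
      ∑ e : Edge n, (Real.log 2 + Real.log (Real.cosh (θ * (k e.1.1 / ν + k e.1.2 / ν)))) =
      -∑ e : Edge n, pairExcess θ m (k e.1.1 / ν) (k e.1.2 / ν) +
        ∑ _e : Edge n, (Real.log 2 - freeEnergy θ m) := by
    have h5 := sum_edge_endpoints (n := n) (fun i => θ / 2 * (k i / ν) ^ 2)
    have h6 : θ / (2 * ν) * ∑ i, k i ^ 2 =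
        ∑ e : Edge n, (θ / 2 * (k e.1.1 / ν) ^ 2 + θ / 2 * (k e.1.2 / ν) ^ 2) := by
      rw [h5, ← hν, Finset.mul_sum, Finset.mul_sum]
      refine Finset.sum_congr rfl fun i _ => ?_
      field_simp
    rw [h6, ← Finset.sum_neg_distrib, ← Finset.sum_neg_distrib, ← Finset.sum_add_distrib,
      ← Finset.sum_add_distrib]
    refine Finset.sum_congr rfl fun e _ => ?_
    rw [pairExcess]; ring
  rw [h4, Real.exp_add, mul_left_comm]
  exact mul_le_mul_of_nonneg_left (le_partitionFn_null hn hm) (Real.exp_pos _).le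

lemma exists_deg_eq_sub (Y : Config n) (i : Fin n) :
    ∃ k : Fin (2 * n + 1), deg Y i = (k : ℝ) - n := by
  obtain ⟨z, hz⟩ : ∃ z : ℤ, deg Y i = z := by
    refine ⟨∑ e, (if e.1.1 = i ∨ e.1.2 = i then 1 else 0) * (Y e : ℤ), ?_⟩
    rw [deg_eq]
    push_cast
    rfl
  have h := abs_le.1 (abs_deg_le Y i)
  rw [hz] at h
  have h1 : -(n : ℤ) ≤ z := by
    have : (-(n : ℝ)) ≤ z := by linarith [h.1]
    exact_mod_cast this
  have h2 : z ≤ n := by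
    have : (z : ℝ) ≤ n := by linarith [h.2]
    exact_mod_cast this
  refine ⟨⟨(z + n).toNat, by omega⟩, ?_⟩
  have h3 : (((z + n).toNat : ℤ) : ℝ) = ((z + n : ℤ) : ℝ) := by
    rw [Int.toNat_of_nonneg (by omega)]
  rw [hz]
  push_cast at h3
  simp only
  linarith

/-- The total excess free energy of the degree sequence. -/
def totalExcess (θ m : ℝ) (Y : Config n) : ℝ :=
  ∑ e : Edge n, pairExcess θ m (deg Y e.1.1 / ((n : ℝ) - 1)) (deg Y e.1.2 / ((n : ℝ) - 1))

/-- A union bound over degree sequences: their number is exp(O(n log n)), negligible against an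
excess of order n². -/
lemma prob_totalExcess_gt_le (hn : 2 ≤ n) (hm : IsMagnetization θ m) (a : ℝ) :
    prob θ (nullParam n 0) {Y | a < totalExcess θ m Y} ≤
      ((2 * n + 1 : ℕ) : ℝ) ^ n * Real.exp (-a) := by
  classical
  let S : (Fin n → Fin (2 * n + 1)) → Set (Config n) := fun k =>
    {Y | deg Y = (fun i => ((k i : ℕ) : ℝ) - n) ∧ a < totalExcess θ m Y}
  have hsub : {Y : Config n | a < totalExcess θ m Y} ⊆ ⋃ k, S k := by
    intro Y hY
    choose k hk using exists_deg_eq_sub Y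
    exact Set.mem_iUnion.2 ⟨k, funext hk, hY⟩
  refine (prob_mono _ _ hsub).trans ((prob_iUnion_le _ _ _).trans ?_)
  refine (Finset.sum_le_card_nsmul _ _ (Real.exp (-a)) fun k _ => ?_).trans (by simp)
  by_cases h : ∃ Y, Y ∈ S k
  · obtain ⟨Y, hY, hY'⟩ := h
    refine (prob_mono _ _ (show S k ⊆ {Y | deg Y = (fun i => ((k i : ℕ) : ℝ) - n)} from
      fun Z hZ => hZ.1)).trans ((prob_deg_eq_le hn hm _).trans ?_)
    rw [Real.exp_le_exp, neg_le_neg_iff]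
    rw [totalExcess, hY] at hY'
    exact hY'.le
  · have : S k = ∅ := Set.eq_empty_iff_forall_notMem.2 fun Y hY => h ⟨Y, hY⟩
    rw [this, prob_eq_avg]
    simp [avg]
    exact (Real.exp_pos _).le

lemma weight_add (θ : ℝ) (β γ : Fin n → ℝ) (Y : Config n) :
    weight θ (β + γ) Y = weight θ β Y * Real.exp (1 / 2 * ∑ i, γ i * deg Y i) := by
  rw [weight, weight, ← Real.exp_add]
  congr 1
  simp only [Pi.add_apply, add_mul, Finset.sum_add_distrib]
  ring

/-- The sum of all degrees. -/
def totalDeg (Y : Config n) : ℝ := ∑ i, deg Y i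

lemma abs_totalDeg_le (Y : Config n) : |totalDeg Y| ≤ (n : ℝ) * ((n : ℝ) - 1) := by
  refine (Finset.abs_sum_le_sum_abs _ _).trans
    ((Finset.sum_le_sum fun i _ => abs_deg_le Y i).trans ?_)
  rw [Finset.sum_const]
  simp

lemma weight_add_null (θ : ℝ) (β : Fin n → ℝ) (h : ℝ) (Y : Config n) :
    weight θ (β + nullParam n h) Y = weight θ β Y * Real.exp (h / 2 * totalDeg Y) := by
  rw [weight_add, totalDeg, Finset.mul_sum, Finset.mul_sum]
  congr 2
  refine Finset.sum_congr rfl fun i _ => ?_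
  rw [nullParam]; ring

lemma weight_null (θ h : ℝ) (Y : Config n) :
    weight θ (nullParam n h) Y =
      weight θ (nullParam n 0) Y * Real.exp (h / 2 * totalDeg Y) := by
  rw [← weight_add_null, nullParam_zero_add]

/-- Crude, but harmless: it is used with h n² = O(log n), a polynomial factor in n. -/
lemma prob_null_le (θ : ℝ) {h : ℝ} (hh : 0 ≤ h) (S : Set (Config n)) :
    prob θ (nullParam n h) S ≤ Real.exp (h * (n : ℝ) ^ 2) * prob θ (nullParam n 0) S := by
  have hb : ∀ Y : Config n, |h / 2 * totalDeg Y| ≤ h / 2 * (n : ℝ) ^ 2 := fun Y => by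
    rw [abs_mul, abs_of_nonneg (by positivity)]
    refine mul_le_mul_of_nonneg_left ((abs_totalDeg_le Y).trans ?_) (by positivity)
    have : (0 : ℝ) ≤ n := by positivity
    nlinarith
  have hI : ∀ Y, (0 : ℝ) ≤ S.indicator 1 Y := fun Y => Set.indicator_nonneg (by simp) Y
  set E := Real.exp (h / 2 * (n : ℝ) ^ 2) with hE
  have hE0 : 0 < E := Real.exp_pos _
  have hEE : Real.exp (h * (n : ℝ) ^ 2) = E * E := by
    rw [hE, ← Real.exp_add]; ring_nf
  have hZ0 := sum_weight_pos (weight_pos θ (nullParam n 0))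
  have hZ : ∑ Y : Config n, weight θ (nullParam n 0) Y ≤
      E * ∑ Y : Config n, weight θ (nullParam n h) Y := by
    rw [Finset.mul_sum]
    refine Finset.sum_le_sum fun Y _ => ?_
    rw [weight_null θ h, mul_left_comm]
    refine le_mul_of_one_le_right (weight_pos _ _ _).le ?_
    rw [hE, ← Real.exp_add, ← Real.exp_zero]
    exact Real.exp_le_exp.2 (by linarith [(abs_le.1 (hb Y)).1])
  have hS : ∑ Y : Config n, weight θ (nullParam n h) Y * S.indicator 1 Y ≤
      E * ∑ Y : Config n, weight θ (nullParam n 0) Y * S.indicator 1 Y := by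
    rw [Finset.mul_sum]
    refine Finset.sum_le_sum fun Y _ => ?_
    rw [weight_null θ h, mul_right_comm, mul_comm E]
    refine mul_le_mul_of_nonneg_left ?_ (mul_nonneg (weight_pos _ _ _).le (hI Y))
    exact Real.exp_le_exp.2 (abs_le.1 (hb Y)).2
  have hZh := sum_weight_pos (weight_pos θ (nullParam n h))
  rw [prob_eq_avg, prob_eq_avg, avg, avg, hEE, ← mul_div_assoc, div_le_div_iff₀ hZh hZ0]
  have hS0 : 0 ≤ ∑ Y : Config n, weight θ (nullParam n 0) Y * S.indicator 1 Y :=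
    Finset.sum_nonneg fun Y _ => mul_nonneg (weight_pos _ _ _).le (hI Y)
  calc _ ≤ (E * ∑ Y : Config n, weight θ (nullParam n 0) Y * S.indicator 1 Y) *
        (E * ∑ Y : Config n, weight θ (nullParam n h) Y) :=
        mul_le_mul hS hZ hZ0.le (mul_nonneg hE0.le hS0)
    _ = _ := by ring

/-- The configurations all of whose normalized degrees are close to `τ`. -/
def phase (n : ℕ) (τ δ : ℝ) : Set (Config n) :=
  {Y | ∀ i, |deg Y i / ((n : ℝ) - 1) - τ| ≤ δ}

/-- The field at an edge ij is θ(y_i + y_j) up to O(1/n) + h. Replacing y_j by τ costs only the ℓ¹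
distance of the degrees to τ, so ℓ¹ control of the bulk yields an equation at every single vertex.
-/
lemma abs_deg_sub_tanh_le (hn : 2 ≤ n) (hθ : 0 ≤ θ) {h : ℝ} (hh : 0 ≤ h) (τ : ℝ) (Y : Config n)
    (i : Fin n) :
    |deg Y i - ((n : ℝ) - 1) * Real.tanh (θ * (deg Y i / ((n : ℝ) - 1) + τ))| ≤
      |centeredSum θ (nullParam n h) (incident i) Y| +
        (θ * ∑ j, |deg Y j / ((n : ℝ) - 1) - τ| + 2 * θ + h * ((n : ℝ) - 1)) := by
  have hn' : (0 : ℝ) < (n : ℝ) - 1 := by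
    have : (2 : ℝ) ≤ n := by exact_mod_cast hn
    linarith
  set ν := (n : ℝ) - 1 with hν
  set y : Fin n → ℝ := fun j => deg Y j / ν with hy
  have h1 : centeredSum θ (nullParam n h) (incident i) Y =
      ∑ e, inc i e * centered θ (nullParam n h) e Y := by
    rw [centeredSum, incident, sum_filter_incident]
  have h2 : deg Y i - ν * Real.tanh (θ * (y i + τ)) =
      centeredSum θ (nullParam n h) (incident i) Y +
      ∑ e, inc i e * (Real.tanh (field θ (nullParam n h) e Y) - Real.tanh (θ * (y i + τ))) := by
    rw [h1, ← Finset.sum_add_distrib, deg_eq, hν, ← sum_inc i, Finset.sum_mul,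
      ← Finset.sum_sub_distrib]
    refine Finset.sum_congr rfl fun e _ => ?_
    rw [centered]; ring
  rw [h2]
  refine (abs_add_le _ _).trans (add_le_add le_rfl ?_)
  set g : Fin n → ℝ := fun j => |y j - τ| with hg
  have h3 : ∀ e : Edge n, |inc i e * (Real.tanh (field θ (nullParam n h) e Y) -
      Real.tanh (θ * (y i + τ)))| ≤
      θ * (inc i e * (g e.1.1 + g e.1.2)) + inc i e * (2 * θ / ν + h - θ * g i) := by
    intro e
    rw [abs_mul, abs_of_nonneg (inc_nonneg i e)]
    by_cases he : e.1.1 = i ∨ e.1.2 = i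
    · have hie : inc i e = 1 := if_pos he
      rw [hie, one_mul, one_mul, one_mul]
      refine (abs_tanh_sub_le _ _).trans ?_
      have hsplit : field θ (nullParam n h) e Y - θ * (y i + τ) =
          θ * (y e.1.1 + y e.1.2 - y i - τ) + (-(2 * θ / ν) * edgeVal Y e + h) := by
        simp only [field, nullParam, hy]
        rw [← hν]
        field_simp
        ring
      have ha : |y e.1.1 + y e.1.2 - y i - τ| = g e.1.1 + g e.1.2 - g i := by
        rcases he with he | he
        · rw [he]; simp only [hg]; rw [add_sub_cancel_left]; ring
        · rw [he]; simp only [hg]; rw [add_sub_cancel_right]; ring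
      rw [hsplit]
      refine (abs_add_le _ _).trans ?_
      rw [abs_mul, abs_of_nonneg hθ, ha]
      have hb : |(-(2 * θ / ν) * edgeVal Y e + h)| ≤ 2 * θ / ν + h := by
        refine (abs_add_le _ _).trans ?_
        rw [abs_mul, abs_edgeVal, abs_neg, mul_one, abs_of_nonneg (by positivity),
          abs_of_nonneg hh]
      linarith
    · have hie : inc i e = 0 := if_neg he
      rw [hie]; simp
  refine (Finset.abs_sum_le_sum_abs _ _).trans ((Finset.sum_le_sum fun e _ => h3 e).trans ?_)
  rw [Finset.sum_add_distrib, ← Finset.mul_sum, ← Finset.sum_mul, sum_inc, sum_inc_mul_endpoints,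
    ← hν]
  have hgi : 0 ≤ θ * g i := mul_nonneg hθ (abs_nonneg _)
  have : ν * (2 * θ / ν + h - θ * g i) = 2 * θ + h * ν - ν * (θ * g i) := by
    field_simp
  rw [this]
  have hn2 : (n : ℝ) - 2 = ν - 1 := by rw [hν]; ring
  rw [hn2]
  nlinarith

/-- Small excess free energy and small conditionally centered degrees force a pure phase. -/
lemma IsMagnetization.exists_phase (hm : IsMagnetization θ m) {δ : ℝ} (hδ : 0 < δ) :
    ∃ ε > 0, ∃ η > 0, ∃ n₀ : ℕ, ∀ n : ℕ, n₀ ≤ n → 2 ≤ n → ∀ h : ℝ, 0 ≤ h →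
      h * ((n : ℝ) - 1) ≤ 1 → ∀ Y : Config n, totalExcess θ m Y ≤ ε * (n : ℝ) ^ 2 →
      (∀ i, |centeredSum θ (nullParam n h) (incident i) Y| ≤ η * n) →
      Y ∈ phase n m δ ∪ phase n (-m) δ := by
  have hθ := hm.theta_pos
  obtain ⟨η₀, hη₀, hroot⟩ := hm.exists_root_gap hδ
  obtain ⟨ε, hε, hbulk⟩ := hm.exists_bulk (show 0 < η₀ / (8 * θ) by positivity)
  -- Error budget: the centered degree, the ℓ¹ distance and the term 2θ + 1 each take at most η₀(n −
  -- 1)/4.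
  obtain ⟨n₀, hn₀⟩ := exists_nat_ge ((2 * θ + 1) * (4 / η₀) + 1)
  refine ⟨ε, hε, η₀ / 8, by positivity, n₀, fun n hnn hn h hh hh1 Y hY hc => ?_⟩
  have hn2 : (2 : ℝ) ≤ n := by exact_mod_cast hn
  have hn' : (0 : ℝ) < (n : ℝ) - 1 := by linarith
  have hnn' : (2 * θ + 1) * (4 / η₀) + 1 ≤ n := hn₀.trans (by exact_mod_cast hnn)
  have hsmall : 2 * θ + 1 ≤ η₀ / 4 * ((n : ℝ) - 1) := by
    have : (2 * θ + 1) * (4 / η₀) ≤ (n : ℝ) - 1 := by linarith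
    calc 2 * θ + 1 = η₀ / 4 * ((2 * θ + 1) * (4 / η₀)) := by field_simp
      _ ≤ _ := by gcongr
  have hy1 : ∀ i, |deg Y i / ((n : ℝ) - 1)| ≤ 1 := fun i => by
    rw [abs_div, abs_of_pos hn', div_le_one hn']; exact abs_deg_le Y i
  have key : ∀ τ : ℝ, ∑ j, |deg Y j / ((n : ℝ) - 1) - τ| ≤ η₀ / (8 * θ) * n → ∀ i,
      |deg Y i / ((n : ℝ) - 1) - Real.tanh (θ * (deg Y i / ((n : ℝ) - 1) + τ))| ≤ η₀ := by
    intro τ hτ i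
    have h1 := abs_deg_sub_tanh_le hn hθ.le hh τ Y i
    have h2 : deg Y i / ((n : ℝ) - 1) - Real.tanh (θ * (deg Y i / ((n : ℝ) - 1) + τ)) =
        (deg Y i - ((n : ℝ) - 1) * Real.tanh (θ * (deg Y i / ((n : ℝ) - 1) + τ))) /
          ((n : ℝ) - 1) := by
      field_simp
    rw [h2, abs_div, abs_of_pos hn', div_le_iff₀ hn']
    have h3 : θ * ∑ j, |deg Y j / ((n : ℝ) - 1) - τ| ≤ η₀ / 8 * n := by
      calc _ ≤ θ * (η₀ / (8 * θ) * n) := by gcongr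
        _ = _ := by field_simp
    have h4 := hc i
    nlinarith
  rcases hbulk n hn (fun i => deg Y i / ((n : ℝ) - 1)) hy1 hY with hb | hb
  · left
    exact fun i => (hroot _ (abs_le.1 (hy1 i)) (key m hb i)).le
  · right
    intro i
    have h1 := key (-m) hb i
    set y := deg Y i / ((n : ℝ) - 1)
    -- Reflection y ↦ −y turns the equation of the negative phase into that of the positive one.
    have e1 : -y - Real.tanh (θ * (-y + m)) = -(y - Real.tanh (θ * (y + -m))) := by
      rw [show θ * (-y + m) = -(θ * (y + -m)) by ring, Real.tanh_neg]; ring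
    have h2 := hroot (-y) (abs_le.1 (by rw [abs_neg]; exact hy1 i)) (by rwa [e1, abs_neg])
    rw [show y - -m = -(-y - m) by ring, abs_neg]
    exact h2.le

lemma prob_abs_centeredSum_incident_gt_le (hn : 2 ≤ n) (hθ : 0 ≤ θ) (β : Fin n → ℝ) {η l : ℝ}
    (hl0 : 0 ≤ l) (hl1 : l * (2 + 4 * θ) ≤ 1) (hl2 : 6 * (2 + 4 * θ) * l ≤ η) (i : Fin n) :
    prob θ β {Y | η * n < |centeredSum θ β (incident i) Y|} ≤
      2 * Real.exp (-(l * η / 2 * n)) := by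
  have hsub : {Y : Config n | η * n < |centeredSum θ β (incident i) Y|} ⊆
      {Y | l * (η * n) ≤ l * centeredSum θ β (incident i) Y} ∪
      {Y | l * (η * n) ≤ (-l) * centeredSum θ β (incident i) Y} := by
    intro Y hY
    rcases lt_abs.1 (show η * n < |centeredSum θ β (incident i) Y| from hY) with h | h
    · left; exact mul_le_mul_of_nonneg_left h.le hl0
    · right
      have := mul_le_mul_of_nonneg_left h.le hl0
      change l * (η * n) ≤ (-l) * centeredSum θ β (incident i) Y
      linarith
  have hexp : 3 * (2 + 4 * θ) * (incident i).card * l ^ 2 - l * (η * n) ≤ -(l * η / 2 * n) := by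
    rw [card_incident]
    have h1 : 3 * (2 + 4 * θ) * ((n : ℝ) - 1) * l ^ 2 ≤ 3 * (2 + 4 * θ) * n * l ^ 2 := by
      gcongr; linarith
    have h2 : 3 * (2 + 4 * θ) * n * l ^ 2 ≤ l * η / 2 * n := by
      have : 0 ≤ n * l := by positivity
      nlinarith
    linarith
  refine (prob_mono _ _ hsub).trans ((prob_union_le _ _ _ _).trans ?_)
  rw [two_mul]
  refine add_le_add ?_ ?_
  · refine (prob_centeredSum_le hn hθ β _ (by rwa [abs_of_nonneg hl0]) _).trans ?_
    exact Real.exp_le_exp.2 hexp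
  · refine (prob_centeredSum_le hn hθ β _ (by rwa [abs_neg, abs_of_nonneg hl0]) _).trans ?_
    rw [neg_sq]
    exact Real.exp_le_exp.2 hexp

lemma tendsto_log_div_rpow {r : ℝ} (hr : 0 < r) :
    Tendsto (fun n : ℕ => Real.log n / (n : ℝ) ^ r) atTop (𝓝 0) :=
  ((isLittleO_log_rpow_atTop hr).tendsto_div_nhds_zero).comp tendsto_natCast_atTop_atTop

lemma eventually_log_le {ε : ℝ} (hε : 0 < ε) : ∀ᶠ n : ℕ in atTop, Real.log n ≤ ε * n := by
  filter_upwards [(tendsto_log_div_rpow one_pos).eventually_le_const hε, eventually_gt_atTop 0]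
    with n h hn
  rw [Real.rpow_one, div_le_iff₀ (by positivity)] at h
  exact h

/-- Up to probability `n⁻²` the model in a small uniform field is in one of the two phases. -/
lemma IsMagnetization.eventually_prob_phases (hm : IsMagnetization θ m) {δ : ℝ} (hδ : 0 < δ)
    {c : ℝ} (hc : 0 ≤ c) : ∀ᶠ n : ℕ in atTop, ∀ h : ℝ, 0 ≤ h → h * (n : ℝ) ^ 2 ≤ c * Real.log n →
      prob θ (nullParam n h) (phase n m δ ∪ phase n (-m) δ)ᶜ ≤ 1 / (n : ℝ) ^ 2 := by
  have hθ := hm.theta_pos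
  obtain ⟨ε, hε, η, hη, n₀, hph⟩ := hm.exists_phase hδ
  set l := min (1 / (2 + 4 * θ)) (η / (6 * (2 + 4 * θ))) with hl
  have hl0 : 0 < l := lt_min (by positivity) (by positivity)
  have hl1 : l * (2 + 4 * θ) ≤ 1 := by
    rw [← le_div_iff₀ (by positivity)]; exact min_le_left _ _
  have hl2 : 6 * (2 + 4 * θ) * l ≤ η := by
    rw [mul_comm, ← le_div_iff₀ (by positivity)]; exact min_le_right _ _
  have hr : 0 < l * η / 2 := by positivity
  filter_upwards [eventually_ge_atTop n₀, eventually_ge_atTop 3,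
    eventually_log_le (show 0 < 1 / (c + 1) by positivity),
    eventually_log_le (show 0 < ε / 4 / (c + 3 + 2) by positivity),
    eventually_log_le (show 0 < l * η / 2 / 6 by positivity)] with n h1 h2 h3 h4 h5 h hh hh2
  have hn : 2 ≤ n := by omega
  have hnr : (3 : ℝ) ≤ n := by exact_mod_cast h2
  have hn0 : (0 : ℝ) < n := by linarith
  have hlog0 : 1 ≤ Real.log n := by
    rw [Real.le_log_iff_exp_le hn0]
    have := Real.exp_one_lt_d9
    linarith
  have hhn : h * ((n : ℝ) - 1) ≤ 1 := by
    have h6 : c * Real.log n ≤ n := by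
      calc c * Real.log n ≤ (c + 1) * (1 / (c + 1) * n) := by gcongr; linarith
        _ = n := by field_simp
    have h7 : h * n * n ≤ 1 * n := by nlinarith
    have h8 := le_of_mul_le_mul_right h7 hn0
    nlinarith
  have hlog2 : Real.log ((2 * n + 1 : ℕ) : ℝ) ≤ 2 * Real.log n := by
    rw [← Real.log_rpow hn0]
    apply Real.log_le_log (by positivity)
    push_cast
    norm_num
    nlinarith
  have hsub : (phase n m δ ∪ phase n (-m) δ)ᶜ ⊆ {Y | ε * (n : ℝ) ^ 2 < totalExcess θ m Y} ∪
      ⋃ i, {Y | η * n < |centeredSum θ (nullParam n h) (incident i) Y|} := by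
    intro Y hY
    by_contra hcon
    rw [Set.mem_union, not_or, Set.mem_iUnion, not_exists] at hcon
    exact hY (hph n h1 hn h hh hhn Y (not_lt.1 hcon.1) fun i => not_lt.1 (hcon.2 i))
  refine (prob_mono _ _ hsub).trans ((prob_union_le _ _ _ _).trans ?_)
  -- Both the field, exp(c log n), and the number of degree sequences, at most exp(2n log n), are
  -- beaten by exp(−εn²).
  have hA : prob θ (nullParam n h) {Y | ε * (n : ℝ) ^ 2 < totalExcess θ m Y} ≤
      Real.exp (-(3 * Real.log n)) := by
    refine (prob_null_le θ hh _).trans ?_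
    refine (mul_le_mul_of_nonneg_left (prob_totalExcess_gt_le hn hm _) (Real.exp_pos _).le).trans ?_
    have hpow : ((2 * n + 1 : ℕ) : ℝ) ^ n = Real.exp (n * Real.log ((2 * n + 1 : ℕ) : ℝ)) := by
      rw [Real.exp_nat_mul, Real.exp_log (by positivity)]
    rw [hpow, ← Real.exp_add, ← Real.exp_add, Real.exp_le_exp]
    have h9 : (c + 3 + 2) * Real.log n ≤ ε / 4 * n := by
      calc (c + 3 + 2) * Real.log n ≤ (c + 3 + 2) * (ε / 4 / (c + 3 + 2) * n) := by gcongr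
        _ = ε / 4 * n := by field_simp
    have h10 : n * Real.log ((2 * n + 1 : ℕ) : ℝ) ≤ n * (2 * Real.log n) := by gcongr
    have h11 : (c + 3 + 2) * Real.log n * n ≤ ε / 4 * n * n := by gcongr
    have h12 : (c + 3) * Real.log n * 1 ≤ (c + 3) * Real.log n * n := by
      gcongr; linarith
    have h13 : 0 ≤ ε * (n : ℝ) ^ 2 := by positivity
    linarith
  have hB : ∀ i, prob θ (nullParam n h)
      {Y | η * n < |centeredSum θ (nullParam n h) (incident i) Y|} ≤
      2 * Real.exp (-(6 * Real.log n)) := fun i => by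
    refine (prob_abs_centeredSum_incident_gt_le hn hθ.le _ hl0.le hl1 hl2 i).trans ?_
    exact mul_le_mul_of_nonneg_left (Real.exp_le_exp.2 (by linarith)) zero_le_two
  have hC := (prob_iUnion_le θ (nullParam n h)
    fun i => {Y | η * n < |centeredSum θ (nullParam n h) (incident i) Y|}).trans
    (Finset.sum_le_card_nsmul _ _ _ fun i _ => hB i)
  have he3 : Real.exp (-(3 * Real.log n)) = 1 / (n : ℝ) ^ 3 := by
    rw [Real.exp_neg, mul_comm, Real.exp_mul, Real.exp_log hn0]; norm_cast; simp
  have he6 : Real.exp (-(6 * Real.log n)) = 1 / (n : ℝ) ^ 6 := by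
    rw [Real.exp_neg, mul_comm, Real.exp_mul, Real.exp_log hn0]; norm_cast; simp
  rw [he3] at hA
  rw [he6] at hC
  simp only [Finset.card_univ, Fintype.card_fin, nsmul_eq_mul] at hC
  refine (add_le_add hA hC).trans ?_
  rw [div_add' _ _ _ (by positivity), div_le_div_iff₀ (by positivity) (by positivity)]
  have : (n : ℝ) * (2 * (1 / (n : ℝ) ^ 6)) * (n : ℝ) ^ 3 ≤ 1 := by
    rw [show (n : ℝ) * (2 * (1 / (n : ℝ) ^ 6)) * (n : ℝ) ^ 3 = 2 / (n : ℝ) ^ 2 by field_simp,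
      div_le_one (by positivity)]
    nlinarith
  have h3' : (0 : ℝ) ≤ n ^ 2 := by positivity
  calc _ ≤ (1 + 1) * (n : ℝ) ^ 2 := by gcongr
    _ ≤ 1 * (n : ℝ) ^ 3 := by nlinarith

/-- Reversing all spins. -/
def flipAll (Y : Config n) : Config n := fun e => -Y e

lemma flipAll_flipAll (Y : Config n) : flipAll (flipAll Y) = Y := by
  funext e; simp [flipAll]

lemma deg_flipAll (Y : Config n) (i : Fin n) : deg (flipAll Y) i = -deg Y i := by
  rw [deg_eq, deg_eq, ← Finset.sum_neg_distrib]
  refine Finset.sum_congr rfl fun e _ => ?_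
  simp [edgeVal, flipAll]

lemma sum_flipAll (F : Config n → ℝ) : ∑ Y, F (flipAll Y) = ∑ Y, F Y :=
  Equiv.sum_comp ⟨flipAll, flipAll, flipAll_flipAll, flipAll_flipAll⟩ F

lemma weight_null_flipAll (hn : 2 ≤ n) (θ h : ℝ) (Y : Config n) :
    weight θ (nullParam n h) (flipAll Y) =
      weight θ (nullParam n h) Y * Real.exp (-(h * totalDeg Y)) := by
  have h1 : weight θ (nullParam n 0) (flipAll Y) = weight θ (nullParam n 0) Y := by
    simp only [weight_null_zero hn, deg_flipAll, neg_sq]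
  have h2 : totalDeg (flipAll Y) = -totalDeg Y := by
    simp only [totalDeg, deg_flipAll, Finset.sum_neg_distrib]
  rw [weight_null θ h, weight_null θ h Y, h1, h2, mul_assoc, ← Real.exp_add]
  congr 2; ring

lemma flipAll_mem_phase_neg (Y : Config n) (τ δ : ℝ) :
    flipAll Y ∈ phase n (-τ) δ ↔ Y ∈ phase n τ δ := by
  refine forall_congr' fun i => ?_
  rw [deg_flipAll, ← abs_neg]
  ring_nf

/-- Reversing all spins exchanges the phases and multiplies the weight by exp(−h · total degree);
for δ ≤ τ/2 the total degree in the positive phase is at least (τ/2) n(n − 1). -/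
lemma prob_null_phase_neg_le (hn : 2 ≤ n) {h : ℝ} (hh : 0 ≤ h) {τ δ : ℝ} (hδ : δ ≤ τ / 2) :
    prob θ (nullParam n h) (phase n (-τ) δ) ≤
      Real.exp (-(h * (τ / 2 * (n * ((n : ℝ) - 1))))) * prob θ (nullParam n h) (phase n τ δ) := by
  have hn' : (0 : ℝ) < (n : ℝ) - 1 := by
    have : (2 : ℝ) ≤ n := by exact_mod_cast hn
    linarith
  rw [prob_eq_avg, prob_eq_avg, avg, avg, ← mul_div_assoc]
  refine div_le_div_of_nonneg_right ?_ (sum_weight_pos (weight_pos θ _)).le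
  rw [← sum_flipAll, Finset.mul_sum]
  refine Finset.sum_le_sum fun Y _ => ?_
  by_cases hY : Y ∈ phase n τ δ
  · rw [Set.indicator_of_mem hY, Set.indicator_of_mem ((flipAll_mem_phase_neg Y τ δ).2 hY),
      weight_null_flipAll hn]
    simp only [Pi.one_apply, mul_one]
    rw [mul_comm]
    refine mul_le_mul_of_nonneg_right (Real.exp_le_exp.2 (neg_le_neg ?_)) (weight_pos _ _ _).le
    refine mul_le_mul_of_nonneg_left ?_ hh
    have : ∀ i, τ / 2 * ((n : ℝ) - 1) ≤ deg Y i := fun i => by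
      rw [← le_div_iff₀ hn']
      linarith [(abs_le.1 (hY i)).1]
    have := Finset.sum_le_sum fun i (_ : i ∈ Finset.univ) => this i
    simp at this
    rw [totalDeg]
    linarith
  · rw [Set.indicator_of_notMem hY,
      Set.indicator_of_notMem fun h => hY ((flipAll_mem_phase_neg Y τ δ).1 h)]
    simp

end Phases

/-! ### Stability of the linearized mean field equations. -/

section Fluctuations

set_option maxHeartbeats 1000000 in
/-- A priori bounds for the solutions of the perturbed linearized mean field equations. -/
lemma exists_stability_bounds {p C₀ : ℝ} (hp0 : 0 ≤ p) (hp : 2 * p < 1) (hC₀ : 0 ≤ C₀) :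
    ∃ δ₀ > 0, ∃ C > 0, ∀ n : ℕ, 2 ≤ n → ∀ x d : Fin n → ℝ, (∀ i, |x i| ≤ δ₀) →
      (∀ i, |d i - ((((n : ℝ) - 1) * (1 - p) + p) * x i - p * ∑ j, x j)| ≤
        C₀ * (((n : ℝ) - 1) * x i ^ 2 + ∑ j, x j ^ 2 + 1)) →
      (∑ j, x j) ^ 2 ≤ C * ((∑ j, d j) ^ 2 / ((n : ℝ) - 1) ^ 2 + (∑ j, x j ^ 2) ^ 2 + 1) ∧
      ((n : ℝ) - 1) ^ 2 * ∑ j, x j ^ 2 ≤ C * (∑ j, d j ^ 2 + ((n : ℝ) - 1) ^ 2) ∧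
      ∀ i, ((n : ℝ) - 1) ^ 2 * x i ^ 2 ≤
        C * (d i ^ 2 + (∑ j, d j) ^ 2 / ((n : ℝ) - 1) ^ 2 + (∑ j, x j ^ 2) ^ 2 + 1) := by
  have ha : 0 < 1 - 2 * p := by linarith
  -- The linear operator has eigenvalue ν(1 − 2p) on constants, which K₁ inverts, and ν(1 − p) + p ≥
  -- ν/2 on vectors of sum zero.
  set K₁ := (1 + 3 * C₀) / (1 - 2 * p) with hK₁
  have hK₁0 : 0 < K₁ := by positivity
  set K₂ := 4 * (K₁ + C₀) with hK₂
  have hK₂0 : 0 < K₂ := by positivity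
  -- The first entry absorbs the error C₀νx_i² into ν|x_i|/4; the second absorbs the terms Q²,
  -- summed over the vertices, into ν²Q/2.
  set δ₀ := min (1 / (4 * (C₀ + 1))) (1 / (7 * K₂)) with hδ₀
  have hδ0 : 0 < δ₀ := lt_min (by positivity) (by positivity)
  have hδ1 : C₀ * δ₀ ≤ 1 / 4 := by
    have : δ₀ * (4 * (C₀ + 1)) ≤ 1 := by
      rw [← le_div_iff₀ (by positivity)]; exact min_le_left _ _
    nlinarith
  have hδ2 : 24 * K₂ ^ 2 * δ₀ ^ 2 ≤ 1 / 2 := by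
    have h1 : δ₀ * (7 * K₂) ≤ 1 := by
      rw [← le_div_iff₀ (by positivity)]; exact min_le_right _ _
    have h2 : 0 ≤ δ₀ * (7 * K₂) := by positivity
    nlinarith
  refine ⟨δ₀, hδ0, 64 + 48 * K₂ ^ 2 + 3 * K₁ ^ 2, by positivity, ?_⟩
  intro n hn x d hx hd
  have hn2 : (2 : ℝ) ≤ n := by exact_mod_cast hn
  set ν := (n : ℝ) - 1 with hν
  have hν1 : 1 ≤ ν := by rw [hν]; linarith
  have hν0 : 0 < ν := by linarith
  have hnν : (n : ℝ) = ν + 1 := by rw [hν]; ring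
  set X := ∑ j, x j with hX
  set Q := ∑ j, x j ^ 2 with hQ
  set D := ∑ j, d j with hD
  have hQ0 : 0 ≤ Q := Finset.sum_nonneg fun _ _ => sq_nonneg _
  set R := |D| / ν + Q + 1 with hR
  have hR0 : 0 ≤ R := by positivity
  have hR2 : R ^ 2 ≤ 3 * (D ^ 2 / ν ^ 2 + Q ^ 2 + 1) := by
    have : (|D| / ν) ^ 2 = D ^ 2 / ν ^ 2 := by rw [div_pow, sq_abs]
    rw [← this, hR]
    nlinarith [sq_nonneg (|D| / ν - Q), sq_nonneg (|D| / ν - 1), sq_nonneg (Q - 1)]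
  have hXR : |X| ≤ K₁ * R := by
    -- Summing the equations projects on constants: the coefficient of X is ν(1 − p) + p − np = ν(1
    -- − 2p).
    have h1 : |D - ν * (1 - 2 * p) * X| ≤ C₀ * (ν * (3 * Q + 2)) := by
      have h2 : D - ν * (1 - 2 * p) * X = ∑ i, (d i - ((ν * (1 - p) + p) * x i - p * X)) := by
        rw [Finset.sum_sub_distrib, Finset.sum_sub_distrib, ← Finset.mul_sum, Finset.sum_const,
          ← hX, ← hD]
        simp only [Finset.card_univ, Fintype.card_fin, nsmul_eq_mul, hnν]
        ring
      rw [h2]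
      refine (Finset.abs_sum_le_sum_abs _ _).trans ((Finset.sum_le_sum fun i _ => hd i).trans ?_)
      rw [← Finset.mul_sum]
      refine mul_le_mul_of_nonneg_left ?_ hC₀
      rw [Finset.sum_add_distrib, Finset.sum_add_distrib, ← Finset.mul_sum, ← hQ]
      simp only [Finset.sum_const, Finset.card_univ, Fintype.card_fin, nsmul_eq_mul, hnν]
      nlinarith
    have h3 : ν * (1 - 2 * p) * |X| ≤ |D| + C₀ * (ν * (3 * Q + 2)) := by
      have h4 : |ν * (1 - 2 * p) * X| ≤ |D| + |D - ν * (1 - 2 * p) * X| := by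
        have := abs_sub (D) (D - ν * (1 - 2 * p) * X)
        rwa [sub_sub_cancel] at this
      rw [abs_mul, abs_of_pos (by positivity)] at h4
      linarith
    have h5 : (1 - 2 * p) * |X| ≤ (1 + 3 * C₀) * R := by
      have h6 : ν * ((1 - 2 * p) * |X|) ≤ ν * ((1 + 3 * C₀) * R) := by
        have h7 : ν * (|D| / ν) = |D| := by field_simp
        have h8 : 0 ≤ C₀ * (|D| / ν) := by positivity
        have h9 : 0 ≤ ν * (C₀ * (|D| / ν)) := by positivity
        have h10 : 0 ≤ ν * Q := by positivity
        have h11 : 0 ≤ C₀ * ν := by positivity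
        calc ν * ((1 - 2 * p) * |X|) ≤ |D| + C₀ * (ν * (3 * Q + 2)) := by linarith
          _ ≤ |D| + 3 * (ν * (C₀ * (|D| / ν))) + ν * Q + ν + C₀ * (ν * (3 * Q + 3)) := by
              nlinarith
          _ = ν * ((1 + 3 * C₀) * R) := by rw [hR, ← h7]; field_simp; ring
      exact le_of_mul_le_mul_left h6 hν0
    rw [hK₁, div_mul_eq_mul_div, le_div_iff₀ ha]
    linarith
  have hxi : ∀ i, ν * |x i| ≤ 4 * |d i| + K₂ * R := by
    intro i
    have h1 : (ν * (1 - p) + p) * |x i| ≤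
        |d i| + p * |X| + C₀ * (ν * x i ^ 2 + Q + 1) := by
      have h2 : (ν * (1 - p) + p) * x i =
          d i + p * X - (d i - ((ν * (1 - p) + p) * x i - p * X)) := by ring
      have h3 : 0 ≤ ν * (1 - p) + p := by nlinarith
      have h4 : |(ν * (1 - p) + p) * x i| ≤ |d i + p * X| +
          |d i - ((ν * (1 - p) + p) * x i - p * X)| := by
        conv_lhs => rw [h2]
        exact abs_sub _ _
      rw [abs_mul, abs_of_nonneg h3] at h4
      have h5 := abs_add_le (d i) (p * X)
      rw [abs_mul, abs_of_nonneg hp0] at h5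
      linarith [hd i]
    have h6 : C₀ * (ν * x i ^ 2) ≤ 1 / 4 * (ν * |x i|) := by
      rw [← sq_abs]
      have h7 : |x i| ^ 2 ≤ δ₀ * |x i| := by
        rw [sq]; exact mul_le_mul_of_nonneg_right (hx i) (abs_nonneg _)
      calc C₀ * (ν * |x i| ^ 2) ≤ C₀ * (ν * (δ₀ * |x i|)) := by gcongr
        _ = (C₀ * δ₀) * (ν * |x i|) := by ring
        _ ≤ _ := by gcongr
    have h8 : p * |X| ≤ 1 * (K₁ * R) := by
      refine mul_le_mul (by linarith) hXR (abs_nonneg _) zero_le_one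
    have h9 : C₀ * (Q + 1) ≤ C₀ * R := by
      refine mul_le_mul_of_nonneg_left ?_ hC₀
      have : 0 ≤ |D| / ν := by positivity
      linarith
    have h10 : ν * |x i| * (1 / 2) ≤ (ν * (1 - p) + p) * |x i| := by
      have h11 : ν * (1 / 2) ≤ ν * (1 - p) + p := by
        have : ν * (1 / 2) ≤ ν * (1 - p) := mul_le_mul_of_nonneg_left (by linarith) hν0.le
        linarith
      have := mul_le_mul_of_nonneg_right h11 (abs_nonneg (x i))
      linarith
    rw [hK₂]
    linarith
  have hxi2 : ∀ i, ν ^ 2 * x i ^ 2 ≤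
      32 * d i ^ 2 + 6 * K₂ ^ 2 * (D ^ 2 / ν ^ 2 + Q ^ 2 + 1) := by
    intro i
    have h1 : (ν * |x i|) ^ 2 ≤ (4 * |d i| + K₂ * R) ^ 2 :=
      pow_le_pow_left₀ (by positivity) (hxi i) 2
    have h2 : (4 * |d i| + K₂ * R) ^ 2 ≤ 32 * d i ^ 2 + 2 * K₂ ^ 2 * R ^ 2 := by
      rw [← sq_abs (d i)]
      nlinarith [sq_nonneg (4 * |d i| - K₂ * R)]
    rw [mul_pow, sq_abs] at h1
    have h3 : 2 * K₂ ^ 2 * R ^ 2 ≤ 2 * K₂ ^ 2 * (3 * (D ^ 2 / ν ^ 2 + Q ^ 2 + 1)) := by gcongr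
    linarith
  have hT : 0 ≤ D ^ 2 / ν ^ 2 + Q ^ 2 + 1 := by positivity
  refine ⟨?_, ?_, fun i => ?_⟩
  · have h1 : X ^ 2 ≤ (K₁ * R) ^ 2 := by
      rw [← sq_abs X]; exact pow_le_pow_left₀ (abs_nonneg _) hXR 2
    have h2 : K₁ ^ 2 * R ^ 2 ≤ K₁ ^ 2 * (3 * (D ^ 2 / ν ^ 2 + Q ^ 2 + 1)) := by gcongr
    rw [mul_pow] at h1
    have h3 : 0 ≤ (64 + 48 * K₂ ^ 2) * (D ^ 2 / ν ^ 2 + Q ^ 2 + 1) := by positivity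
    linarith
  · have h1 : ν ^ 2 * Q ≤ 32 * ∑ i, d i ^ 2 +
        (ν + 1) * (6 * K₂ ^ 2 * (D ^ 2 / ν ^ 2 + Q ^ 2 + 1)) := by
      have := Finset.sum_le_sum fun i (_ : i ∈ Finset.univ) => hxi2 i
      rw [← Finset.mul_sum, Finset.sum_add_distrib, ← Finset.mul_sum, Finset.sum_const] at this
      simpa only [Finset.card_univ, Fintype.card_fin, nsmul_eq_mul, hnν] using this
    set S := ∑ i, d i ^ 2 with hS
    have hS0 : 0 ≤ S := Finset.sum_nonneg fun _ _ => sq_nonneg _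
    have h2 : (ν + 1) * (D ^ 2 / ν ^ 2) ≤ 4 * S := by
      have h3 : D ^ 2 ≤ (ν + 1) * S := by
        have := sq_sum_le_card_mul_sum_sq (s := Finset.univ) (f := d)
        simpa only [Finset.card_univ, Fintype.card_fin, hnν] using this
      rw [← mul_div_assoc, div_le_iff₀ (by positivity)]
      calc (ν + 1) * D ^ 2 ≤ (ν + 1) * ((ν + 1) * S) := by gcongr
        _ = (ν + 1) ^ 2 * S := by ring
        _ ≤ (2 * ν) ^ 2 * S := by gcongr; linarith
        _ = 4 * S * ν ^ 2 := by ring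
    -- One factor Q is bounded by nδ₀², which makes the quadratic error linear in Q with a small
    -- coefficient.
    have h4 : (ν + 1) * Q ^ 2 ≤ 4 * ν ^ 2 * δ₀ ^ 2 * Q := by
      have h5 : Q ≤ (ν + 1) * δ₀ ^ 2 := by
        have : ∀ i, x i ^ 2 ≤ δ₀ ^ 2 := fun i => by
          rw [← sq_abs]; exact pow_le_pow_left₀ (abs_nonneg _) (hx i) 2
        have := Finset.sum_le_sum fun i (_ : i ∈ Finset.univ) => this i
        rw [Finset.sum_const] at this
        simpa only [Finset.card_univ, Fintype.card_fin, nsmul_eq_mul, hnν] using this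
      calc (ν + 1) * Q ^ 2 = (ν + 1) * (Q * Q) := by ring
        _ ≤ (ν + 1) * ((ν + 1) * δ₀ ^ 2 * Q) := by gcongr
        _ = (ν + 1) ^ 2 * (δ₀ ^ 2 * Q) := by ring
        _ ≤ (2 * ν) ^ 2 * (δ₀ ^ 2 * Q) := by gcongr; linarith
        _ = _ := by ring
    have h6 : ν + 1 ≤ 2 * ν ^ 2 := by nlinarith
    have h7 : 6 * K₂ ^ 2 * (4 * ν ^ 2 * δ₀ ^ 2 * Q) ≤ 1 / 2 * (ν ^ 2 * Q) := by
      calc 6 * K₂ ^ 2 * (4 * ν ^ 2 * δ₀ ^ 2 * Q) = (24 * K₂ ^ 2 * δ₀ ^ 2) * (ν ^ 2 * Q) := by ring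
        _ ≤ _ := by gcongr
    have h8 : (ν + 1) * (6 * K₂ ^ 2 * (D ^ 2 / ν ^ 2 + Q ^ 2 + 1)) ≤
        6 * K₂ ^ 2 * (4 * S) + 1 / 2 * (ν ^ 2 * Q) + 6 * K₂ ^ 2 * (2 * ν ^ 2) := by
      calc (ν + 1) * (6 * K₂ ^ 2 * (D ^ 2 / ν ^ 2 + Q ^ 2 + 1)) =
          6 * K₂ ^ 2 * ((ν + 1) * (D ^ 2 / ν ^ 2)) + 6 * K₂ ^ 2 * ((ν + 1) * Q ^ 2) +
            6 * K₂ ^ 2 * (ν + 1) := by ring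
        _ ≤ 6 * K₂ ^ 2 * (4 * S) + 6 * K₂ ^ 2 * (4 * ν ^ 2 * δ₀ ^ 2 * Q) +
            6 * K₂ ^ 2 * (2 * ν ^ 2) := by gcongr
        _ ≤ _ := by linarith
    have h9 : 0 ≤ K₁ ^ 2 * S := by positivity
    have h10 : 0 ≤ K₁ ^ 2 * ν ^ 2 := by positivity
    have h11 : 0 ≤ K₂ ^ 2 * ν ^ 2 := by positivity
    nlinarith
  · have h1 := hxi2 i
    have h2 : 0 ≤ d i ^ 2 := sq_nonneg _
    have h3 : 0 ≤ (64 + 42 * K₂ ^ 2 + 3 * K₁ ^ 2) * (D ^ 2 / ν ^ 2 + Q ^ 2 + 1) := by positivity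
    have h4 : 0 ≤ (32 + 48 * K₂ ^ 2 + 3 * K₁ ^ 2) * d i ^ 2 := by positivity
    linarith

variable {n : ℕ} {θ m : ℝ}

/-- The deviation of a normalized degree from the magnetization. -/
def devDeg (m : ℝ) (Y : Config n) (i : Fin n) : ℝ := deg Y i / ((n : ℝ) - 1) - m

/-- The conditionally centered degrees are, to first order, linear in the degrees. -/
lemma abs_centeredSum_sub_linear_le (hn : 2 ≤ n) (hm : IsMagnetization θ m) {h : ℝ} (hh : 0 ≤ h)
    (hh1 : h * ((n : ℝ) - 1) ≤ 1) (Y : Config n) (i : Fin n) :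
    |centeredSum θ (nullParam n h) (incident i) Y -
      ((((n : ℝ) - 1) * (1 - θ * (1 - m ^ 2)) + θ * (1 - m ^ 2)) * devDeg m Y i -
        θ * (1 - m ^ 2) * ∑ j, devDeg m Y j)| ≤
      (4 * θ ^ 2 + 2 * θ + 1) *
        (((n : ℝ) - 1) * devDeg m Y i ^ 2 + ∑ j, devDeg m Y j ^ 2 + 1) := by
  have hθ := hm.theta_pos
  have hn' : (0 : ℝ) < (n : ℝ) - 1 := by
    have : (2 : ℝ) ≤ n := by exact_mod_cast hn
    linarith
  set ν := (n : ℝ) - 1 with hν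
  set x := devDeg m Y with hx
  set p := θ * (1 - m ^ 2) with hp
  have hdeg : ∀ j, deg Y j = ν * (x j + m) := fun j => by
    simp only [hx, devDeg]; rw [← hν]; field_simp; ring
  have herr : ∀ e : Edge n, |Real.tanh (field θ (nullParam n h) e Y) -
      (m + p * (x e.1.1 + x e.1.2))| ≤
      4 * θ ^ 2 * (x e.1.1 ^ 2 + x e.1.2 ^ 2) + (2 * θ + 1) / ν := by
    intro e
    -- Expansion of tanh about 2θm, where its value is m and its slope 1 − m²; the edge's own spin
    -- and h are O(1/n) and go into the constant error.
    set z := θ * (x e.1.1 + x e.1.2) with hz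
    have h1 : field θ (nullParam n h) e Y = 2 * θ * m + z + (-(2 * θ / ν) * edgeVal Y e + h) := by
      simp only [field, nullParam, hdeg, hz]
      rw [← hν]
      field_simp
      ring
    have h2 : |Real.tanh (field θ (nullParam n h) e Y) - Real.tanh (2 * θ * m + z)| ≤
        (2 * θ + 1) / ν := by
      refine (abs_tanh_sub_le _ _).trans ?_
      rw [h1, add_sub_cancel_left]
      refine (abs_add_le _ _).trans ?_
      rw [abs_mul, abs_edgeVal, abs_neg, mul_one, abs_of_nonneg (by positivity), abs_of_nonneg hh,
        add_div]
      have : h ≤ 1 / ν := by rw [le_div_iff₀ hn']; exact hh1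
      linarith
    have h3 := abs_tanh_add_sub_le (2 * θ * m) z
    rw [hm.tanh_eq] at h3
    have h4 : p * (x e.1.1 + x e.1.2) = (1 - m ^ 2) * z := by rw [hp, hz]; ring
    have h5 : 2 * z ^ 2 ≤ 4 * θ ^ 2 * (x e.1.1 ^ 2 + x e.1.2 ^ 2) := by
      rw [hz]
      have : 0 ≤ θ ^ 2 * (x e.1.1 - x e.1.2) ^ 2 := by positivity
      nlinarith
    have h6 := abs_add_le (Real.tanh (field θ (nullParam n h) e Y) - Real.tanh (2 * θ * m + z))
      (Real.tanh (2 * θ * m + z) - m - (1 - m ^ 2) * z)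
    rw [h4]
    calc _ = |(Real.tanh (field θ (nullParam n h) e Y) - Real.tanh (2 * θ * m + z)) +
          (Real.tanh (2 * θ * m + z) - m - (1 - m ^ 2) * z)| := by congr 1; ring
      _ ≤ _ := by linarith
  have hsum : centeredSum θ (nullParam n h) (incident i) Y -
      ((ν * (1 - p) + p) * x i - p * ∑ j, x j) =
      -∑ e, inc i e * (Real.tanh (field θ (nullParam n h) e Y) -
        (m + p * (x e.1.1 + x e.1.2))) := by
    have h1 : centeredSum θ (nullParam n h) (incident i) Y =
        deg Y i - ∑ e, inc i e * Real.tanh (field θ (nullParam n h) e Y) := by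
      rw [centeredSum, incident, sum_filter_incident, deg_eq, ← Finset.sum_sub_distrib]
      refine Finset.sum_congr rfl fun e _ => ?_
      rw [centered]; ring
    have h2 : ∑ e, inc i e * (Real.tanh (field θ (nullParam n h) e Y) -
        (m + p * (x e.1.1 + x e.1.2))) =
        ∑ e, inc i e * Real.tanh (field θ (nullParam n h) e Y) -
          (ν * m + p * (((n : ℝ) - 2) * x i + ∑ j, x j)) := by
      rw [← sum_inc_mul_endpoints, hν, ← sum_inc i, Finset.sum_mul, Finset.mul_sum,
        ← Finset.sum_add_distrib, ← Finset.sum_sub_distrib]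
      refine Finset.sum_congr rfl fun e _ => by ring
    rw [h1, h2, hdeg i, show (n : ℝ) - 2 = ν - 1 by rw [hν]; ring]
    ring
  rw [hsum, abs_neg]
  have hb : ∀ e, |inc i e * (Real.tanh (field θ (nullParam n h) e Y) -
      (m + p * (x e.1.1 + x e.1.2)))| ≤
      4 * θ ^ 2 * (inc i e * (x e.1.1 ^ 2 + x e.1.2 ^ 2)) + inc i e * ((2 * θ + 1) / ν) := by
    intro e
    rw [abs_mul, abs_of_nonneg (inc_nonneg i e)]
    have := mul_le_mul_of_nonneg_left (herr e) (inc_nonneg i e)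
    linarith
  refine (Finset.abs_sum_le_sum_abs _ _).trans ((Finset.sum_le_sum fun e _ => hb e).trans ?_)
  rw [Finset.sum_add_distrib, ← Finset.mul_sum, ← Finset.sum_mul, sum_inc,
    sum_inc_mul_endpoints fun j => x j ^ 2, ← hν, mul_div_cancel₀ _ hn'.ne',
    show (n : ℝ) - 2 = ν - 1 by rw [hν]; ring]
  have hQ0 : 0 ≤ ∑ j, x j ^ 2 := Finset.sum_nonneg fun _ _ => sq_nonneg _
  have h1 : 0 ≤ θ ^ 2 * x i ^ 2 := by positivity
  have h2 : 0 ≤ (2 * θ + 1) * (ν * x i ^ 2 + ∑ j, x j ^ 2) := by positivity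
  have h3 : 0 ≤ 4 * θ ^ 2 := by positivity
  nlinarith

lemma sum_centeredSum_incident (β : Fin n → ℝ) (Y : Config n) :
    ∑ i, centeredSum θ β (incident i) Y = 2 * centeredSum θ β Finset.univ Y := by
  simp only [centeredSum, incident, sum_filter_incident]
  rw [Finset.sum_comm, Finset.mul_sum]
  refine Finset.sum_congr rfl fun e _ => ?_
  rw [sum_inc_mul fun _ => centered θ β e Y]; ring

end Fluctuations

/-! ### Degree variances in the selecting field, and its partition function. -/

section Moments

variable {n : ℕ} {θ m : ℝ}

/-- A bound for the squared size of the fluctuations, in terms of conditionally centered sums. -/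
def fluctuation (θ h : ℝ) (Y : Config n) : ℝ :=
  4 * centeredSum θ (nullParam n h) Finset.univ Y ^ 2 / ((n : ℝ) - 1) ^ 2 +
    n * (∑ i, centeredSum θ (nullParam n h) (incident i) Y ^ 4) / ((n : ℝ) - 1) ^ 4 + 1

lemma fluctuation_nonneg (θ h : ℝ) (Y : Config n) : 0 ≤ fluctuation θ h Y := by
  have : 0 ≤ ∑ i, centeredSum θ (nullParam n h) (incident i) Y ^ 4 :=
    Finset.sum_nonneg fun i _ => by positivity
  unfold fluctuation
  positivity

/-- Bounded in n: the sum over all edges has second moment O(n²), and each of the n centered degrees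
has fourth moment O(n²). -/
lemma avg_fluctuation_le (hn : 2 ≤ n) (hθ : 0 ≤ θ) (h : ℝ) :
    avg (weight θ (nullParam n h)) (fluctuation θ h) ≤
      4 * (2 + 4 * θ) + 4 * ((2 + 4 * θ) * (9 / 2 * (2 + 4 * θ) + 3 * (2 + 4 * θ) ^ 2)) + 1 := by
  have hn2 : (2 : ℝ) ≤ n := by exact_mod_cast hn
  set ν := (n : ℝ) - 1 with hν
  have hν1 : 1 ≤ ν := by rw [hν]; linarith
  have hν0 : 0 < ν := by linarith
  have hnν : (n : ℝ) ≤ 2 * ν := by rw [hν]; linarith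
  set c := 2 + 4 * θ with hc
  have hc0 : 0 ≤ c := by positivity
  set w := weight θ (nullParam n h)
  have h1 : avg w (fluctuation θ h) = 4 / ν ^ 2 * avg w
      (fun Y => centeredSum θ (nullParam n h) Finset.univ Y ^ 2) +
      n / ν ^ 4 * ∑ i, avg w (fun Y => centeredSum θ (nullParam n h) (incident i) Y ^ 4) + 1 := by
    have h0 : (1 : ℝ) = avg w fun _ => 1 := (avg_const (weight_pos θ (nullParam n h)) 1).symm
    rw [← avg_sum, ← avg_const_mul, ← avg_const_mul, ← avg_add]
    conv_rhs => rw [h0]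
    rw [← avg_add]
    congr 1
    funext Y
    unfold fluctuation
    ring
  have h2 := avg_centeredSum_sq_le hn hθ (nullParam n h) Finset.univ
  rw [Finset.card_univ, card_edge, ← hν, ← hc] at h2
  have h3 : ∀ i, avg w (fun Y => centeredSum θ (nullParam n h) (incident i) Y ^ 4) ≤
      ν ^ 2 * (c * (9 / 2 * c + 3 * c ^ 2)) := by
    intro i
    have := avg_centeredSum_pow_four_le hn hθ (nullParam n h) (incident i)
    rw [card_incident, ← hν, ← hc] at this
    refine this.trans ?_
    have h4 : c * (9 / 2 * (ν * c) + 3 * c ^ 2) ≤ c * (9 / 2 * (ν * c) + ν * (3 * c ^ 2)) := by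
      have : 3 * c ^ 2 ≤ ν * (3 * c ^ 2) := le_mul_of_one_le_left (by positivity) hν1
      exact mul_le_mul_of_nonneg_left (by linarith) hc0
    calc ν * (c * (9 / 2 * (ν * c) + 3 * c ^ 2)) ≤
        ν * (c * (9 / 2 * (ν * c) + ν * (3 * c ^ 2))) := by gcongr
      _ = _ := by ring
  have h4 : ∑ i, avg w (fun Y => centeredSum θ (nullParam n h) (incident i) Y ^ 4) ≤
      n * (ν ^ 2 * (c * (9 / 2 * c + 3 * c ^ 2))) := by
    refine (Finset.sum_le_sum fun i _ => h3 i).trans ?_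
    simp
  rw [h1]
  have h5 : 4 / ν ^ 2 * avg w (fun Y => centeredSum θ (nullParam n h) Finset.univ Y ^ 2) ≤
      4 * c := by
    calc _ ≤ 4 / ν ^ 2 * (2 * ν * ν / 2 * c) := by gcongr; refine h2.trans ?_; gcongr
      _ = _ := by field_simp
  have h6 : n / ν ^ 4 * ∑ i, avg w (fun Y => centeredSum θ (nullParam n h) (incident i) Y ^ 4) ≤
      4 * (c * (9 / 2 * c + 3 * c ^ 2)) := by
    calc _ ≤ 2 * ν / ν ^ 4 * (2 * ν * (ν ^ 2 * (c * (9 / 2 * c + 3 * c ^ 2)))) := by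
          refine mul_le_mul (by gcongr) (h4.trans (by gcongr)) ?_ (by positivity)
          exact Finset.sum_nonneg fun i _ =>
            avg_nonneg (weight_pos θ (nullParam n h)) fun Y => by positivity
      _ = _ := by field_simp; ring
  linarith

/-- Close to the positive phase, degrees are controlled by conditionally centered sums. -/
lemma IsMagnetization.exists_devDeg_sq_le (hm : IsMagnetization θ m) :
    ∃ δ > 0, δ ≤ m / 2 ∧ ∃ C > 0, ∀ n : ℕ, 2 ≤ n → ∀ h : ℝ, 0 ≤ h → h * ((n : ℝ) - 1) ≤ 1 →
      ∀ Y ∈ phase n m δ, (∑ i, devDeg m Y i) ^ 2 ≤ C * fluctuation θ h Y ∧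
        ∀ i, ((n : ℝ) - 1) ^ 2 * devDeg m Y i ^ 2 ≤
          C * (centeredSum θ (nullParam n h) (incident i) Y ^ 2 + fluctuation θ h Y) := by
  have hθ := hm.theta_pos
  have hm1 := hm.lt_one
  have hm0 := hm.pos
  have hp0 : 0 ≤ θ * (1 - m ^ 2) := mul_nonneg hθ.le (by nlinarith)
  obtain ⟨δ₀, hδ₀, C, hC, key⟩ := exists_stability_bounds hp0 hm.stable
    (show 0 ≤ 4 * θ ^ 2 + 2 * θ + 1 by positivity)
  refine ⟨min δ₀ (m / 2), lt_min hδ₀ (by linarith), min_le_right _ _, C * (2 * C ^ 2 + 1),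
    by positivity, fun n hn h hh hh1 Y hY => ?_⟩
  have hn2 : (2 : ℝ) ≤ n := by exact_mod_cast hn
  obtain ⟨h1, h2, h3⟩ := key n hn (devDeg m Y)
    (fun i => centeredSum θ (nullParam n h) (incident i) Y)
    (fun i => (hY i).trans (min_le_left _ _))
    (fun i => abs_centeredSum_sub_linear_le hn hm hh hh1 Y i)
  rw [sum_centeredSum_incident] at h1
  simp only [sum_centeredSum_incident] at h3
  set ν := (n : ℝ) - 1 with hν
  have hν0 : 0 < ν := by rw [hν]; linarith
  set Δ := centeredSum θ (nullParam n h) Finset.univ Y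
  set d := fun i => centeredSum θ (nullParam n h) (incident i) Y with hd
  set Q := ∑ j, devDeg m Y j ^ 2
  have hQ0 : 0 ≤ Q := Finset.sum_nonneg fun _ _ => sq_nonneg _
  have hQ : Q ≤ C * ((∑ j, d j ^ 2) / ν ^ 2 + 1) := by
    refine le_of_mul_le_mul_left (h2.trans (le_of_eq ?_)) (pow_pos hν0 2)
    field_simp
    ring
  -- The squared error Q² is quartic in the centered degrees; this is why fourth moments are needed.
  have hS : (∑ j, d j ^ 2) ^ 2 ≤ n * ∑ j, d j ^ 4 := by
    have := sq_sum_le_card_mul_sum_sq (s := Finset.univ) (f := fun j => d j ^ 2)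
    simpa only [Finset.card_univ, Fintype.card_fin, ← pow_mul] using this
  set F := fluctuation θ h Y with hF
  have hF1 : F = 4 * Δ ^ 2 / ν ^ 2 + n * (∑ i, d i ^ 4) / ν ^ 4 + 1 := rfl
  have h40 : 0 ≤ n * (∑ i, d i ^ 4) / ν ^ 4 := by
    have : 0 ≤ ∑ i, d i ^ 4 := Finset.sum_nonneg fun i _ => by positivity
    positivity
  have hQ2 : Q ^ 2 ≤ 2 * C ^ 2 * (n * (∑ i, d i ^ 4) / ν ^ 4 + 1) := by
    have h4 : Q ^ 2 ≤ (C * ((∑ j, d j ^ 2) / ν ^ 2 + 1)) ^ 2 := pow_le_pow_left₀ hQ0 hQ 2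
    have h5 : ((∑ j, d j ^ 2) / ν ^ 2) ^ 2 ≤ n * (∑ i, d i ^ 4) / ν ^ 4 := by
      rw [div_pow, ← pow_mul]
      gcongr
    have h6 : ((∑ j, d j ^ 2) / ν ^ 2 + 1) ^ 2 ≤ 2 * (n * (∑ i, d i ^ 4) / ν ^ 4 + 1) := by
      nlinarith [sq_nonneg ((∑ j, d j ^ 2) / ν ^ 2 - 1)]
    calc Q ^ 2 ≤ C ^ 2 * ((∑ j, d j ^ 2) / ν ^ 2 + 1) ^ 2 := by rw [← mul_pow]; exact h4
      _ ≤ C ^ 2 * (2 * (n * (∑ i, d i ^ 4) / ν ^ 4 + 1)) := by gcongr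
      _ = _ := by ring
  have hΔ0 : 0 ≤ 4 * Δ ^ 2 / ν ^ 2 := by positivity
  have hW : (2 * Δ) ^ 2 / ν ^ 2 + Q ^ 2 + 1 ≤ (2 * C ^ 2 + 1) * F := by
    have h4 : (2 * Δ) ^ 2 / ν ^ 2 = 4 * Δ ^ 2 / ν ^ 2 := by ring
    have h5 : 0 ≤ 2 * C ^ 2 * (4 * Δ ^ 2 / ν ^ 2) := by positivity
    rw [hF1, h4]
    linarith
  refine ⟨h1.trans ?_, fun i => (h3 i).trans ?_⟩
  · rw [mul_assoc]
    exact mul_le_mul_of_nonneg_left hW hC.le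
  · rw [mul_assoc]
    refine mul_le_mul_of_nonneg_left ?_ hC.le
    have : 0 ≤ 2 * C ^ 2 * d i ^ 2 := by positivity
    have hdi : d i = centeredSum θ (nullParam n h) (incident i) Y := rfl
    rw [← hdi]
    linarith

/-- Fluctuations of the degrees inside the positive phase. -/
lemma IsMagnetization.exists_avg_indicator_le (hm : IsMagnetization θ m) :
    ∃ δ > 0, δ ≤ m / 2 ∧ ∃ C > 0, ∀ n : ℕ, 2 ≤ n → ∀ h : ℝ, 0 ≤ h → h * ((n : ℝ) - 1) ≤ 1 →
      avg (weight θ (nullParam n h)) (fun Y => (phase n m δ).indicator 1 Y *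
        (∑ i, devDeg m Y i) ^ 2) ≤ C ∧
      ∀ i, avg (weight θ (nullParam n h)) (fun Y => (phase n m δ).indicator 1 Y *
        (((n : ℝ) - 1) ^ 2 * devDeg m Y i ^ 2)) ≤ C * ((n : ℝ) - 1) := by
  have hθ := hm.theta_pos
  obtain ⟨δ, hδ, hδm, C, hC, key⟩ := hm.exists_devDeg_sq_le
  set c := 2 + 4 * θ with hc
  have hc0 : 0 < c := by positivity
  set M := 4 * c + 4 * (c * (9 / 2 * c + 3 * c ^ 2)) + 1 with hM
  have hM0 : 0 < M := by positivity
  refine ⟨δ, hδ, hδm, C * (c + M), by positivity, fun n hn h hh hh1 => ?_⟩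
  have hn2 : (2 : ℝ) ≤ n := by exact_mod_cast hn
  have hw := weight_pos θ (nullParam n h)
  have hF := avg_fluctuation_le hn hθ.le h
  rw [← hc, ← hM] at hF
  constructor
  · calc _ ≤ avg (weight θ (nullParam n h)) (fun Y => C * fluctuation θ h Y) := by
          refine avg_mono hw fun Y => ?_
          by_cases hY : Y ∈ phase n m δ
          · simpa [hY] using (key n hn h hh hh1 Y hY).1
          · simpa [hY] using mul_nonneg hC.le (fluctuation_nonneg θ h Y)
      _ = C * avg (weight θ (nullParam n h)) (fluctuation θ h) := avg_const_mul _ _ _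
      _ ≤ C * M := by gcongr
      _ ≤ _ := by gcongr; linarith
  · intro i
    have h1 := avg_centeredSum_sq_le hn hθ.le (nullParam n h) (incident i)
    rw [card_incident, ← hc] at h1
    calc _ ≤ avg (weight θ (nullParam n h)) (fun Y =>
          C * (centeredSum θ (nullParam n h) (incident i) Y ^ 2 + fluctuation θ h Y)) := by
          refine avg_mono hw fun Y => ?_
          by_cases hY : Y ∈ phase n m δ
          · simpa [hY] using (key n hn h hh hh1 Y hY).2 i
          · simpa [hY] using mul_nonneg hC.le
              (add_nonneg (sq_nonneg _) (fluctuation_nonneg θ h Y))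
      _ = C * (avg (weight θ (nullParam n h))
            (fun Y => centeredSum θ (nullParam n h) (incident i) Y ^ 2) +
          avg (weight θ (nullParam n h)) (fluctuation θ h)) := by rw [avg_const_mul, avg_add]
      _ ≤ C * (((n : ℝ) - 1) * c + ((n : ℝ) - 1) * M) := by
          gcongr
          exact hF.trans (le_mul_of_one_le_left hM0.le (by linarith))
      _ = _ := by ring

/-- The auxiliary uniform field that selects the positive phase. -/
def selectField (m : ℝ) (n : ℕ) : ℝ := 8 / m * Real.log n / (n : ℝ) ^ 2

lemma selectField_nonneg (hm : 0 < m) (n : ℕ) : 0 ≤ selectField m n := by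
  have := Real.log_natCast_nonneg n
  unfold selectField; positivity

lemma selectField_mul_sq {n : ℕ} (hn : 2 ≤ n) :
    selectField m n * (n : ℝ) ^ 2 = 8 / m * Real.log n := by
  have : (n : ℝ) ≠ 0 := by positivity
  unfold selectField; field_simp

/-- This is why the field is harmless: it acts on the total degree, whose fluctuations in one phase
are of order n. -/
lemma eventually_selectField_mul_le (hm : 0 < m) {ε : ℝ} (hε : 0 < ε) :
    ∀ᶠ n : ℕ in atTop, selectField m n * n ≤ ε := by
  filter_upwards [eventually_log_le (show 0 < ε * m / 8 by positivity), eventually_ge_atTop 2]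
    with n hn h2
  have h0 : (0 : ℝ) < n := by positivity
  have : selectField m n * n = 8 / m * Real.log n / n := by
    unfold selectField; field_simp
  rw [this, div_le_iff₀ h0]
  calc 8 / m * Real.log n ≤ 8 / m * (ε * m / 8 * n) := by gcongr
    _ = _ := by field_simp

/-- The factor 8/m in the field makes the negative phase lighter than the positive one by
exp(−h(m/2)n(n − 1)) ≤ n⁻², using n − 1 ≥ n/2. -/
lemma IsMagnetization.eventually_prob_phase_compl (hm : IsMagnetization θ m) {δ : ℝ} (hδ : 0 < δ)
    (hδm : δ ≤ m / 2) : ∀ᶠ n : ℕ in atTop,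
      prob θ (nullParam n (selectField m n)) (phase n m δ)ᶜ ≤ 2 / (n : ℝ) ^ 2 := by
  have hm0 := hm.pos
  filter_upwards [hm.eventually_prob_phases hδ (show 0 ≤ 8 / m by positivity),
    eventually_ge_atTop 2] with n h1 hn
  have hn2 : (2 : ℝ) ≤ n := by exact_mod_cast hn
  set h := selectField m n with hh
  have hh0 : 0 ≤ h := selectField_nonneg hm0 n
  have hhn : h * (n : ℝ) ^ 2 = 8 / m * Real.log n := selectField_mul_sq hn
  have h2 := h1 h hh0 hhn.le
  have h3 := prob_null_phase_neg_le (θ := θ) hn hh0 hδm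
  have h4 : Real.exp (-(h * (m / 2 * (n * ((n : ℝ) - 1))))) ≤ 1 / (n : ℝ) ^ 2 := by
    have h5 : 2 * Real.log n ≤ h * (m / 2 * (n * ((n : ℝ) - 1))) := by
      calc 2 * Real.log n = (8 / m * Real.log n) * (m / 4) := by field_simp; ring
        _ = h * (m / 2 * (n * (n / 2))) := by rw [← hhn]; ring
        _ ≤ _ := by gcongr; linarith
    calc _ ≤ Real.exp (-(2 * Real.log n)) := Real.exp_le_exp.2 (by linarith)
      _ = 1 / (n : ℝ) ^ 2 := by
        rw [Real.exp_neg, two_mul, Real.exp_add, Real.exp_log (by positivity)]; ring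
  have h6 : prob θ (nullParam n h) (phase n (-m) δ) ≤ 1 / (n : ℝ) ^ 2 := by
    refine h3.trans ((mul_le_mul h4 (prob_le_one _ _ _) (prob_nonneg _ _ _)
      (by positivity)).trans ?_)
    rw [mul_one]
  have h7 : (phase n m δ)ᶜ ⊆ (phase n m δ ∪ phase n (-m) δ)ᶜ ∪ phase n (-m) δ := by
    intro Y hY
    by_cases h8 : Y ∈ phase n (-m) δ
    · exact Or.inr h8
    · exact Or.inl fun h9 => h9.elim hY h8
  refine (prob_mono θ _ h7).trans ((prob_union_le θ _ _ _).trans ?_)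
  have : 2 / (n : ℝ) ^ 2 = 1 / (n : ℝ) ^ 2 + 1 / (n : ℝ) ^ 2 := by ring
  linarith

lemma abs_devDeg_le (hn : 2 ≤ n) (hm : IsMagnetization θ m) (Y : Config n) (i : Fin n) :
    |devDeg m Y i| ≤ 2 := by
  have hn' : (0 : ℝ) < (n : ℝ) - 1 := by
    have : (2 : ℝ) ≤ n := by exact_mod_cast hn
    linarith
  have h1 : |deg Y i / ((n : ℝ) - 1)| ≤ 1 := by
    rw [abs_div, abs_of_pos hn', div_le_one hn']; exact abs_deg_le Y i
  refine (abs_sub _ _).trans ?_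
  rw [abs_of_pos hm.pos]
  linarith [hm.lt_one]

lemma totalDeg_sub_eq (hn : 2 ≤ n) (m : ℝ) (Y : Config n) :
    totalDeg Y - m * (n * ((n : ℝ) - 1)) = ((n : ℝ) - 1) * ∑ i, devDeg m Y i := by
  have hn' : (n : ℝ) - 1 ≠ 0 := by
    have : (2 : ℝ) ≤ n := by exact_mod_cast hn
    linarith
  simp only [devDeg, Finset.sum_sub_distrib, ← Finset.sum_div, totalDeg]
  simp
  field_simp

lemma deg_sub_eq (hn : 2 ≤ n) (m : ℝ) (Y : Config n) (i : Fin n) :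
    deg Y i - m * ((n : ℝ) - 1) = ((n : ℝ) - 1) * devDeg m Y i := by
  have hn' : (n : ℝ) - 1 ≠ 0 := by
    have : (2 : ℝ) ≤ n := by exact_mod_cast hn
    linarith
  rw [devDeg]
  field_simp

/-- Off the phase the trivial bound is used: deviations have squares O(n²), which the probability
O(n⁻²) reduces to O(1). -/
lemma avg_le_avg_indicator_add (β : Fin n → ℝ) (G : Set (Config n)) (f : Config n → ℝ) {B : ℝ}
    (hf : ∀ Y, f Y ≤ B) :
    avg (weight θ β) f ≤ avg (weight θ β) (fun Y => G.indicator 1 Y * f Y) + B * prob θ β Gᶜ := by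
  rw [prob_eq_avg, ← avg_const_mul, ← avg_add]
  refine avg_mono (weight_pos θ β) fun Y => ?_
  by_cases hY : Y ∈ G
  · simp [hY]
  · simpa [hY] using hf Y

/-- In the selecting field, the variances of the degrees and of their sum are of the order of the
number of edges that they involve. -/
lemma IsMagnetization.exists_moments (hm : IsMagnetization θ m) :
    ∃ C > 0, ∀ᶠ n : ℕ in atTop,
      avg (weight θ (nullParam n (selectField m n)))
        (fun Y => (totalDeg Y - m * (n * ((n : ℝ) - 1))) ^ 2) ≤ C * (n : ℝ) ^ 2 ∧
      ∀ i, avg (weight θ (nullParam n (selectField m n)))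
        (fun Y => (deg Y i - m * ((n : ℝ) - 1)) ^ 2) ≤ C * n := by
  obtain ⟨δ, hδ, hδm, C, hC, key⟩ := hm.exists_avg_indicator_le
  have hm0 := hm.pos
  refine ⟨C + 8, by positivity, ?_⟩
  filter_upwards [hm.eventually_prob_phase_compl hδ hδm, eventually_ge_atTop 2,
    eventually_selectField_mul_le hm0 one_pos] with n h1 hn hh1
  have hn2 : (2 : ℝ) ≤ n := by exact_mod_cast hn
  set h := selectField m n with hh
  have hh0 : 0 ≤ h := selectField_nonneg hm0 n
  obtain ⟨k1, k2⟩ := key n hn h hh0 (by nlinarith)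
  set ν := (n : ℝ) - 1 with hν
  have hν0 : 0 < ν := by rw [hν]; linarith
  have hνn : ν ≤ n := by rw [hν]; linarith
  have hx : ∀ Y : Config n, ∀ i, devDeg m Y i ^ 2 ≤ 4 := fun Y i => by
    rw [← sq_abs]
    have := pow_le_pow_left₀ (abs_nonneg _) (abs_devDeg_le hn hm Y i) 2
    linarith
  have hX : ∀ Y : Config n, (∑ i, devDeg m Y i) ^ 2 ≤ 4 * (n : ℝ) ^ 2 := fun Y => by
    have h2 : |∑ i, devDeg m Y i| ≤ n * 2 := by
      refine (Finset.abs_sum_le_sum_abs _ _).trans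
        ((Finset.sum_le_sum fun i _ => abs_devDeg_le hn hm Y i).trans ?_)
      simp
    have := pow_le_pow_left₀ (abs_nonneg _) h2 2
    rw [sq_abs] at this
    linarith
  constructor
  · simp only [hν, totalDeg_sub_eq hn, mul_pow, avg_const_mul]
    have h3 := avg_le_avg_indicator_add (θ := θ) (nullParam n h) (phase n m δ) _ hX
    have h4 : 4 * (n : ℝ) ^ 2 * prob θ (nullParam n h) (phase n m δ)ᶜ ≤ 8 := by
      calc _ ≤ 4 * (n : ℝ) ^ 2 * (2 / (n : ℝ) ^ 2) := by gcongr
        _ = 8 := by field_simp; norm_num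
    have h5 : avg (weight θ (nullParam n h)) (fun Y => (∑ i, devDeg m Y i) ^ 2) ≤ C + 8 := by
      linarith
    rw [mul_comm (C + 8), ← hν]
    refine mul_le_mul (by gcongr) h5 ?_ (by positivity)
    exact avg_nonneg (weight_pos θ (nullParam n h)) fun Y => sq_nonneg _
  · intro i
    simp only [hν, deg_sub_eq hn, mul_pow]
    have h3 := avg_le_avg_indicator_add (θ := θ) (nullParam n h) (phase n m δ)
      (fun Y => ν ^ 2 * devDeg m Y i ^ 2) (B := ν ^ 2 * 4)
      (fun Y => mul_le_mul_of_nonneg_left (hx Y i) (by positivity))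
    have h4 : ν ^ 2 * 4 * prob θ (nullParam n h) (phase n m δ)ᶜ ≤ 8 := by
      have h0 := prob_nonneg θ (nullParam n h) (phase n m δ)ᶜ
      calc _ ≤ (n : ℝ) ^ 2 * 4 * (2 / (n : ℝ) ^ 2) := by gcongr
        _ = 8 := by field_simp; norm_num
    have h5 := k2 i
    have h6 : C * ν ≤ C * n := by gcongr
    rw [← hν]
    linarith

/-- A lower bound for the ratio of partition functions, from the weight of the positive phase. -/
lemma IsMagnetization.exists_partitionFn_ge (hm : IsMagnetization θ m) :
    ∃ B > 0, ∀ᶠ n : ℕ in atTop, ∀ h : ℝ, 0 ≤ h →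
      1 / 4 * Real.exp (h / 2 * (m * (n * ((n : ℝ) - 1)) - B * n)) * partitionFn θ (nullParam n 0) ≤
        partitionFn θ (nullParam n h) := by
  obtain ⟨δ, hδ, hδm, C, hC, key⟩ := hm.exists_avg_indicator_le
  refine ⟨1 + 8 * C, by positivity, ?_⟩
  filter_upwards [hm.eventually_prob_phases hδ le_rfl, eventually_ge_atTop 2] with n h1 hn h hh
  have hn2 : (2 : ℝ) ≤ n := by exact_mod_cast hn
  set B := 1 + 8 * C with hB
  have hB1 : 0 < B := by positivity
  have h2 := h1 0 le_rfl (by simp)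
  have h3 := prob_null_phase_neg_le (θ := θ) hn (le_refl (0 : ℝ)) hδm
  rw [zero_mul, neg_zero, Real.exp_zero, one_mul] at h3
  obtain ⟨k1, -⟩ := key n hn 0 le_rfl (by simp)
  have h4 : 1 / (n : ℝ) ^ 2 ≤ 1 / 4 := by
    refine one_div_le_one_div_of_le (by norm_num) (by nlinarith)
  -- At h = 0 the two phases share probability at least 3/4, and spin reversal shows that the
  -- positive one has at least half of it.
  have h5 : 3 / 8 ≤ prob θ (nullParam n 0) (phase n m δ) := by
    rw [prob_compl] at h2
    have := prob_union_le θ (nullParam n 0) (phase n m δ) (phase n (-m) δ)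
    linarith
  set S : Set (Config n) := {Y | Y ∈ phase n m δ ∧ |∑ i, devDeg m Y i| ≤ B} with hS
  set S' : Set (Config n) := {Y | Y ∈ phase n m δ ∧ B < |∑ i, devDeg m Y i|} with hS'
  have h6 : prob θ (nullParam n 0) S' ≤ 1 / 8 := by
    -- Chebyshev inside the phase; B = 1 + 8C is large enough that C/B² ≤ 1/8, so 1/4 of the
    -- probability remains.
    refine (prob_le_avg_div θ (nullParam n 0) _ (show 0 < B ^ 2 by positivity) S' (fun Y => ?_)
      (fun Y hY => ?_)).trans ((div_le_div_of_nonneg_right k1 (by positivity)).trans ?_)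
    · exact mul_nonneg (Set.indicator_nonneg (by simp) _) (sq_nonneg _)
    · simp only [Set.indicator_of_mem hY.1, Pi.one_apply, one_mul]
      rw [← sq_abs (∑ i, _)]
      exact pow_le_pow_left₀ hB1.le hY.2.le 2
    · rw [div_le_iff₀ (by positivity)]
      nlinarith
  have h7 : 1 / 4 ≤ prob θ (nullParam n 0) S := by
    have : phase n m δ ⊆ S ∪ S' := fun Y hY => by
      rcases le_or_gt |∑ i, devDeg m Y i| B with h8 | h8
      · exact Or.inl ⟨hY, h8⟩
      · exact Or.inr ⟨hY, h8⟩
    have := (prob_mono θ (nullParam n 0) this).trans (prob_union_le θ _ _ _)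
    linarith
  set E := Real.exp (h / 2 * (m * (n * ((n : ℝ) - 1)) - B * n)) with hE
  have hZ := partitionFn_pos θ (nullParam n 0)
  have h8 : prob θ (nullParam n 0) S * E * partitionFn θ (nullParam n 0) ≤
      partitionFn θ (nullParam n h) := by
    rw [prob_eq_sum, Finset.sum_mul, Finset.sum_mul, partitionFn.eq_1 θ (nullParam n h)]
    refine Finset.sum_le_sum fun Y _ => ?_
    rw [weight_null θ h]
    by_cases hY : Y ∈ S
    · simp only [Set.indicator_of_mem hY, Pi.one_apply, mul_one, mass]
      rw [mul_right_comm, div_mul_cancel₀ _ hZ.ne']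
      refine mul_le_mul_of_nonneg_left (Real.exp_le_exp.2 ?_) (weight_pos θ _ Y).le
      refine mul_le_mul_of_nonneg_left ?_ (by positivity)
      have h9 := totalDeg_sub_eq hn m Y
      have h10 := (abs_le.1 hY.2).1
      have h11 : ((n : ℝ) - 1) * (-B) ≤ ((n : ℝ) - 1) * ∑ i, devDeg m Y i :=
        mul_le_mul_of_nonneg_left h10 (by linarith)
      linarith
    · simp only [Set.indicator_of_notMem hY, mul_zero, zero_mul]
      exact (mul_pos (weight_pos θ _ Y) (Real.exp_pos _)).le
  refine le_trans ?_ h8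
  have : 0 < E := Real.exp_pos _
  gcongr

end Moments

/-! ### The two-star model as a ferromagnet: monotone covariances and partition function ratios. -/

section Correlations

variable {n : ℕ} {θ : ℝ}

lemma avg_const_mul_weight {Ω : Type*} [Fintype Ω] {c : ℝ} (hc : c ≠ 0) (w f : Ω → ℝ) :
    avg (fun ω => c * w ω) f = avg w f := by
  simp only [avg, mul_assoc, ← Finset.mul_sum]
  exact mul_div_mul_left _ _ hc

lemma cov_const_mul_weight {Ω : Type*} [Fintype Ω] {c : ℝ} (hc : c ≠ 0) (w f g : Ω → ℝ) :
    cov (fun ω => c * w ω) f g = cov w f g := by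
  simp only [cov, avg_const_mul_weight hc]

/-- The couplings of the two-star model as an Ising model on the edges. -/
def coupling (n : ℕ) (θ : ℝ) (e f : Edge n) : ℝ :=
  θ / (2 * ((n : ℝ) - 1)) * ∑ i, inc i e * inc i f

/-- The external field of the two-star model as an Ising model on the edges. -/
def edgeField (β : Fin n → ℝ) (e : Edge n) : ℝ := (β e.1.1 + β e.1.2) / 2

lemma coupling_nonneg (hn : 2 ≤ n) (hθ : 0 ≤ θ) (e f : Edge n) : 0 ≤ coupling n θ e f := by
  have hn' : (0 : ℝ) < (n : ℝ) - 1 := by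
    have : (2 : ℝ) ≤ n := by exact_mod_cast hn
    linarith
  have : 0 ≤ ∑ i, inc i e * inc i f :=
    Finset.sum_nonneg fun i _ => mul_nonneg (inc_nonneg i e) (inc_nonneg i f)
  unfold coupling
  positivity

/-- Expanding k_i² over pairs of edges at i gives nonnegative couplings, so the Ising inequalities
apply. Diagonal terms e = f are constants and do no harm. -/
lemma weight_eq_isingWeight (hn : 2 ≤ n) (θ : ℝ) (β : Fin n → ℝ) :
    weight θ β = fun Y => Real.exp (-(θ * n / 2)) *
      isingWeight (coupling n θ) (edgeField β) Y := by
  funext Y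
  rw [weight_eq hn, isingWeight]
  congr 3
  · have h1 : ∀ i, deg Y i ^ 2 = ∑ e, ∑ f, inc i e * inc i f * (edgeVal Y e * edgeVal Y f) := by
      intro i
      rw [deg_eq, sq, Finset.sum_mul_sum]
      exact Finset.sum_congr rfl fun e _ => Finset.sum_congr rfl fun f _ => by ring
    simp only [h1]
    rw [Finset.sum_comm, Finset.mul_sum]
    refine Finset.sum_congr rfl fun e _ => ?_
    rw [Finset.sum_comm, Finset.mul_sum]
    refine Finset.sum_congr rfl fun f _ => ?_
    rw [← Finset.sum_mul, coupling, mul_assoc]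
    rfl
  · rw [sum_mul_deg, Finset.mul_sum]
    refine Finset.sum_congr rfl fun e _ => ?_
    simp only [edgeField, edgeVal, spinVal]
    ring

/-- A linear combination of degrees. -/
def degSum (g : Fin n → ℝ) (Y : Config n) : ℝ := ∑ i, g i * deg Y i

lemma cov_degSum_eq (hn : 2 ≤ n) (θ : ℝ) (β g g' : Fin n → ℝ) :
    cov (weight θ β) (degSum g) (degSum g') = ∑ e : Edge n, ∑ f : Edge n,
      (g e.1.1 + g e.1.2) * ((g' f.1.1 + g' f.1.2) *
        cov (isingWeight (coupling n θ) (edgeField β)) (fun Y => spinVal (Y e))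
          (fun Y => spinVal (Y f))) := by
  have h : ∀ g : Fin n → ℝ,
      degSum g = fun Y => ∑ e : Edge n, (g e.1.1 + g e.1.2) * spinVal (Y e) := by
    intro g; funext Y; exact sum_mul_deg g Y
  rw [weight_eq_isingWeight hn, cov_const_mul_weight (Real.exp_pos _).ne', h, h, cov_sum_left]
  refine Finset.sum_congr rfl fun e _ => ?_
  rw [cov_sum_right]
  refine Finset.sum_congr rfl fun f _ => ?_
  rw [cov_const_mul_left, cov_const_mul_right]

variable {β γ g g' : Fin n → ℝ}

lemma cov_degSum_antitone (hn : 2 ≤ n) (hθ : 0 ≤ θ) (hβ : ∀ i, 0 ≤ β i) (hγ : ∀ i, 0 ≤ γ i)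
    (hg : ∀ i, 0 ≤ g i) (hg' : ∀ i, 0 ≤ g' i) :
    cov (weight θ (β + γ)) (degSum g) (degSum g') ≤ cov (weight θ β) (degSum g) (degSum g') := by
  rw [cov_degSum_eq hn, cov_degSum_eq hn]
  have h : edgeField (β + γ) = edgeField β + edgeField γ := by
    funext e; simp only [edgeField, Pi.add_apply]; ring
  rw [h]
  refine Finset.sum_le_sum fun e _ => Finset.sum_le_sum fun f _ => ?_
  refine mul_le_mul_of_nonneg_left (mul_le_mul_of_nonneg_left
    (cov_isingWeight_antitone (coupling_nonneg hn hθ) (fun e => ?_) (fun e => ?_) e f)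
    (add_nonneg (hg' _) (hg' _))) (add_nonneg (hg _) (hg _))
  · exact div_nonneg (add_nonneg (hβ _) (hβ _)) zero_le_two
  · exact div_nonneg (add_nonneg (hγ _) (hγ _)) zero_le_two

lemma cov_degSum_nonneg (hn : 2 ≤ n) (hθ : 0 ≤ θ) (hβ : ∀ i, 0 ≤ β i)
    (hg : ∀ i, 0 ≤ g i) (hg' : ∀ i, 0 ≤ g' i) :
    0 ≤ cov (weight θ β) (degSum g) (degSum g') := by
  rw [cov_degSum_eq hn]
  refine Finset.sum_nonneg fun e _ => Finset.sum_nonneg fun f _ => ?_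
  refine mul_nonneg (add_nonneg (hg _) (hg _)) (mul_nonneg (add_nonneg (hg' _) (hg' _))
    (cov_isingWeight_nonneg (coupling_nonneg hn hθ) (fun e => ?_) e f))
  exact div_nonneg (add_nonneg (hβ _) (hβ _)) zero_le_two

lemma tilt_weight (θ : ℝ) (β g : Fin n → ℝ) (u : ℝ) :
    tilt (weight θ β) (fun Y => 1 / 2 * degSum g Y) u = weight θ (β + u • g) := by
  funext Y
  rw [weight_add, tilt, degSum, Finset.mul_sum, Finset.mul_sum, Finset.mul_sum]
  congr 2
  refine Finset.sum_congr rfl fun i _ => ?_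
  simp only [Pi.smul_apply, smul_eq_mul]; ring

lemma smul_nonneg_apply {u : ℝ} (hu : 0 ≤ u) (hg : ∀ i, 0 ≤ g i) (i : Fin n) : 0 ≤ (u • g) i :=
  mul_nonneg hu (hg i)

lemma add_nonneg_apply (hβ : ∀ i, 0 ≤ β i) (hg : ∀ i, 0 ≤ g i) (i : Fin n) : 0 ≤ (β + g) i :=
  add_nonneg (hβ i) (hg i)

/-- The mixed second difference of the log-partition function is a covariance at an intermediate
parameter; 1/4 comes from the factor 1/2 in front of each ∑ β_i k_i. The size of u, v is irrelevant:
positivity is all that monotonicity needs. -/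
lemma exists_partitionFn_mul_eq (θ : ℝ) (β g g' : Fin n → ℝ) :
    ∃ u : ℝ, 0 < u ∧ ∃ v : ℝ, 0 < v ∧ partitionFn θ (β + g' + g) * partitionFn θ β =
      partitionFn θ (β + g) * partitionFn θ (β + g') *
        Real.exp (1 / 4 * cov (weight θ (β + (u • g + v • g'))) (degSum g) (degSum g')) := by
  obtain ⟨u, hu, v, hv, h⟩ := exists_log_ratio_eq_cov (weight_pos θ β)
    (fun Y => 1 / 2 * degSum g Y) (fun Y => 1 / 2 * degSum g' Y)
  simp only [tilt_weight, one_smul, cov_const_mul_left, cov_const_mul_right] at h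
  refine ⟨u, hu.1, v, hv.1, ?_⟩
  simp only [partitionFn]
  rw [h, ← add_assoc]
  congr 2
  ring

/-- Log-partition functions have a cross difference bounded by the covariance at the base point. -/
lemma partitionFn_mul_le (hn : 2 ≤ n) (hθ : 0 ≤ θ) (hβ : ∀ i, 0 ≤ β i)
    (hg : ∀ i, 0 ≤ g i) (hg' : ∀ i, 0 ≤ g' i) :
    partitionFn θ (β + g' + g) * partitionFn θ β ≤
      partitionFn θ (β + g) * partitionFn θ (β + g') *
        Real.exp (1 / 4 * cov (weight θ β) (degSum g) (degSum g')) := by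
  obtain ⟨u, hu, v, hv, h⟩ := exists_partitionFn_mul_eq θ β g g'
  rw [h]
  refine mul_le_mul_of_nonneg_left (Real.exp_le_exp.2 (mul_le_mul_of_nonneg_left ?_ (by norm_num)))
    (mul_pos (partitionFn_pos _ _) (partitionFn_pos _ _)).le
  exact cov_degSum_antitone hn hθ hβ (add_nonneg_apply (smul_nonneg_apply hu.le hg)
    (smul_nonneg_apply hv.le hg')) hg hg'

/-- Positive correlation makes the log-partition function supermodular along nonnegative directions,
so adding g' raises the ratio that g produces. -/
lemma partitionFn_mul_ge (hn : 2 ≤ n) (hθ : 0 ≤ θ) (hβ : ∀ i, 0 ≤ β i)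
    (hg : ∀ i, 0 ≤ g i) (hg' : ∀ i, 0 ≤ g' i) :
    partitionFn θ (β + g) * partitionFn θ (β + g') ≤
      partitionFn θ (β + g' + g) * partitionFn θ β := by
  obtain ⟨u, hu, v, hv, h⟩ := exists_partitionFn_mul_eq θ β g g'
  rw [h]
  refine le_mul_of_one_le_right (mul_pos (partitionFn_pos _ _) (partitionFn_pos _ _)).le
    (Real.one_le_exp (mul_nonneg (by norm_num) ?_))
  exact cov_degSum_nonneg hn hθ (add_nonneg_apply hβ (add_nonneg_apply
    (smul_nonneg_apply hu.le hg) (smul_nonneg_apply hv.le hg'))) hg hg'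

/-- A nonnegative perturbation raises the mean of a nonnegative combination of degrees by at most
the covariance at the base point. -/
lemma avg_degSum_sub_mem (hn : 2 ≤ n) (hθ : 0 ≤ θ) (hβ : ∀ i, 0 ≤ β i)
    (hg : ∀ i, 0 ≤ g i) (hg' : ∀ i, 0 ≤ g' i) :
    avg (weight θ (β + g)) (degSum g') - avg (weight θ β) (degSum g') ∈
      Set.Icc 0 (1 / 2 * cov (weight θ β) (degSum g') (degSum g)) := by
  obtain ⟨u, hu, h⟩ := exists_avg_tilt_sub_eq_cov (weight_pos θ β)
    (fun Y => 1 / 2 * degSum g Y) (degSum g')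
  rw [tilt_weight, tilt_weight, one_smul, cov_const_mul_right] at h
  rw [h]
  exact ⟨mul_nonneg (by norm_num) (cov_degSum_nonneg hn hθ
      (add_nonneg_apply hβ (smul_nonneg_apply hu.1.le hg)) hg' hg),
    mul_le_mul_of_nonneg_left (cov_degSum_antitone hn hθ hβ (smul_nonneg_apply hu.1.le hg) hg' hg)
      (by norm_num)⟩

lemma degSum_one : degSum (fun _ : Fin n => 1) = totalDeg := by
  funext Y; simp [degSum, totalDeg]

lemma cov_degSum (w : Config n → ℝ) (g g' : Fin n → ℝ) :
    cov w (degSum g) (degSum g') =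
      ∑ i, ∑ j, g i * (g' j * cov w (fun Y => deg Y i) (fun Y => deg Y j)) := by
  have h : ∀ g : Fin n → ℝ, degSum g = fun Y => ∑ i, g i * deg Y i := fun g => rfl
  rw [h, h, cov_sum_left]
  refine Finset.sum_congr rfl fun i _ => ?_
  rw [cov_sum_right]
  refine Finset.sum_congr rfl fun j _ => ?_
  rw [cov_const_mul_left, cov_const_mul_right]

end Correlations

/-! ### Vertex permutations and the covariance of two degrees. -/

section Exchangeability

variable {n : ℕ}

/-- The action of a permutation of the vertices on the edges. -/
def permEdge (σ : Equiv.Perm (Fin n)) (e : Edge n) : Edge n :=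
  if h : σ e.1.1 < σ e.1.2 then ⟨(σ e.1.1, σ e.1.2), h⟩
  else ⟨(σ e.1.2, σ e.1.1), lt_of_le_of_ne (not_lt.1 h) fun h' => e.2.ne (σ.injective h').symm⟩

lemma inc_permEdge (σ : Equiv.Perm (Fin n)) (i : Fin n) (e : Edge n) :
    inc (σ i) (permEdge σ e) = inc i e := by
  unfold permEdge
  split <;> simp [inc, or_comm]

lemma edge_ext_of_inc {e f : Edge n} (h : ∀ i, inc i e = inc i f) : e = f := by
  have key : ∀ i, (e.1.1 = i ∨ e.1.2 = i) ↔ (f.1.1 = i ∨ f.1.2 = i) := by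
    intro i
    have := h i
    unfold inc at this
    by_cases h1 : e.1.1 = i ∨ e.1.2 = i <;> by_cases h2 : f.1.1 = i ∨ f.1.2 = i <;>
      simp_all
  have he := e.2
  have hf := f.2
  have h1 := (key e.1.1).1 (Or.inl rfl)
  have h2 := (key e.1.2).1 (Or.inr rfl)
  have h3 := (key f.1.1).2 (Or.inl rfl)
  refine Subtype.ext (Prod.ext ?_ ?_)
  · simp only [Fin.ext_iff, Fin.lt_def] at *; omega
  · simp only [Fin.ext_iff, Fin.lt_def] at *; omega

lemma permEdge_bijective (σ : Equiv.Perm (Fin n)) : Function.Bijective (permEdge σ) := by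
  refine Finite.injective_iff_bijective.1 fun e f h => edge_ext_of_inc fun i => ?_
  rw [← inc_permEdge σ i e, h, inc_permEdge]

lemma deg_comp_permEdge (σ : Equiv.Perm (Fin n)) (Y : Config n) (i : Fin n) :
    deg (fun e => Y (permEdge σ e)) i = deg Y (σ i) := by
  rw [deg_eq, deg_eq, ← Equiv.sum_comp (Equiv.ofBijective _ (permEdge_bijective σ))
    fun e => inc (σ i) e * edgeVal Y e]
  refine Finset.sum_congr rfl fun e _ => ?_
  rw [Equiv.ofBijective_apply, inc_permEdge]
  rfl

lemma sum_comp_permEdge (σ : Equiv.Perm (Fin n)) (F : Config n → ℝ) :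
    ∑ Y : Config n, F (fun e => Y (permEdge σ e)) = ∑ Y, F Y :=
  Equiv.sum_comp ((Equiv.ofBijective _ (permEdge_bijective σ)).arrowCongr (Equiv.refl ℤˣ)).symm F

lemma weight_null_comp_permEdge (hn : 2 ≤ n) (θ h : ℝ) (σ : Equiv.Perm (Fin n)) (Y : Config n) :
    weight θ (nullParam n h) (fun e => Y (permEdge σ e)) = weight θ (nullParam n h) Y := by
  rw [weight_eq hn, weight_eq hn]
  simp only [deg_comp_permEdge, nullParam]
  rw [Equiv.sum_comp σ fun i => deg Y i ^ 2, Equiv.sum_comp σ fun i => h * deg Y i]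

lemma avg_null_comp_permEdge (hn : 2 ≤ n) (θ h : ℝ) (σ : Equiv.Perm (Fin n)) (F : Config n → ℝ) :
    avg (weight θ (nullParam n h)) (fun Y => F (fun e => Y (permEdge σ e))) =
      avg (weight θ (nullParam n h)) F := by
  unfold avg
  congr 1
  rw [← sum_comp_permEdge σ fun Y => weight θ (nullParam n h) Y * F Y]
  simp only [weight_null_comp_permEdge hn]

lemma cov_deg_perm (hn : 2 ≤ n) (θ h : ℝ) (σ : Equiv.Perm (Fin n)) (i j : Fin n) :
    cov (weight θ (nullParam n h)) (fun Y => deg Y (σ i)) (fun Y => deg Y (σ j)) =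
      cov (weight θ (nullParam n h)) (fun Y => deg Y i) (fun Y => deg Y j) := by
  unfold cov
  rw [← avg_null_comp_permEdge hn θ h σ fun Y => deg Y i * deg Y j,
    ← avg_null_comp_permEdge hn θ h σ fun Y => deg Y i,
    ← avg_null_comp_permEdge hn θ h σ fun Y => deg Y j]
  simp only [deg_comp_permEdge]

lemma exists_perm_apply_eq {α : Type*} [DecidableEq α] {i j i' j' : α} (h : i ≠ j) (h' : i' ≠ j') :
    ∃ σ : Equiv.Perm α, σ i = i' ∧ σ j = j' := by
  refine ⟨Equiv.swap (Equiv.swap i i' j) j' * Equiv.swap i i', ?_, ?_⟩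
  · rw [Equiv.Perm.mul_apply, Equiv.swap_apply_left]
    refine Equiv.swap_apply_of_ne_of_ne (fun h1 => h ?_) h'
    have := congrArg (Equiv.swap i i') h1
    rwa [Equiv.swap_apply_right, Equiv.swap_apply_self] at this
  · rw [Equiv.Perm.mul_apply, Equiv.swap_apply_left]

/-- By exchangeability, each covariance of two degrees is bounded by the average covariance. -/
lemma cov_deg_le (hn : 2 ≤ n) (θ h : ℝ) {i j : Fin n} (hij : i ≠ j) :
    (n * ((n : ℝ) - 1)) * cov (weight θ (nullParam n h)) (fun Y => deg Y i) (fun Y => deg Y j) ≤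
      cov (weight θ (nullParam n h)) totalDeg totalDeg := by
  set c := cov (weight θ (nullParam n h)) (fun Y => deg Y i) (fun Y => deg Y j) with hc
  have h1 : ∀ i' j', (if i' = j' then 0 else c) ≤
      cov (weight θ (nullParam n h)) (fun Y => deg Y i') (fun Y => deg Y j') := by
    intro i' j'
    split_ifs with h2
    · subst h2; exact cov_self_nonneg (weight_pos θ _) _
    · obtain ⟨σ, rfl, rfl⟩ := exists_perm_apply_eq hij h2
      exact (cov_deg_perm hn θ h σ i j).ge
  rw [← degSum_one, cov_degSum]
  simp only [one_mul]
  refine le_trans (le_of_eq ?_) (Finset.sum_le_sum fun i' _ => Finset.sum_le_sum fun j' _ =>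
    h1 i' j')
  have h2 : ∀ i' : Fin n, ∑ j', (if i' = j' then 0 else c) = ((n : ℝ) - 1) * c := by
    intro i'
    have : ∀ j', (if i' = j' then 0 else c) = c - if i' = j' then c else 0 := fun j' => by
      split_ifs <;> simp
    simp only [this, Finset.sum_sub_distrib, Finset.sum_ite_eq, Finset.mem_univ, if_true]
    simp
    ring
  simp only [h2]
  simp
  ring

end Exchangeability

/-! ### The block prior and the second moment of its likelihood ratio. -/

section SecondMoment

variable {n s r : ℕ} {θ : ℝ}

/-- The parameter vector with the value `A` on the range of `φ` and `0` elsewhere. -/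
def spike (A : ℝ) (φ : Fin s → Fin n) : Fin n → ℝ := (Set.range φ).indicator fun _ => A

lemma spike_nonneg {A : ℝ} (hA : 0 ≤ A) (φ : Fin s → Fin n) (i : Fin n) : 0 ≤ spike A φ i :=
  Set.indicator_nonneg (fun _ _ => hA) i

lemma spike_mem_alternative {A : ℝ} (hA : A ≠ 0) {φ : Fin s → Fin n} (hφ : Function.Injective φ)
    {β₀ s₀ : ℝ} (hs : s₀ ≤ s) : nullParam n β₀ + spike A φ ∈ alternative n β₀ s₀ A := by
  have h : Function.support (spike A φ) = Set.range φ := by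
    ext i
    by_cases hi : i ∈ Set.range φ
    · simp only [Function.mem_support, spike, Set.indicator_of_mem hi, hi, iff_true]; exact hA
    · simp only [Function.mem_support, spike, Set.indicator_of_notMem hi, hi, ne_eq,
        not_true_eq_false]
  refine ⟨spike A φ, rfl, ?_, fun i hi => ?_⟩
  · rw [h, ← Set.image_univ, Set.ncard_image_of_injective _ hφ, Set.ncard_univ]
    simpa using hs
  · rw [h] at hi
    rw [spike, Set.indicator_of_mem hi]

lemma sum_spike_mul (A : ℝ) {φ : Fin s → Fin n} (hφ : Function.Injective φ) (F : Fin n → ℝ) :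
    ∑ i, spike A φ i * F i = ∑ a, A * F (φ a) := by
  refine (Fintype.sum_of_injective φ hφ _ _ (fun i hi => ?_) fun a => ?_).symm
  · rw [spike, Set.indicator_of_notMem hi, zero_mul]
  · rw [spike, Set.indicator_of_mem (Set.mem_range_self a)]

lemma cov_degSum_spike (w : Config n → ℝ) (A : ℝ) {φ ψ : Fin s → Fin n}
    (hφ : Function.Injective φ) (hψ : Function.Injective ψ) :
    cov w (degSum (spike A φ)) (degSum (spike A ψ)) =
      A ^ 2 * ∑ a, ∑ b, cov w (fun Y => deg Y (φ a)) (fun Y => deg Y (ψ b)) := by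
  rw [cov_degSum]
  simp only [← Finset.mul_sum]
  simp only [sum_spike_mul A hψ]
  rw [sum_spike_mul A hφ]
  simp only [Finset.mul_sum]
  exact Finset.sum_congr rfl fun a _ => Finset.sum_congr rfl fun b _ => by ring

/-- The second moment of a likelihood ratio in terms of partition functions. -/
lemma sum_mass_mul_mass_div (θ : ℝ) (β g g' : Fin n → ℝ) :
    ∑ Y, mass θ (β + g) Y * mass θ (β + g') Y / mass θ β Y =
      partitionFn θ (β + g' + g) * partitionFn θ β /
        (partitionFn θ (β + g) * partitionFn θ (β + g')) := by
  rw [partitionFn.eq_1 θ (β + g' + g), Finset.sum_mul, Finset.sum_div]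
  refine Finset.sum_congr rfl fun Y _ => ?_
  simp only [mass, weight_add θ (β + g'), weight_add θ β]
  have h1 := (weight_pos θ β Y).ne'
  have h2 := (partitionFn_pos θ β).ne'
  have h3 := (partitionFn_pos θ (β + g)).ne'
  have h4 := (partitionFn_pos θ (β + g')).ne'
  field_simp

lemma sum_mass_mul_mass_div_le (hn : 2 ≤ n) (hθ : 0 ≤ θ) {β g g' : Fin n → ℝ}
    (hβ : ∀ i, 0 ≤ β i) (hg : ∀ i, 0 ≤ g i) (hg' : ∀ i, 0 ≤ g' i) :
    ∑ Y, mass θ (β + g) Y * mass θ (β + g') Y / mass θ β Y ≤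
      Real.exp (1 / 4 * cov (weight θ β) (degSum g) (degSum g')) := by
  rw [sum_mass_mul_mass_div, div_le_iff₀ (mul_pos (partitionFn_pos _ _) (partitionFn_pos _ _)),
    mul_comm (Real.exp _)]
  exact partitionFn_mul_le hn hθ hβ hg hg'

/-- For fixed f the coordinates of g are independent, and each contributes one match and r − 1
mismatches: the overlap is binomial. -/
lemma sum_sum_prod_ite (s r : ℕ) (x : ℝ) :
    ∑ f : Fin s → Fin r, ∑ g : Fin s → Fin r, ∏ a, (if f a = g a then x else 1) =
      ((r : ℝ) * (r - 1 + x)) ^ s := by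
  have h1 : ∀ f : Fin s → Fin r, ∑ g : Fin s → Fin r, ∏ a, (if f a = g a then x else 1) =
      ((r : ℝ) - 1 + x) ^ s := by
    intro f
    have := Finset.prod_univ_sum (fun _ : Fin s => (Finset.univ : Finset (Fin r)))
      (fun a y => if f a = y then x else 1)
    rw [Fintype.piFinset_univ] at this
    rw [← this]
    have h2 : ∀ a, ∑ y, (if f a = y then x else 1) = (r : ℝ) - 1 + x := fun a => by
      have : ∀ y, (if f a = y then x else 1) = 1 + if f a = y then x - 1 else 0 := fun y => by
        split_ifs <;> ring
      simp only [this, Finset.sum_add_distrib, Finset.sum_ite_eq, Finset.mem_univ, if_true]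
      simp
      ring
    simp only [h2, Finset.prod_const, Finset.card_univ, Fintype.card_fin]
  simp only [h1, Finset.sum_const, Finset.card_univ, Fintype.card_fun, Fintype.card_fin]
  rw [nsmul_eq_mul, mul_pow]
  push_cast
  rfl

/-- The injection that picks the element `f a` of the block `a`. -/
def pick (ι : Fin s × Fin r ↪ Fin n) (f : Fin s → Fin r) (a : Fin s) : Fin n := ι (a, f a)

lemma pick_eq_iff (ι : Fin s × Fin r ↪ Fin n) (f g : Fin s → Fin r) (a b : Fin s) :
    pick ι f a = pick ι g b ↔ a = b ∧ f a = g b := by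
  simp [pick, Prod.ext_iff]

lemma pick_injective (ι : Fin s × Fin r ↪ Fin n) (f : Fin s → Fin r) :
    Function.Injective (pick ι f) := fun a b h => ((pick_eq_iff ι f f a b).1 h).1

/-- Different blocks are disjoint, so two picks share a vertex only within one block. Variances
therefore enter only at matches, and all s² pairs contribute at most c. -/
lemma cov_degSum_spike_pick_le (w : Config n → ℝ) (A : ℝ) (ι : Fin s × Fin r ↪ Fin n) {V c : ℝ}
    (hc0 : 0 ≤ c) (hV : ∀ i, cov w (fun Y => deg Y i) (fun Y => deg Y i) ≤ V)
    (hc : ∀ i j, i ≠ j → cov w (fun Y => deg Y i) (fun Y => deg Y j) ≤ c) (f g : Fin s → Fin r) :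
    cov w (degSum (spike A (pick ι f))) (degSum (spike A (pick ι g))) ≤
      A ^ 2 * ((s : ℝ) ^ 2 * c) + ∑ a, if f a = g a then A ^ 2 * V else 0 := by
  rw [cov_degSum_spike w A (pick_injective ι f) (pick_injective ι g)]
  have h1 : ∀ a b, cov w (fun Y => deg Y (pick ι f a)) (fun Y => deg Y (pick ι g b)) ≤
      c + if a = b then (if f a = g a then V else 0) else 0 := by
    intro a b
    by_cases h : pick ι f a = pick ι g b
    · obtain ⟨rfl, h2⟩ := (pick_eq_iff ι f g a b).1 h
      rw [← h, if_pos rfl, if_pos h2]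
      linarith [hV (pick ι f a)]
    · refine (hc _ _ h).trans (le_add_of_nonneg_right ?_)
      split_ifs with h2 h3
      · subst h2
        exact absurd ((pick_eq_iff ι f g a a).2 ⟨rfl, h3⟩) h
      · exact le_rfl
      · exact le_rfl
  have h2 : ∑ a, ∑ b, cov w (fun Y => deg Y (pick ι f a)) (fun Y => deg Y (pick ι g b)) ≤
      (s : ℝ) ^ 2 * c + ∑ a, if f a = g a then V else 0 := by
    refine (Finset.sum_le_sum fun a _ => Finset.sum_le_sum fun b _ => h1 a b).trans (le_of_eq ?_)
    simp only [Finset.sum_add_distrib, Finset.sum_ite_eq, Finset.mem_univ, if_true]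
    simp
    ring
  refine (mul_le_mul_of_nonneg_left h2 (sq_nonneg A)).trans (le_of_eq ?_)
  rw [mul_add, Finset.mul_sum]
  congr 1
  refine Finset.sum_congr rfl fun a _ => ?_
  split_ifs <;> simp

/-- The second moment of the likelihood ratio of the mixture over the prior. -/
lemma sum_sum_mass_div_le (hn : 2 ≤ n) (hθ : 0 ≤ θ) {β : Fin n → ℝ} (hβ : ∀ i, 0 ≤ β i)
    {A C : ℝ} (hA : 0 ≤ A) (hC : 0 ≤ C) (ι : Fin s × Fin r ↪ Fin n) (hr : 0 < r)
    (hV : ∀ i, cov (weight θ β) (fun Y => deg Y i) (fun Y => deg Y i) ≤ C * n)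
    (hc : ∀ i j, i ≠ j → cov (weight θ β) (fun Y => deg Y i) (fun Y => deg Y j) ≤ 2 * C)
    (hAn : A ^ 2 * n ≤ 1) (hsA : s * A ≤ 2) (hsr : n ≤ 2 * (s * r)) :
    ∑ f : Fin s → Fin r, ∑ g : Fin s → Fin r, ∑ Y,
      mass θ (β + spike A (pick ι f)) Y * mass θ (β + spike A (pick ι g)) Y / mass θ β Y ≤
      Real.exp (2 * C + 2 * C * Real.exp C) * (Fintype.card (Fin s → Fin r) : ℝ) ^ 2 := by
  have hr0 : (0 : ℝ) < r := by exact_mod_cast hr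
  have hn0 : (0 : ℝ) < n := by positivity
  set l := 1 / 4 * (A ^ 2 * (C * n)) with hl
  have hl0 : 0 ≤ l := by positivity
  have hlC : l ≤ C := by
    have : A ^ 2 * n * C ≤ 1 * C := by gcongr
    rw [hl]; linarith
  have hsA2 : ((s : ℝ) * A) ^ 2 ≤ 4 := by
    have := pow_le_pow_left₀ (by positivity) hsA 2
    linarith
  have h1 : ∀ f g : Fin s → Fin r, ∑ Y,
      mass θ (β + spike A (pick ι f)) Y * mass θ (β + spike A (pick ι g)) Y / mass θ β Y ≤
      Real.exp (2 * C) * ∏ a, (if f a = g a then Real.exp l else 1) := by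
    intro f g
    refine (sum_mass_mul_mass_div_le hn hθ hβ (spike_nonneg hA _) (spike_nonneg hA _)).trans ?_
    have h2 := cov_degSum_spike_pick_le (weight θ β) A ι (by positivity) hV hc f g
    have h3 : ∏ a, (if f a = g a then Real.exp l else 1) =
        Real.exp (∑ a, if f a = g a then l else 0) := by
      rw [Real.exp_sum]
      refine Finset.prod_congr rfl fun a _ => ?_
      split_ifs <;> simp
    have h4 : ∑ a, (if f a = g a then l else 0) =
        1 / 4 * ∑ a, if f a = g a then A ^ 2 * (C * n) else 0 := by
      rw [Finset.mul_sum]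
      refine Finset.sum_congr rfl fun a _ => ?_
      split_ifs <;> simp [hl]
    rw [h3, ← Real.exp_add, h4]
    refine Real.exp_le_exp.2 ?_
    have h5 : ((s : ℝ) * A) ^ 2 * C ≤ 4 * C := by gcongr
    have h6 : A ^ 2 * ((s : ℝ) ^ 2 * (2 * C)) = 2 * (((s : ℝ) * A) ^ 2 * C) := by ring
    linarith
  -- Up to normalization this is (1 + (e^l − 1)/r)^s ≤ exp(s(e^l − 1)/r). Since e^l − 1 ≤ l e^C, it
  -- remains to bound sl/r, which is of order (sA)² because n ≤ 2sr.
  have h7 : ((r : ℝ) * (r - 1 + Real.exp l)) ^ s ≤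
      Real.exp (2 * C * Real.exp C) * (Fintype.card (Fin s → Fin r) : ℝ) ^ 2 := by
    have h8 : (r : ℝ) * (r - 1 + Real.exp l) = r ^ 2 * (1 + (Real.exp l - 1) / r) := by
      field_simp
      ring
    have h9 : Real.exp l - 1 ≤ l * Real.exp C := by
      have h10 : 1 - l ≤ Real.exp (-l) := by linarith [Real.add_one_le_exp (-l)]
      have h11 : (1 - l) * Real.exp l ≤ 1 := by
        calc (1 - l) * Real.exp l ≤ Real.exp (-l) * Real.exp l := by gcongr
          _ = 1 := by rw [← Real.exp_add]; simp
      have h12 : l * Real.exp l ≤ l * Real.exp C := by gcongr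
      linarith
    have h13 : (s : ℝ) * ((Real.exp l - 1) / r) ≤ 2 * C * Real.exp C := by
      rw [← mul_div_assoc, div_le_iff₀ hr0]
      have h14 : (s : ℝ) * l ≤ 2 * C * r := by
        have h15 : (n : ℝ) ≤ 2 * (s * r) := by exact_mod_cast hsr
        calc (s : ℝ) * l = 1 / 4 * (A ^ 2 * C * s) * n := by rw [hl]; ring
          _ ≤ 1 / 4 * (A ^ 2 * C * s) * (2 * (s * r)) := by gcongr
          _ = 1 / 2 * C * r * ((s : ℝ) * A) ^ 2 := by ring
          _ ≤ 1 / 2 * C * r * 4 := by gcongr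
          _ = _ := by ring
      calc (s : ℝ) * (Real.exp l - 1) ≤ s * (l * Real.exp C) := by gcongr
        _ = s * l * Real.exp C := by ring
        _ ≤ 2 * C * r * Real.exp C := by gcongr
        _ = _ := by ring
    have h16 : 0 ≤ (Real.exp l - 1) / r :=
      div_nonneg (by linarith [Real.one_le_exp hl0]) hr0.le
    rw [h8, mul_pow, mul_comm]
    have h17 : ((r : ℝ) ^ 2) ^ s = (Fintype.card (Fin s → Fin r) : ℝ) ^ 2 := by
      rw [Fintype.card_fun, Fintype.card_fin, Fintype.card_fin]
      push_cast
      rw [← pow_mul, ← pow_mul, mul_comm]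
    rw [h17]
    refine mul_le_mul_of_nonneg_right ?_ (by positivity)
    calc (1 + (Real.exp l - 1) / r) ^ s ≤ Real.exp ((Real.exp l - 1) / r) ^ s := by
          refine pow_le_pow_left₀ (by linarith) ?_ s
          rw [add_comm]
          exact Real.add_one_le_exp _
      _ = Real.exp (s * ((Real.exp l - 1) / r)) := by rw [← Real.exp_nat_mul]
      _ ≤ _ := Real.exp_le_exp.2 h13
  calc _ ≤ ∑ f : Fin s → Fin r, ∑ g : Fin s → Fin r,
        Real.exp (2 * C) * ∏ a, (if f a = g a then Real.exp l else 1) :=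
        Finset.sum_le_sum fun f _ => Finset.sum_le_sum fun g _ => h1 f g
    _ = Real.exp (2 * C) * ((r : ℝ) * (r - 1 + Real.exp l)) ^ s := by
        rw [← sum_sum_prod_ite]
        simp only [Finset.mul_sum]
    _ ≤ Real.exp (2 * C) *
        (Real.exp (2 * C * Real.exp C) * (Fintype.card (Fin s → Fin r) : ℝ) ^ 2) := by gcongr
    _ = _ := by rw [← mul_assoc, ← Real.exp_add]

/-- The testing lower bound in the selecting field. -/
lemma le_prob_add_average (hn : 2 ≤ n) (hθ : 0 ≤ θ) {β : Fin n → ℝ} (hβ : ∀ i, 0 ≤ β i)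
    {A C : ℝ} (hA : 0 ≤ A) (hC : 0 ≤ C) (ι : Fin s × Fin r ↪ Fin n) (hr : 0 < r)
    (hV : ∀ i, cov (weight θ β) (fun Y => deg Y i) (fun Y => deg Y i) ≤ C * n)
    (hc : ∀ i j, i ≠ j → cov (weight θ β) (fun Y => deg Y i) (fun Y => deg Y j) ≤ 2 * C)
    (hAn : A ^ 2 * n ≤ 1) (hsA : s * A ≤ 2) (hsr : n ≤ 2 * (s * r)) (R : Set (Config n)) :
    1 / (4 * Real.exp (2 * C + 2 * C * Real.exp C)) ≤ prob θ β R +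
      (∑ f : Fin s → Fin r, prob θ (β + spike A (pick ι f)) Rᶜ) /
        Fintype.card (Fin s → Fin r) := by
  have : NeZero r := ⟨hr.ne'⟩
  have := testing_lower_bound (Real.one_le_exp (show 0 ≤ 2 * C + 2 * C * Real.exp C by positivity))
    (mass_pos θ β) (fun f Y => (mass_pos θ (β + spike A (pick ι f)) Y).le)
    (fun f => sum_mass θ _) (sum_sum_mass_div_le hn hθ hβ hA hC ι hr hV hc hAn hsA hsr) R
  simpa only [prob_eq_sum] using this

end SecondMoment

/-! ### Removing the selecting field at bounded cost. -/

section Transfer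

variable {n : ℕ} {θ : ℝ}

/-- Removing the selecting field costs a bounded factor where the sum of the degrees is close to
its typical value. -/
lemma prob_le_of_partitionFn_le (hn : 2 ≤ n) (hθ : 0 ≤ θ) {h a L : ℝ} (hh : 0 ≤ h)
    (hZ : 1 / 4 * Real.exp (h / 2 * (a - L)) * partitionFn θ (nullParam n 0) ≤
      partitionFn θ (nullParam n h)) {L' : ℝ} (hL : h * (L + L') ≤ 2)
    {γ : Fin n → ℝ} (hγ : ∀ i, 0 ≤ γ i) (S : Set (Config n)) :
    prob θ (nullParam n h + γ) S ≤ 4 * Real.exp 1 * prob θ (nullParam n 0 + γ) S +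
      prob θ (nullParam n h + γ) {Y | L' < |totalDeg Y - a|} := by
  -- The bound on the partition function is known only at the null; by `partitionFn_mul_ge` the gain
  -- from the field is at least as large in the presence of γ.
  have hZ' : 1 / 4 * Real.exp (h / 2 * (a - L)) * partitionFn θ (nullParam n 0 + γ) ≤
      partitionFn θ (nullParam n h + γ) := by
    have h1 := partitionFn_mul_ge hn hθ (β := nullParam n 0) (g := γ) (g' := nullParam n h)
      (fun _ => le_rfl) hγ (fun _ => hh)
    rw [nullParam_zero_add] at h1
    rw [nullParam_zero_add (nullParam n h)] at h1
    rw [nullParam_zero_add]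
    have h2 := partitionFn_pos θ (nullParam n 0)
    have h3 := partitionFn_pos θ γ
    refine le_of_mul_le_mul_right ?_ h2
    calc _ = partitionFn θ γ *
          (1 / 4 * Real.exp (h / 2 * (a - L)) * partitionFn θ (nullParam n 0)) := by ring
      _ ≤ partitionFn θ γ * partitionFn θ (nullParam n h) := by gcongr
      _ ≤ _ := h1
  set Z := partitionFn θ (nullParam n 0 + γ) with hZdef
  set Zh := partitionFn θ (nullParam n h + γ) with hZhdef
  have hZ0 : 0 < Z := partitionFn_pos _ _
  have hZh0 : 0 < Zh := partitionFn_pos _ _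
  -- The density ratio is at most 4 exp((h/2)(total degree − a + L)), and the exponent is at most
  -- h(L' + L)/2 ≤ 1.
  have key : ∀ Y : Config n, |totalDeg Y - a| ≤ L' →
      mass θ (nullParam n h + γ) Y ≤ 4 * Real.exp 1 * mass θ (nullParam n 0 + γ) Y := by
    intro Y hY
    have hw : weight θ (nullParam n h + γ) Y =
        weight θ (nullParam n 0 + γ) Y * Real.exp (h / 2 * totalDeg Y) := by
      rw [nullParam_zero_add, add_comm, weight_add_null]
    have hw0 := weight_pos θ (nullParam n 0 + γ) Y
    rw [mass, mass, hw, div_le_iff₀ hZh0, ← hZdef, ← mul_div_assoc,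
      div_mul_eq_mul_div (4 * Real.exp 1 * _) Z, le_div_iff₀ hZ0]
    have h4 : Real.exp (h / 2 * totalDeg Y) ≤ Real.exp 1 * Real.exp (h / 2 * (a - L)) := by
      rw [← Real.exp_add]
      refine Real.exp_le_exp.2 ?_
      have h5 : h / 2 * (totalDeg Y - a) ≤ h / 2 * L' :=
        mul_le_mul_of_nonneg_left ((le_abs_self _).trans hY) (by positivity)
      nlinarith
    calc _ ≤ weight θ (nullParam n 0 + γ) Y * (Real.exp 1 * Real.exp (h / 2 * (a - L))) * Z := by
          gcongr
      _ = 4 * Real.exp 1 * weight θ (nullParam n 0 + γ) Y *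
          (1 / 4 * Real.exp (h / 2 * (a - L)) * Z) := by ring
      _ ≤ _ := by gcongr
  simp only [prob_eq_sum]
  rw [Finset.mul_sum, ← Finset.sum_add_distrib]
  refine Finset.sum_le_sum fun Y _ => ?_
  have hp := (mass_pos θ (nullParam n h + γ) Y).le
  have hp' := (mass_pos θ (nullParam n 0 + γ) Y).le
  have he := (Real.exp_pos 1).le
  by_cases hY : |totalDeg Y - a| ≤ L'
  · have h6 : Y ∉ {Y : Config n | L' < |totalDeg Y - a|} := not_lt.2 hY
    by_cases hS : Y ∈ S
    · simpa [hS, Set.indicator_of_notMem h6] using key Y hY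
    · simp [hS, Set.indicator_of_notMem h6]
  · have h6 : Y ∈ {Y : Config n | L' < |totalDeg Y - a|} := not_le.1 hY
    have h7 : 0 ≤ 4 * Real.exp 1 * mass θ (nullParam n 0 + γ) Y := by positivity
    by_cases hS : Y ∈ S
    · simpa [hS, Set.indicator_of_mem h6] using h7
    · simpa [hS, Set.indicator_of_mem h6] using hp

/-- The sum of the degrees stays close to its typical value under a small perturbation. -/
lemma avg_totalDeg_sub_sq_le (hn : 2 ≤ n) (hθ : 0 ≤ θ) {h a A C : ℝ} (hh : 0 ≤ h) (hA : 0 ≤ A)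
    (hC : 0 ≤ C)
    (hK : avg (weight θ (nullParam n h)) (fun Y => (totalDeg Y - a) ^ 2) ≤ C * (n : ℝ) ^ 2)
    (hV : ∀ i, cov (weight θ (nullParam n h)) (fun Y => deg Y i) (fun Y => deg Y i) ≤ C * n)
    (hc : ∀ i j, i ≠ j →
      cov (weight θ (nullParam n h)) (fun Y => deg Y i) (fun Y => deg Y j) ≤ 2 * C)
    {s : ℕ} (hsA : s * A ≤ 2) {φ : Fin s → Fin n} (hφ : Function.Injective φ) :
    avg (weight θ (nullParam n h + spike A φ)) (fun Y => (totalDeg Y - a) ^ 2) ≤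
      (3 * C + 18 * C ^ 2) * (n : ℝ) ^ 2 := by
  set w := weight θ (nullParam n h) with hw
  set w' := weight θ (nullParam n h + spike A φ) with hw'
  have hwp := weight_pos θ (nullParam n h)
  -- By GHS the spike does not increase the variance, so no fresh analysis of the perturbed model is
  -- needed; below, its shift of the mean is bounded by half a covariance at the base point.
  have h1 : cov w' totalDeg totalDeg ≤ C * (n : ℝ) ^ 2 := by
    rw [← degSum_one]
    refine (cov_degSum_antitone hn hθ (fun _ => hh) (spike_nonneg hA φ) (fun _ => zero_le_one)
      (fun _ => zero_le_one)).trans ?_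
    rw [degSum_one]
    exact (cov_self_le hwp totalDeg a).trans hK
  have h2 : (avg w totalDeg - a) ^ 2 ≤ C * (n : ℝ) ^ 2 := (sq_avg_sub_le hwp totalDeg a).trans hK
  have h3 : cov w totalDeg (degSum (spike A φ)) ≤ 6 * C * n := by
    rw [← degSum_one, cov_comm, cov_degSum]
    have h4 : ∀ i, ∑ j, (1 * cov w (fun Y => deg Y i) (fun Y => deg Y j)) ≤ 3 * C * n := by
      intro i
      have h5 : ∀ j, 1 * cov w (fun Y => deg Y i) (fun Y => deg Y j) ≤
          2 * C + if i = j then C * n else 0 := by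
        intro j
        rw [one_mul]
        split_ifs with h6
        · subst h6; linarith [hV i]
        · linarith [hc i j h6]
      refine (Finset.sum_le_sum fun j _ => h5 j).trans (le_of_eq ?_)
      simp only [Finset.sum_add_distrib, Finset.sum_ite_eq, Finset.mem_univ, if_true]
      simp
      ring
    simp only [← Finset.mul_sum] at h4 ⊢
    rw [sum_spike_mul A hφ]
    calc _ ≤ ∑ _a : Fin s, A * (3 * C * n) :=
          Finset.sum_le_sum fun a _ => mul_le_mul_of_nonneg_left (h4 _) hA
      _ = (s * A) * (3 * C * n) := by simp; ring
      _ ≤ 2 * (3 * C * n) := by gcongr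
      _ = _ := by ring
  have h6 := avg_degSum_sub_mem hn hθ (β := nullParam n h) (g := spike A φ)
    (g' := fun _ => 1) (fun _ => hh) (spike_nonneg hA φ) (fun _ => zero_le_one)
  rw [degSum_one, ← hw, ← hw'] at h6
  have h7 : (avg w' totalDeg - avg w totalDeg) ^ 2 ≤ (3 * C * n) ^ 2 :=
    pow_le_pow_left₀ h6.1 (h6.2.trans (by linarith)) 2
  rw [avg_sub_sq (weight_pos θ _)]
  nlinarith [sq_nonneg (avg w' totalDeg - avg w totalDeg - (avg w totalDeg - a))]

end Transfer

/-! ### Impossibility below the detection boundary. -/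

section LowerBound

variable {θ b t : ℝ}

/-- Blocks for the prior: `s ≈ n ^ b` blocks of about `n ^ (1 - b)` vertices each. -/
lemma eventually_exists_blocks (hb0 : 0 ≤ b) (hb1 : b < 1) :
    ∀ᶠ n : ℕ in atTop, ∃ s r : ℕ, (n : ℝ) ^ b ≤ s ∧ (s : ℝ) ≤ 2 * (n : ℝ) ^ b ∧ 0 < r ∧
      n ≤ 2 * (s * r) ∧ Nonempty (Fin s × Fin r ↪ Fin n) := by
  have h1 : Tendsto (fun n : ℕ => (n : ℝ) ^ (1 - b)) atTop atTop :=
    (tendsto_rpow_atTop (sub_pos.2 hb1)).comp tendsto_natCast_atTop_atTop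
  filter_upwards [h1.eventually_ge_atTop 4, eventually_ge_atTop 2] with n h4 hn
  have hn0 : (0 : ℝ) < n := by positivity
  have hnb : 1 ≤ (n : ℝ) ^ b := Real.one_le_rpow (by exact_mod_cast (by omega : 1 ≤ n)) hb0
  set s := ⌈(n : ℝ) ^ b⌉₊ with hs
  have hs1 : (n : ℝ) ^ b ≤ s := Nat.le_ceil _
  have hs2 : (s : ℝ) ≤ 2 * (n : ℝ) ^ b := by
    have := Nat.ceil_lt_add_one (show 0 ≤ (n : ℝ) ^ b by positivity)
    linarith
  have hs0 : 0 < s := by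
    have : (0 : ℝ) < s := by linarith
    exact_mod_cast this
  -- Room for blocks of size ⌊n/s⌋ ≥ 1 which together cover at least half of the vertices.
  have hsn : 2 * s ≤ n := by
    have h5 : (n : ℝ) ^ (1 - b) * (n : ℝ) ^ b = n := by
      rw [← Real.rpow_add hn0]; simp
    have h6 : 2 * (s : ℝ) ≤ n := by nlinarith
    exact_mod_cast h6
  have h7 : n < s * (n / s) + s := Nat.lt_mul_div_succ n hs0 |>.trans_eq (by ring)
  have h8 : n ≤ 2 * (s * (n / s)) := by omega
  refine ⟨s, n / s, hs1, hs2, Nat.div_pos (by omega) hs0, h8, ?_⟩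
  refine Function.Embedding.nonempty_of_card_le ?_
  simpa using Nat.mul_div_le n s

lemma IsMagnetization.exists_cov_bounds {m : ℝ} (hm : IsMagnetization θ m) :
    ∃ C > 0, ∀ᶠ n : ℕ in atTop,
      avg (weight θ (nullParam n (selectField m n)))
        (fun Y => (totalDeg Y - m * (n * ((n : ℝ) - 1))) ^ 2) ≤ C * (n : ℝ) ^ 2 ∧
      (∀ i, cov (weight θ (nullParam n (selectField m n))) (fun Y => deg Y i)
        (fun Y => deg Y i) ≤ C * n) ∧
      ∀ i j, i ≠ j → cov (weight θ (nullParam n (selectField m n))) (fun Y => deg Y i)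
        (fun Y => deg Y j) ≤ 2 * C := by
  obtain ⟨C, hC, h⟩ := hm.exists_moments
  refine ⟨C, hC, ?_⟩
  filter_upwards [h, eventually_ge_atTop 2] with n h1 hn
  have hn2 : (2 : ℝ) ≤ n := by exact_mod_cast hn
  have hw := weight_pos θ (nullParam n (selectField m n))
  refine ⟨h1.1, fun i => (cov_self_le hw _ _).trans (h1.2 i), fun i j hij => ?_⟩
  have h2 := (cov_deg_le hn θ (selectField m n) hij).trans ((cov_self_le hw _ _).trans h1.1)
  have h3 : (0 : ℝ) < n * ((n : ℝ) - 1) := mul_pos (by linarith) (by linarith)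
  refine le_of_mul_le_mul_left (h2.trans ?_) h3
  have h4 : (n : ℝ) * n ≤ n * (2 * ((n : ℝ) - 1)) := by
    refine mul_le_mul_of_nonneg_left ?_ ?_ <;> linarith
  nlinarith

lemma risk_le_two {n : ℕ} (θ β₀ s A : ℝ) (T : Test n) : risk θ β₀ s A T ≤ 2 := by
  have := risk_le (θ := θ) (β₀ := β₀) (s := s) (A := A) (T := T) zero_le_one
    (prob_le_one _ _ _) fun _ _ _ => prob_le_one _ _ _
  linarith

lemma prob_le_iSup_alternative {n : ℕ} {β₀ s A : ℝ} {β : Fin n → ℝ} (hβ : β ∈ alternative n β₀ s A)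
    (S : Set (Config n)) :
    prob θ β S ≤ ⨆ β : alternative n β₀ s A, prob θ (β : Fin n → ℝ) S :=
  le_ciSup (f := fun β : alternative n β₀ s A => prob θ (β : Fin n → ℝ) S)
    ⟨1, by rintro _ ⟨β, rfl⟩; exact prob_le_one _ _ _⟩ ⟨β, hβ⟩

/-- No test is asymptotically powerful against weak sparse signals. -/
theorem asympNotPowerful (hθ : 1 / 2 < θ) (hb0 : 0 ≤ b) (hb1 : b < 1) (ht : t ≤ -1 / 2)
    (hbt : b + t ≤ 0) (T : ∀ n, Test n) :
    AsympNotPowerful θ 0 (fun n => (n : ℝ) ^ b) (fun n => (n : ℝ) ^ t) T := by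
  obtain ⟨m, hm⟩ := exists_isMagnetization hθ
  have hθ0 := hm.theta_pos
  have hm0 := hm.pos
  obtain ⟨C, hC, hcov⟩ := hm.exists_cov_bounds
  obtain ⟨B, hB, hpart⟩ := hm.exists_partitionFn_ge
  set M := Real.exp (2 * C + 2 * C * Real.exp C) with hM
  have hM0 : 0 < M := Real.exp_pos _
  set V := 3 * C + 18 * C ^ 2 with hV
  have hV0 : 0 < V := by positivity
  -- Chosen so that Chebyshev gives V/B'² = 1/(16M): the two transfers then lose only half of the
  -- testing bound 1/(4M).
  set B' := Real.sqrt (16 * M * V) with hB'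
  have hB'0 : 0 < B' := Real.sqrt_pos.2 (by positivity)
  have hB'2 : B' ^ 2 = 16 * M * V := Real.sq_sqrt (by positivity)
  suffices h : ∀ᶠ n : ℕ in atTop, 1 / (32 * (M * Real.exp 1)) ≤
      risk θ 0 ((n : ℝ) ^ b) ((n : ℝ) ^ t) (T n) by
    refine lt_of_lt_of_le (show 0 < 1 / (32 * (M * Real.exp 1)) by positivity)
      (le_liminf_of_le ?_ h)
    exact (isBoundedUnder_of ⟨2, fun n => risk_le_two _ _ _ _ _⟩).isCoboundedUnder_ge
  filter_upwards [hcov, hpart, eventually_exists_blocks hb0 hb1, eventually_ge_atTop 2,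
    eventually_selectField_mul_le hm0 (show 0 < 2 / (B + B') by positivity)]
    with n ⟨hK, hVar, hCov⟩ hZ ⟨s, r, hs1, hs2, hr, hsr, ⟨ι⟩⟩ hn hhn
  have hn1 : (1 : ℝ) ≤ n := by exact_mod_cast (by omega : 1 ≤ n)
  have hn0 : (0 : ℝ) < n := by linarith
  set h := selectField m n with hh
  have hh0 : 0 ≤ h := selectField_nonneg hm0 n
  set A := (n : ℝ) ^ t with hA
  have hA0 : 0 < A := Real.rpow_pos_of_pos hn0 t
  have hAn : A ^ 2 * n ≤ 1 := by
    have h1 : A ^ 2 * n = (n : ℝ) ^ (t + t + 1) := by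
      rw [Real.rpow_add hn0, Real.rpow_add hn0, Real.rpow_one, sq]
    rw [h1]
    exact rpow_nonpos_le_one (by omega) (by linarith)
  have hsA : (s : ℝ) * A ≤ 2 := by
    have h1 : (n : ℝ) ^ b * A = (n : ℝ) ^ (b + t) := by rw [hA, Real.rpow_add hn0]
    have h2 : (n : ℝ) ^ (b + t) ≤ 1 := rpow_nonpos_le_one (by omega) hbt
    calc (s : ℝ) * A ≤ 2 * (n : ℝ) ^ b * A := by gcongr
      _ = 2 * ((n : ℝ) ^ b * A) := by ring
      _ ≤ _ := by rw [h1]; linarith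
  set a := m * (n * ((n : ℝ) - 1)) with ha
  have hL : h * (B * n + B' * n) ≤ 2 := by
    calc h * (B * n + B' * n) = h * n * (B + B') := by ring
      _ ≤ 2 / (B + B') * (B + B') := by gcongr
      _ = 2 := by field_simp
  set D := 4 * Real.exp 1 with hD
  have hD0 : 0 < D := by positivity
  have hdev : ∀ γ : Fin n → ℝ, avg (weight θ (nullParam n h + γ)) (fun Y => (totalDeg Y - a) ^ 2) ≤
      V * (n : ℝ) ^ 2 →
      prob θ (nullParam n h + γ) {Y | B' * n < |totalDeg Y - a|} ≤ 1 / (16 * M) := by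
    intro γ hγ
    refine (prob_le_avg_div θ _ _ (show 0 < (B' * n) ^ 2 by positivity) _ (fun Y => sq_nonneg _)
      (fun Y hY => ?_)).trans ((div_le_div_of_nonneg_right hγ (by positivity)).trans (le_of_eq ?_))
    · rw [← sq_abs (_ - a)]
      exact pow_le_pow_left₀ (by positivity) (le_of_lt hY) 2
    · rw [mul_pow, hB'2]
      field_simp
  have htrans : ∀ γ : Fin n → ℝ, (∀ i, 0 ≤ γ i) →
      avg (weight θ (nullParam n h + γ)) (fun Y => (totalDeg Y - a) ^ 2) ≤ V * (n : ℝ) ^ 2 →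
      ∀ S, prob θ (nullParam n h + γ) S ≤ D * prob θ (nullParam n 0 + γ) S + 1 / (16 * M) :=
    fun γ hγ hγ' S => (prob_le_of_partitionFn_le hn hθ0.le hh0 (hZ h hh0) hL hγ S).trans
      (add_le_add_right (hdev γ hγ') _)
  set R : Set (Config n) := {Y | T n Y = 1} with hR
  have hRc : Rᶜ = {Y | T n Y = 0} := by
    ext Y
    simp only [hR, Set.mem_compl_iff, Set.mem_ofPred_eq]
    omega
  -- The testing bound holds in the selecting field; both error terms are moved back to field zero,
  -- here the type I error, which is the case γ = 0.
  have hnull : prob θ (nullParam n h) R ≤ D * prob θ (nullParam n 0) R + 1 / (16 * M) := by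
    have := htrans 0 (fun _ => le_rfl) (by
      rw [add_zero]
      refine hK.trans (mul_le_mul_of_nonneg_right ?_ (by positivity))
      rw [hV]; nlinarith) R
    simpa only [add_zero] using this
  set W := ⨆ β : alternative n 0 ((n : ℝ) ^ b) A, prob θ (β : Fin n → ℝ) {Y | T n Y = 0} with hW
  have halt : ∀ f : Fin s → Fin r, prob θ (nullParam n h + spike A (pick ι f)) Rᶜ ≤
      D * W + 1 / (16 * M) := by
    intro f
    refine (htrans _ (spike_nonneg hA0.le _) (avg_totalDeg_sub_sq_le hn hθ0.le hh0 hA0.le hC.le hK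
      hVar hCov hsA (pick_injective ι f)) _).trans ?_
    rw [hRc]
    have := prob_le_iSup_alternative (θ := θ)
      (spike_mem_alternative (β₀ := 0) hA0.ne' (pick_injective ι f) hs1) {Y | T n Y = 0}
    gcongr
  have hmain := le_prob_add_average hn hθ0.le (β := nullParam n h) (fun _ => hh0) hA0.le hC.le ι hr
    hVar hCov hAn hsA hsr R
  have : NeZero r := ⟨hr.ne'⟩
  have hcard : (0 : ℝ) < Fintype.card (Fin s → Fin r) := by exact_mod_cast Fintype.card_pos
  have havg : (∑ f : Fin s → Fin r, prob θ (nullParam n h + spike A (pick ι f)) Rᶜ) /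
      Fintype.card (Fin s → Fin r) ≤ D * W + 1 / (16 * M) := by
    rw [div_le_iff₀ hcard]
    refine (Finset.sum_le_sum fun f _ => halt f).trans (le_of_eq ?_)
    rw [Finset.sum_const, Finset.card_univ, nsmul_eq_mul, mul_comm]
  have hrisk : risk θ 0 ((n : ℝ) ^ b) A (T n) = prob θ (nullParam n 0) R + W := rfl
  rw [hrisk]
  have h1 : 1 / (4 * M) ≤ D * (prob θ (nullParam n 0) R + W) + 2 * (1 / (16 * M)) := by
    rw [← hM] at hmain
    linarith
  -- The remainder 1/(8M), divided by the transfer factor 4e, is the lower bound for the risk.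
  have h2 : 1 / (4 * M) - 2 * (1 / (16 * M)) = D * (1 / (32 * (M * Real.exp 1))) := by
    rw [hD]
    field_simp
    norm_num
  refine le_of_mul_le_mul_left ?_ hD0
  rw [← h2]
  linarith

end LowerBound

end TwoStar

end

/-! ### The four regimes. -/

theorem theorem4 (θ β₀ : ℝ) (hΘ : (θ, β₀) ∈ TwoStar.lowTemp) :
    ∃ C : ℝ, 0 < C ∧ ∀ b t : ℝ, 0 < b → b < 1 → t < 0 →
      (1 / 2 ≤ b → b + t < 0 →
        ∀ T : ∀ n, TwoStar.Test n,
          TwoStar.AsympNotPowerful θ β₀ (fun n => (n : ℝ) ^ b) (fun n => (n : ℝ) ^ t) T) ∧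
      (1 / 2 ≤ b → 0 < b + t →
        ∀ L : ℕ → ℝ, Tendsto (fun n => L n / (n : ℝ)) atTop atTop →
          Tendsto (fun n => L n / ((n : ℝ) * (n : ℝ) ^ b * (n : ℝ) ^ t)) atTop (𝓝 0) →
          TwoStar.AsympPowerful θ β₀ (fun n => (n : ℝ) ^ b) (fun n => (n : ℝ) ^ t)
            (fun n => TwoStar.sumTest n θ β₀ (L n))) ∧
      (b < 1 / 2 → t + 1 / 2 ≤ 0 →
        ∀ T : ∀ n, TwoStar.Test n,
          TwoStar.AsympNotPowerful θ β₀ (fun n => (n : ℝ) ^ b) (fun n => (n : ℝ) ^ t) T) ∧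
      (b < 1 / 2 → 0 < t + 1 / 2 →
        TwoStar.AsympPowerful θ β₀ (fun n => (n : ℝ) ^ b) (fun n => (n : ℝ) ^ t)
          (fun n => TwoStar.maxTest n θ β₀ (C * Real.sqrt ((n : ℝ) * Real.log n)))) := by
  obtain ⟨hθ, rfl⟩ : 1 / 2 < θ ∧ β₀ = 0 := hΘ
  have hθ0 : 0 ≤ θ := by linarith
  -- The constant is the cut-off of the max test. Both impossibility regimes satisfy t ≤ −1/2 and b
  -- + t ≤ 0, which is all that the lower bound uses.
  refine ⟨3 * (2 + 4 * θ) + 2, by positivity, fun b t hb0 hb1 ht => ⟨?_, ?_, ?_, ?_⟩⟩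
  · exact fun hb hbt T =>
      TwoStar.asympNotPowerful hθ hb0.le hb1 (by linarith) hbt.le T
  · exact fun _ hbt L hL hL' => TwoStar.asympPowerful_sumTest hθ0 ht hbt hL hL'
  · exact fun hb ht' T =>
      TwoStar.asympNotPowerful hθ hb0.le hb1 (by linarith) (by linarith) T
  · exact fun _ ht' => TwoStar.asympPowerful_maxTest hθ0 ht ht'
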